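/- For positive integers $k_1,\dots,k_d$ let $\zeta^*(k_1,\dots,k_d)\in\mathbb R$ be the stuffle regularized multiple zeta value, normalized by $\zeta^*(1)=0$: it is the value at $T=0$ of the unique polynomial $Z(T)\in\mathbb R[T]$ with $$\sum_{0<m_1<\cdots<m_d\le N}\frac1{m_1^{k_1}\cdots m_d^{k_d}}-Z(\log N+\gamma)\longrightarrow 0\qquad(N\to\infty),$$ where $\gamma$ is Euler's constant; if $k_d\ge 2$ it is the usual multiple zeta value. Its value at the empty index is $1$. Let $$\zeta^{\star,*}(k_1,\dots,k_d)=\sum_{\square_1,\dots,\square_{d-1}\in\{\text{comma},\,+\}}\zeta^*(k_1\,\square_1\cdots\square_{d-1}\,k_d)$$ (equal to $1$ at the empty index), and for $a\ge 0$ let $$\zeta^*_a(k_1,\dots,k_d)=(-1)^a\sum_{\substack{a_1+\cdots+a_d=a\\ a_1,\dots,a_d\ge 0}}\zeta^*(k_1+a_1,\dots,k_d+a_d)\prod_{j=1}^d\binom{k_j-1+a_j}{a_j},$$ so that for the empty index it is $1$ if $a=0$ and $0$ if $a>0$. Let $\delta^{k_1,\dots,k_d}=\frac{(-1)^n\pi^{2n}}{(2n)!}$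 if $d=2n$ is even and $k_1=\cdots=k_d=1$, and $\delta^{k_1,\dots,k_d}=0$ otherwise. Let $B_n$ denote the Bernoulli numbers. **Theorem.** For all positive integers $k_1,\dots,k_d$ with $\sum_{j=1}^d k_j\not\equiv d\pmod 2$, $$\begin{aligned}\zeta^*(k_1,\dots,k_d)={}&\frac{\zeta^*(k_1,\dots,k_d)-\zeta^{\star,*}(k_1,\dots,k_d)}2-\frac12\sum_{i=0}^{d-1}(-1)^{d-i}\,\zeta^{\star,*}(k_1,\dots,k_i)\,\delta^{k_{i+1},\dots,k_d}\\&-\sum_{0\le i<j\le d}\ \sum_{\substack{a+2m+b=k_j\\ a,b,m\ge0}}(-1)^{m+i+b+k_1+\cdots+k_j}\frac{(2\pi)^{2m}}{2\,(2m)!}B_{2m}\,\zeta^{\star,*}(k_1,\dots,k_i)\,\zeta^*_a(k_{j-1},\dots,k_{i+1})\,\zeta^*_b(k_{j+1},\dots,k_d).\end{aligned}$$ -/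

import Mathlib

open Filter Topology

namespace MZV

/-- The truncated sum `∑ 1 / (m₁ ^ k₁ ⋯ m_d ^ k_d)` over all integers `a < m₁ < ⋯ < m_d ≤ N`. -/
noncomputable def truncSum (N : ℕ) : ℕ → List ℕ+ → ℝ
  | _, [] => 1
  | a, k :: ks => ∑ m ∈ Finset.Ioc a N, 1 / (m : ℝ) ^ (k : ℕ) * truncSum N m ks

/-- `P` is the polynomial (in the variable `T = log N + γ`) that describes the growth of the
truncated multiple harmonic sums `∑_{0 < m₁ < ⋯ < m_d ≤ N} 1 / (m₁ ^ k₁ ⋯ m_d ^ k_d)`,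
up to an error that tends to zero. -/
def IsRegPoly (k : List ℕ+) (P : Polynomial ℝ) : Prop :=
  Tendsto (fun N : ℕ =>
    truncSum N 0 k - P.eval (Real.log N + Real.eulerMascheroniConstant)) atTop (𝓝 0)

/-! ### Existence and uniqueness of the regularization polynomial -/

/-- `log N + γ` -/
noncomputable def logGamma (N : ℕ) : ℝ := Real.log N + Real.eulerMascheroniConstant

/-- Sequences that tend to zero faster than every power of `log N + γ`. -/
def Negligible (f : ℕ → ℝ) : Prop :=
  ∀ j : ℕ, Tendsto (fun N => f N * logGamma N ^ j) atTop (𝓝 0)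

/-- Polynomial growth in `log N + γ`, up to a negligible error. -/
def HasExpansion (f : ℕ → ℝ) : Prop :=
  ∃ P : Polynomial ℝ, Negligible (fun N => f N - P.eval (logGamma N))

theorem tendsto_logGamma : Tendsto logGamma atTop atTop :=
  tendsto_atTop_add_const_right _ _ (Real.tendsto_log_atTop.comp tendsto_natCast_atTop_atTop)

theorem Negligible.add {f g : ℕ → ℝ} (hf : Negligible f) (hg : Negligible g) :
    Negligible (fun N => f N + g N) := fun j => by
  simpa [add_mul] using (hf j).add (hg j)

theorem Negligible.const_mul {f : ℕ → ℝ} (c : ℝ) (hf : Negligible f) :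
    Negligible (fun N => c * f N) := fun j => by
  simpa [mul_assoc] using (hf j).const_mul c

theorem Negligible.mul {f g : ℕ → ℝ} (hf : Negligible f) (hg : Negligible g) :
    Negligible (fun N => f N * g N) := fun j => by
  have h := (hf j).mul (hg 0)
  simp only [mul_zero, pow_zero, mul_one] at h
  refine h.congr fun N => ?_
  ring

theorem Negligible.mul_eval {f : ℕ → ℝ} (hf : Negligible f) (P : Polynomial ℝ) :
    Negligible (fun N => f N * P.eval (logGamma N)) := by
  induction P using Polynomial.induction_on' with
  | add p q hp hq =>
    have h := hp.add hq
    simpa only [Polynomial.eval_add, mul_add] using h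
  | monomial n c =>
    intro j
    have h := (hf (n + j)).const_mul c
    rw [mul_zero] at h
    refine h.congr fun N => ?_
    simp only [Polynomial.eval_monomial]
    ring

theorem HasExpansion.add {f g : ℕ → ℝ} (hf : HasExpansion f) (hg : HasExpansion g) :
    HasExpansion (fun N => f N + g N) := by
  obtain ⟨P, hP⟩ := hf
  obtain ⟨Q, hQ⟩ := hg
  refine ⟨P + Q, ?_⟩
  have h := hP.add hQ
  convert h using 2 with N
  rw [Polynomial.eval_add]
  ring

theorem HasExpansion.const_mul {f : ℕ → ℝ} (c : ℝ) (hf : HasExpansion f) :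
    HasExpansion (fun N => c * f N) := by
  obtain ⟨P, hP⟩ := hf
  refine ⟨Polynomial.C c * P, ?_⟩
  have h := hP.const_mul c
  convert h using 2 with N
  rw [Polynomial.eval_mul, Polynomial.eval_C]
  ring

theorem HasExpansion.mul {f g : ℕ → ℝ} (hf : HasExpansion f) (hg : HasExpansion g) :
    HasExpansion (fun N => f N * g N) := by
  obtain ⟨P, hP⟩ := hf
  obtain ⟨Q, hQ⟩ := hg
  refine ⟨P * Q, ?_⟩
  have h := ((hP.mul_eval Q).add (hQ.mul_eval P)).add (hP.mul hQ)
  convert h using 2 with N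
  rw [Polynomial.eval_mul]
  ring

theorem hasExpansion_const (c : ℝ) : HasExpansion (fun _ => c) :=
  ⟨Polynomial.C c, fun j => by simp⟩

theorem HasExpansion.list_sum {F : List ℕ+ → ℕ → ℝ} (l : List (List ℕ+))
    (h : ∀ v ∈ l, HasExpansion (F v)) : HasExpansion (fun N => (l.map fun v => F v N).sum) := by
  induction l with
  | nil => simpa using hasExpansion_const 0
  | cons v l ih =>
    simp only [List.map_cons, List.sum_cons]
    exact (h v (by simp)).add (ih fun w hw => h w (by simp [hw]))

theorem negligible_of_le {f : ℕ → ℝ} (C : ℝ)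
    (h : ∀ᶠ N : ℕ in atTop, |f N| ≤ C * (N : ℝ) ^ (-(1 / 2) : ℝ)) : Negligible f := by
  intro j
  have h1 : Tendsto (fun N : ℕ => C * (N : ℝ) ^ (-(1 / 2) : ℝ) * logGamma N ^ j) atTop (𝓝 0) := by
    have h2 : Tendsto (fun x : ℝ => x ^ j * Real.exp (-(1 / 2) * x)) atTop (𝓝 0) := by
      have := tendsto_rpow_mul_exp_neg_mul_atTop_nhds_zero (j : ℝ) (1 / 2) (by norm_num)
      simpa using this
    have h3 := (h2.comp tendsto_logGamma).const_mul
      (C * Real.exp (1 / 2 * Real.eulerMascheroniConstant))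
    rw [mul_zero] at h3
    refine h3.congr' ?_
    filter_upwards [eventually_ge_atTop 1] with N hN
    have hN' : (0 : ℝ) < N := by exact_mod_cast hN
    simp only [Function.comp]
    rw [Real.rpow_def_of_pos hN']
    have : Real.exp (1 / 2 * Real.eulerMascheroniConstant) * Real.exp (-(1 / 2) * logGamma N)
        = Real.exp (Real.log N * (-(1 / 2))) := by
      rw [← Real.exp_add]
      congr 1
      unfold logGamma
      ring
    rw [← this]
    ring
  refine squeeze_zero_norm' ?_ h1
  filter_upwards [h, tendsto_logGamma.eventually_ge_atTop 0] with N hN h0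
  rw [norm_mul, norm_pow, Real.norm_eq_abs, Real.norm_eq_abs, abs_of_nonneg h0]
  exact mul_le_mul_of_nonneg_right hN (pow_nonneg h0 j)

theorem truncSum_one (N : ℕ) : truncSum N 0 [1] = (harmonic N : ℝ) := by
  rw [harmonic_eq_sum_Icc]
  simp only [truncSum, PNat.one_coe, pow_one, mul_one, one_div]
  push_cast
  rfl

theorem hasExpansion_one : HasExpansion (fun N => truncSum N 0 [1]) := by
  refine ⟨Polynomial.X, negligible_of_le 1 ?_⟩
  filter_upwards [eventually_ge_atTop 1] with N hN
  have hN' : (1 : ℝ) ≤ N := by exact_mod_cast hN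
  have h1 := Real.eulerMascheroniSeq_lt_eulerMascheroniConstant N
  have h2 := Real.eulerMascheroniConstant_lt_eulerMascheroniSeq' N
  rw [Real.eulerMascheroniSeq] at h1
  rw [Real.eulerMascheroniSeq', if_neg (by omega)] at h2
  rw [truncSum_one, Polynomial.eval_X, logGamma, one_mul]
  have h3 : Real.log ((N : ℝ) + 1) - Real.log N ≤ 1 / N := by
    rw [← Real.log_div (by positivity) (by positivity)]
    have := Real.log_le_sub_one_of_pos (x := ((N : ℝ) + 1) / N) (by positivity)
    have h4 : ((N : ℝ) + 1) / N - 1 = 1 / N := by field_simp; ring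
    linarith
  have h5 : 1 / (N : ℝ) ≤ (N : ℝ) ^ (-(1 / 2) : ℝ) := by
    rw [one_div, ← Real.rpow_neg_one]
    exact Real.rpow_le_rpow_of_exponent_le hN' (by norm_num)
  rw [abs_le]
  constructor <;> linarith

theorem truncSum_nonneg (N : ℕ) (k : List ℕ+) : ∀ a, 0 ≤ truncSum N a k := by
  induction k with
  | nil => intro a; simp [truncSum]
  | cons x k ih =>
    intro a
    exact Finset.sum_nonneg fun m _ => mul_nonneg (by positivity) (ih m)

theorem truncSum_le (N : ℕ) (k : List ℕ+) : ∀ a, truncSum N a k ≤ (harmonic N : ℝ) ^ k.length := by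
  induction k with
  | nil => intro a; simp [truncSum]
  | cons x k ih =>
    intro a
    rw [List.length_cons, pow_succ', ← truncSum_one]
    simp only [truncSum, PNat.one_coe, pow_one, mul_one]
    rw [Finset.sum_mul]
    calc ∑ m ∈ Finset.Ioc a N, 1 / (m : ℝ) ^ (x : ℕ) * truncSum N m k
        ≤ ∑ m ∈ Finset.Ioc a N, 1 / (m : ℝ) * (truncSum N 0 [1]) ^ k.length := by
          refine Finset.sum_le_sum fun m hm => ?_
          have hm1 : (1 : ℝ) ≤ m := by
            have := (Finset.mem_Ioc.1 hm).1
            exact_mod_cast (by omega : 1 ≤ m)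
          refine mul_le_mul ?_ ?_ (truncSum_nonneg N k m) (by positivity)
          · exact one_div_le_one_div_of_le (by positivity) (le_self_pow₀ hm1 x.ne_zero)
          · rw [truncSum_one]
            exact ih m
      _ ≤ _ := by
          simp only [truncSum, PNat.one_coe, pow_one, mul_one]
          refine Finset.sum_le_sum_of_subset_of_nonneg
            (Finset.Ioc_subset_Ioc_left (Nat.zero_le a)) fun m _ _ => ?_
          exact mul_nonneg (by positivity)
            (pow_nonneg (Finset.sum_nonneg fun _ _ => by positivity) _)

theorem truncSum_self (N : ℕ) (x : ℕ+) (k : List ℕ+) : truncSum N N (x :: k) = 0 := by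
  simp [truncSum]

/-- Splitting off the terms whose largest index is `N + 1`. -/
theorem truncSum_succ (N : ℕ) (x : ℕ+) (k : List ℕ+) : ∀ a ≤ N,
    truncSum (N + 1) a (k ++ [x]) =
      truncSum N a (k ++ [x]) + truncSum N a k / ((N : ℝ) + 1) ^ (x : ℕ) := by
  induction k with
  | nil =>
    intro a ha
    simp only [List.nil_append, truncSum, mul_one]
    rw [← Finset.insert_Ioc_right_eq_Ioc_add_one ha, Finset.sum_insert (by simp)]
    push_cast
    ring
  | cons y k ih =>
    intro a ha
    simp only [List.cons_append, truncSum]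
    rw [← Finset.insert_Ioc_right_eq_Ioc_add_one ha, Finset.sum_insert (by simp)]
    have h0 : truncSum (N + 1) (N + 1) (k ++ [x]) = 0 := by
      cases k <;> simp [truncSum]
    rw [h0, mul_zero, zero_add, Finset.sum_div, ← Finset.sum_add_distrib]
    refine Finset.sum_congr rfl fun m hm => ?_
    rw [ih m (Finset.mem_Ioc.1 hm).2]
    ring

/-- The admissible case: the truncated sums converge, with a power saving. -/
theorem negligible_admissible (k : List ℕ+) (x : ℕ+) (hx : x ≠ 1) :
    ∃ c : ℝ, Negligible (fun N => truncSum N 0 (k ++ [x]) - c) := by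
  have hx2 : 2 ≤ (x : ℕ) := by
    have h1 : (x : ℕ) ≠ 1 := fun h => hx (PNat.coe_eq_one_iff.1 h)
    have := x.pos
    omega
  -- growth of the inner sums
  obtain ⟨M, hM1, hM⟩ : ∃ M : ℕ, 1 ≤ M ∧ ∀ N ≥ M, truncSum N 0 k ≤ (N : ℝ) ^ (1 / 2 : ℝ) := by
    have h1 : ∀ᶠ t : ℝ in atTop, (1 + t) ^ k.length ≤ Real.exp (1 / 2 * t) := by
      have h2 := tendsto_rpow_mul_exp_neg_mul_atTop_nhds_zero (k.length : ℝ) (1 / 2)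
        (by norm_num)
      have h3 := (h2.comp (tendsto_atTop_add_const_left atTop (1 : ℝ) tendsto_id)).eventually
        (gt_mem_nhds (Real.exp_pos (-(1 / 2))))
      filter_upwards [h3] with t ht
      simp only [Function.comp, id, Real.rpow_natCast] at ht
      have h4 : Real.exp (-(1 / 2)) = Real.exp (-(1 / 2) * (1 + t)) * Real.exp (1 / 2 * t) := by
        rw [← Real.exp_add]
        congr 1
        ring
      rw [h4, mul_comm] at ht
      exact (lt_of_mul_lt_mul_left ht (Real.exp_pos _).le).le
    have h5 := (Real.tendsto_log_atTop.comp tendsto_natCast_atTop_atTop).eventually h1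
    obtain ⟨M, hM⟩ := eventually_atTop.1 (h5.and (eventually_ge_atTop 1))
    refine ⟨max M 1, le_max_right _ _, fun N hN => ?_⟩
    obtain ⟨h6, h7⟩ := hM N (le_trans (le_max_left _ _) hN)
    have hN' : (0 : ℝ) < N := by exact_mod_cast h7
    calc truncSum N 0 k ≤ (harmonic N : ℝ) ^ k.length := truncSum_le N k 0
      _ ≤ (1 + Real.log N) ^ k.length := by
          refine pow_le_pow_left₀ ?_ (harmonic_le_one_add_log N) _
          rw [← truncSum_one]
          exact truncSum_nonneg _ _ _
      _ ≤ Real.exp (1 / 2 * Real.log N) := h6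
      _ = (N : ℝ) ^ (1 / 2 : ℝ) := by rw [Real.rpow_def_of_pos hN', mul_comm]
  set S : ℕ → ℝ := fun N => truncSum N 0 (k ++ [x]) with hS
  have hmono : Monotone S := monotone_nat_of_le_succ fun N => by
    simp only [hS]
    rw [truncSum_succ N x k 0 (Nat.zero_le N)]
    have := truncSum_nonneg N k 0
    have : 0 ≤ truncSum N 0 k / ((N : ℝ) + 1) ^ (x : ℕ) := by positivity
    linarith
  -- `S N + 4 / √N` decreases
  have hstep : ∀ N ≥ M, S (N + 1) + 4 * ((N + 1 : ℕ) : ℝ) ^ (-(1 / 2) : ℝ)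
      ≤ S N + 4 * (N : ℝ) ^ (-(1 / 2) : ℝ) := by
    intro N hN
    have hN1 : (1 : ℝ) ≤ N := by exact_mod_cast le_trans hM1 hN
    have hN0 : (0 : ℝ) < N := by linarith
    have h1 : S (N + 1) = S N + truncSum N 0 k / ((N : ℝ) + 1) ^ (x : ℕ) :=
      truncSum_succ N x k 0 (Nat.zero_le N)
    have h2 : truncSum N 0 k / ((N : ℝ) + 1) ^ (x : ℕ) ≤ √(N : ℝ) / ((N : ℝ) + 1) ^ 2 := by
      have h3 := hM N hN
      rw [← Real.sqrt_eq_rpow] at h3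
      refine div_le_div₀ (Real.sqrt_nonneg _) h3 (by positivity) ?_
      exact pow_le_pow_right₀ (by linarith) hx2
    rw [h1, Real.rpow_neg hN0.le, Real.rpow_neg (Nat.cast_nonneg _), ← Real.sqrt_eq_rpow,
      ← Real.sqrt_eq_rpow]
    push_cast
    set s := √(N : ℝ)
    set t := √((N : ℝ) + 1)
    have hs : 0 < s := Real.sqrt_pos.2 hN0
    have ht : 0 < t := Real.sqrt_pos.2 (by linarith)
    have hs2 : s ^ 2 = N := Real.sq_sqrt hN0.le
    have ht2 : t ^ 2 = (N : ℝ) + 1 := Real.sq_sqrt (by linarith)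
    have hst : s ≤ t := Real.sqrt_le_sqrt (by linarith)
    have h4 : s / ((N : ℝ) + 1) ^ 2 + 4 * t⁻¹ ≤ 4 * s⁻¹ := by
      rw [← ht2]
      have h5 : 4 * s⁻¹ - (s / (t ^ 2) ^ 2 + 4 * t⁻¹)
          = (4 * (t - s) * t ^ 3 - s ^ 2) / (s * t ^ 4) := by
        field_simp
        ring
      have h6 : (t - s) * (t + s) = 1 := by nlinarith
      have h7 : 0 ≤ t - s := by linarith
      have h8 : s ^ 2 ≤ 4 * (t - s) * t ^ 3 := by
        have h9 : 1 ≤ (t - s) * (2 * t) := by nlinarith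
        have h10 : s ^ 2 ≤ t ^ 2 := by linarith
        nlinarith [sq_nonneg t]
      have h11 : 0 ≤ (4 * (t - s) * t ^ 3 - s ^ 2) / (s * t ^ 4) :=
        div_nonneg (by linarith) (by positivity)
      linarith
    linarith
  have hanti : ∀ N ≥ M, ∀ n ≥ N, S n + 4 * (n : ℝ) ^ (-(1 / 2) : ℝ)
      ≤ S N + 4 * (N : ℝ) ^ (-(1 / 2) : ℝ) := by
    intro N hN n hn
    induction n, hn using Nat.le_induction with
    | base => exact le_rfl
    | succ n hn ih => exact (hstep n (le_trans hN hn)).trans ih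
  have hle : ∀ N ≥ M, ∀ n, S n ≤ S N + 4 * (N : ℝ) ^ (-(1 / 2) : ℝ) := by
    intro N hN n
    have h1 := hanti N hN (max n N) (le_max_right _ _)
    have h2 := hmono (le_max_left n N)
    have h3 : (0 : ℝ) ≤ ((max n N : ℕ) : ℝ) ^ (-(1 / 2) : ℝ) := by positivity
    linarith
  have hbdd : BddAbove (Set.range S) := ⟨_, by
    rintro _ ⟨n, rfl⟩
    exact hle M le_rfl n⟩
  refine ⟨⨆ n, S n, negligible_of_le 4 ?_⟩
  filter_upwards [eventually_ge_atTop M] with N hN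
  rw [abs_le]
  have h1 : S N ≤ ⨆ n, S n := le_ciSup hbdd N
  have h2 : ⨆ n, S n ≤ S N + 4 * (N : ℝ) ^ (-(1 / 2) : ℝ) := ciSup_le (hle N hN)
  have h3 : (0 : ℝ) ≤ (N : ℝ) ^ (-(1 / 2) : ℝ) := by positivity
  constructor <;> linarith

theorem hasExpansion_admissible (k : List ℕ+) (x : ℕ+) (hx : x ≠ 1) :
    HasExpansion (fun N => truncSum N 0 (k ++ [x])) := by
  obtain ⟨c, hc⟩ := negligible_admissible k x hx
  exact ⟨Polynomial.C c, by simpa using hc⟩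

theorem tendsto_truncSum_admissible (k : List ℕ+) (x : ℕ+) (hx : x ≠ 1) :
    ∃ c : ℝ, Tendsto (fun N => truncSum N 0 (k ++ [x])) atTop (𝓝 c) := by
  obtain ⟨c, hc⟩ := negligible_admissible k x hx
  refine ⟨c, ?_⟩
  have h := (hc 0).add_const c
  simpa using h

/-- The words that occur in the stuffle product of the one-letter word `1` with a given word. -/
def stuffleOne : List ℕ+ → List (List ℕ+)
  | [] => [[1]]
  | x :: k => (1 :: x :: k) :: ((x + 1) :: k) :: (stuffleOne k).map (x :: ·)

theorem truncSum_one_mul (N : ℕ) (k : List ℕ+) : ∀ a,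
    truncSum N a [1] * truncSum N a k = ((stuffleOne k).map (truncSum N a)).sum := by
  induction k with
  | nil => intro a; simp [stuffleOne, truncSum]
  | cons x k ih =>
    intro a
    have hmap : ((stuffleOne k).map fun v => truncSum N a (x :: v)).sum =
        ∑ m ∈ Finset.Ioc a N, 1 / (m : ℝ) ^ (x : ℕ) * ((stuffleOne k).map (truncSum N m)).sum := by
      simp only [truncSum]
      generalize stuffleOne k = l
      induction l with
      | nil => simp
      | cons v l ih' => simp only [List.map_cons, List.sum_cons, ih', mul_add, Finset.sum_add_distrib]
    rw [stuffleOne, List.map_cons, List.map_cons, List.sum_cons, List.sum_cons, List.map_map]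
    change _ = _ + (_ + ((stuffleOne k).map fun v => truncSum N a (x :: v)).sum)
    rw [hmap]
    simp only [← ih, truncSum, PNat.one_coe, pow_one, mul_one, PNat.add_coe]
    rw [← Finset.sum_add_distrib, Finset.sum_mul_sum]
    -- split according to `m < n`, `m = n`, `m > n`
    have key : ∀ f g : ℕ → ℝ, ∑ m ∈ Finset.Ioc a N, ∑ n ∈ Finset.Ioc a N, f m * g n =
        ∑ m ∈ Finset.Ioc a N, f m * ∑ n ∈ Finset.Ioc m N, g n +
        ∑ n ∈ Finset.Ioc a N, (f n * g n + g n * ∑ m ∈ Finset.Ioc n N, f m) := by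
      intro f g
      have hswap : ∑ n ∈ Finset.Ioc a N, g n * ∑ m ∈ Finset.Ioc n N, f m =
          ∑ m ∈ Finset.Ioc a N, ∑ n ∈ Finset.Ioo a m, f m * g n := by
        simp_rw [Finset.mul_sum]
        rw [Finset.sum_comm' (t' := Finset.Ioc a N) (s' := fun m => Finset.Ioo a m)]
        · exact Finset.sum_congr rfl fun m _ => Finset.sum_congr rfl fun n _ => mul_comm _ _
        · intro n m
          simp only [Finset.mem_Ioc, Finset.mem_Ioo]
          omega
      rw [Finset.sum_add_distrib, hswap, ← Finset.sum_add_distrib, ← Finset.sum_add_distrib]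
      refine Finset.sum_congr rfl fun m hm => ?_
      have hm' := Finset.mem_Ioc.1 hm
      have hU : Finset.Ioc a N = Finset.Ioc m N ∪ insert m (Finset.Ioo a m) := by
        ext n
        simp only [Finset.mem_Ioc, Finset.mem_union, Finset.mem_insert, Finset.mem_Ioo]
        omega
      have hD : Disjoint (Finset.Ioc m N) (insert m (Finset.Ioo a m)) := by
        rw [Finset.disjoint_left]
        intro n
        simp only [Finset.mem_Ioc, Finset.mem_insert, Finset.mem_Ioo]
        omega
      rw [hU, Finset.sum_union hD, Finset.sum_insert (by simp), Finset.mul_sum]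
    rw [key]
    congr 1
    refine Finset.sum_congr rfl fun m hm => ?_
    have hm0 : (m : ℝ) ≠ 0 := by
      have := (Finset.mem_Ioc.1 hm).1
      exact_mod_cast (by omega : m ≠ 0)
    rw [pow_succ]
    field_simp

/-- Words in which the last letter different from `1` exists and is followed by at most
`n` letters. -/
def TailLE (n : ℕ) (w : List ℕ+) : Prop :=
  ∃ (u : List ℕ+) (x : ℕ+) (m : ℕ), x ≠ 1 ∧ m ≤ n ∧ w = u ++ x :: List.replicate m 1

theorem TailLE.cons {n : ℕ} {w : List ℕ+} (y : ℕ+) (h : TailLE n w) : TailLE n (y :: w) := by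
  obtain ⟨u, x, m, hx, hm, rfl⟩ := h
  exact ⟨y :: u, x, m, hx, hm, rfl⟩

theorem add_one_ne_one (x : ℕ+) : x + 1 ≠ 1 := by
  intro h
  have := congrArg PNat.val h
  have := x.pos
  simp at *

theorem stuffleOne_replicate (n : ℕ) : ∃ l : List (List ℕ+), (∀ v ∈ l, TailLE n v) ∧
    ∀ G : List ℕ+ → ℝ, ((stuffleOne (List.replicate n 1)).map G).sum =
      ((n : ℝ) + 1) * G (List.replicate (n + 1) 1) + (l.map G).sum := by
  induction n with
  | zero => exact ⟨[], by simp, fun G => by simp [stuffleOne]⟩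
  | succ n ih =>
    obtain ⟨l, hl, hG⟩ := ih
    refine ⟨((1 + 1) :: List.replicate n 1) :: l.map (1 :: ·), ?_, fun G => ?_⟩
    · intro v hv
      rcases List.mem_cons.1 hv with rfl | hv
      · exact ⟨[], 1 + 1, n, add_one_ne_one 1, by omega, rfl⟩
      · obtain ⟨w, hw, rfl⟩ := List.mem_map.1 hv
        obtain ⟨u, x, m, hx, hm, rfl⟩ := hl w hw
        exact ⟨1 :: u, x, m, hx, by omega, rfl⟩
    · have h := hG fun v => G (1 :: v)
      rw [List.replicate_succ, stuffleOne]
      simp only [List.map_cons, List.sum_cons, List.map_map, Function.comp_def]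
      rw [h]
      simp only [← List.replicate_succ]
      push_cast
      ring

theorem stuffleOne_tail (u : List ℕ+) (x : ℕ+) (hx : x ≠ 1) (n : ℕ) :
    ∃ l : List (List ℕ+), (∀ v ∈ l, TailLE n v) ∧
    ∀ G : List ℕ+ → ℝ, ((stuffleOne (u ++ x :: List.replicate n 1)).map G).sum =
      ((n : ℝ) + 1) * G (u ++ x :: List.replicate (n + 1) 1) + (l.map G).sum := by
  induction u with
  | nil =>
    obtain ⟨l, hl, hG⟩ := stuffleOne_replicate n
    refine ⟨(1 :: x :: List.replicate n 1) :: ((x + 1) :: List.replicate n 1) ::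
      l.map (x :: ·), ?_, fun G => ?_⟩
    · intro v hv
      rcases List.mem_cons.1 hv with rfl | hv
      · exact ⟨[1], x, n, hx, le_rfl, rfl⟩
      rcases List.mem_cons.1 hv with rfl | hv
      · exact ⟨[], x + 1, n, add_one_ne_one x, le_rfl, rfl⟩
      · obtain ⟨w, hw, rfl⟩ := List.mem_map.1 hv
        exact (hl w hw).cons x
    · have h := hG fun v => G (x :: v)
      rw [List.nil_append, List.nil_append, stuffleOne]
      simp only [List.map_cons, List.sum_cons, List.map_map, Function.comp_def]
      rw [h]
      ring
  | cons y u ih =>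
    obtain ⟨l, hl, hG⟩ := ih
    refine ⟨(1 :: y :: (u ++ x :: List.replicate n 1)) ::
      ((y + 1) :: (u ++ x :: List.replicate n 1)) :: l.map (y :: ·), ?_, fun G => ?_⟩
    · intro v hv
      rcases List.mem_cons.1 hv with rfl | hv
      · exact ⟨1 :: y :: u, x, n, hx, le_rfl, rfl⟩
      rcases List.mem_cons.1 hv with rfl | hv
      · exact ⟨(y + 1) :: u, x, n, hx, le_rfl, rfl⟩
      · obtain ⟨w, hw, rfl⟩ := List.mem_map.1 hv
        exact (hl w hw).cons y
    · have h := hG fun v => G (y :: v)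
      rw [List.cons_append, List.cons_append, stuffleOne]
      simp only [List.map_cons, List.sum_cons, List.map_map, Function.comp_def]
      rw [h]
      ring

theorem HasExpansion.step {w w' : List ℕ+} {n : ℕ} {l : List (List ℕ+)}
    (hw : HasExpansion fun N => truncSum N 0 w)
    (hl : ∀ v ∈ l, HasExpansion fun N => truncSum N 0 v)
    (hG : ∀ G : List ℕ+ → ℝ, ((stuffleOne w).map G).sum =
      ((n : ℝ) + 1) * G w' + (l.map G).sum) :
    HasExpansion fun N => truncSum N 0 w' := by
  have h1 := HasExpansion.list_sum (F := fun v N => truncSum N 0 v) l hl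
  have h2 := ((hasExpansion_one.mul hw).add (h1.const_mul (-1))).const_mul (((n : ℝ) + 1)⁻¹)
  convert h2 using 2 with N
  have hn : (n : ℝ) + 1 ≠ 0 := by positivity
  rw [truncSum_one_mul, hG (truncSum N 0)]
  field_simp
  ring

theorem hasExpansion_tail (n : ℕ) : ∀ w : List ℕ+, TailLE n w →
    HasExpansion fun N => truncSum N 0 w := by
  induction n with
  | zero =>
    rintro w ⟨u, x, m, hx, hm, rfl⟩
    obtain rfl : m = 0 := by omega
    exact hasExpansion_admissible u x hx
  | succ n ih =>
    rintro w ⟨u, x, m, hx, hm, rfl⟩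
    rcases Nat.lt_or_ge n m with h | h
    · obtain rfl : m = n + 1 := by omega
      obtain ⟨l, hl, hG⟩ := stuffleOne_tail u x hx n
      exact HasExpansion.step (ih _ ⟨u, x, n, hx, le_rfl, rfl⟩) (fun v hv => ih v (hl v hv)) hG
    · exact ih _ ⟨u, x, m, hx, h, rfl⟩

theorem hasExpansion_replicate (n : ℕ) :
    HasExpansion fun N => truncSum N 0 (List.replicate n 1) := by
  induction n with
  | zero => simpa [truncSum] using hasExpansion_const 1
  | succ n ih =>
    obtain ⟨l, hl, hG⟩ := stuffleOne_replicate n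
    exact HasExpansion.step ih (fun v hv => hasExpansion_tail n v (hl v hv)) hG

theorem word_cases (w : List ℕ+) : (∃ n, w = List.replicate n 1) ∨ ∃ n, TailLE n w := by
  induction w with
  | nil => exact Or.inl ⟨0, rfl⟩
  | cons y w ih =>
    rcases ih with ⟨n, rfl⟩ | ⟨n, h⟩
    · by_cases hy : y = 1
      · exact Or.inl ⟨n + 1, by rw [hy, List.replicate_succ]⟩
      · exact Or.inr ⟨n, [], y, n, hy, le_rfl, rfl⟩
    · exact Or.inr ⟨n, h.cons y⟩

theorem hasExpansion_truncSum (k : List ℕ+) : HasExpansion fun N => truncSum N 0 k := by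
  rcases word_cases k with ⟨n, rfl⟩ | ⟨n, h⟩
  · exact hasExpansion_replicate n
  · exact hasExpansion_tail n k h

theorem eq_zero_of_tendsto {R : Polynomial ℝ}
    (h1 : Tendsto (fun N : ℕ => R.eval (logGamma N)) atTop (𝓝 0)) : R = 0 := by
  rcases lt_or_ge 0 R.degree with hd | hd
  · have h2 := (R.abs_tendsto_atTop hd).comp tendsto_logGamma
    exact absurd h1.abs (not_tendsto_nhds_of_tendsto_atTop h2 _)
  · obtain ⟨c, rfl⟩ : ∃ c, R = Polynomial.C c := ⟨_, Polynomial.eq_C_of_degree_le_zero hd⟩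
    simp only [Polynomial.eval_C] at h1
    rw [tendsto_nhds_unique tendsto_const_nhds h1, Polynomial.C_0]

theorem existsUnique_isRegPoly (k : List ℕ+) : ∃! P : Polynomial ℝ, IsRegPoly k P := by
  obtain ⟨P, hP⟩ := hasExpansion_truncSum k
  have hP0 : IsRegPoly k P := by simpa [IsRegPoly, logGamma] using hP 0
  refine ⟨P, hP0, fun Q hQ => ?_⟩
  refine sub_eq_zero.1 (eq_zero_of_tendsto ?_)
  have h := Tendsto.sub hP0 hQ
  rw [sub_zero] at h
  refine h.congr fun N => ?_
  rw [Polynomial.eval_sub, logGamma]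
  ring

/-! ### The regularized values -/

/-- The stuffle regularization polynomial `Z(k₁, …, k_d; T)`. It is the constant
`ζ(k₁, …, k_d)` if `k_d ≥ 2`, it is `T` for the index `(1)`, and it is multiplicative for the
stuffle product, because the truncated sums are. -/
noncomputable def regPoly (k : List ℕ+) : Polynomial ℝ := (existsUnique_isRegPoly k).choose

/-- The stuffle regularized multiple zeta value `ζ^*(k₁, …, k_d)`, normalized by
`ζ^*(1) = 0`; its value at the empty index is `1`. -/
noncomputable def zetaReg (k : List ℕ+) : ℝ := (regPoly k).eval 0

theorem isRegPoly_regPoly (k : List ℕ+) : IsRegPoly k (regPoly k) :=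
  (existsUnique_isRegPoly k).choose_spec.1

theorem IsRegPoly.eq_regPoly {k : List ℕ+} {P : Polynomial ℝ} (h : IsRegPoly k P) :
    P = regPoly k :=
  (existsUnique_isRegPoly k).unique h (isRegPoly_regPoly k)

/-- If the last entry is at least `2`, then `ζ^*` is the convergent multiple zeta value. -/
theorem tendsto_truncSum_zetaReg (k : List ℕ+) (x : ℕ+) (hx : x ≠ 1) :
    Tendsto (fun N => truncSum N 0 (k ++ [x])) atTop (𝓝 (zetaReg (k ++ [x]))) := by
  obtain ⟨c, hc⟩ := tendsto_truncSum_admissible k x hx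
  have h : IsRegPoly (k ++ [x]) (Polynomial.C c) := by
    simpa [IsRegPoly] using hc.sub_const c
  rw [zetaReg, ← h.eq_regPoly, Polynomial.eval_C]
  exact hc

theorem zetaReg_nil : zetaReg [] = 1 := by
  have h : IsRegPoly [] (Polynomial.C 1) := by simp [IsRegPoly, truncSum]
  rw [zetaReg, ← h.eq_regPoly, Polynomial.eval_C]

theorem regPoly_one : regPoly [1] = Polynomial.X := by
  symm
  apply IsRegPoly.eq_regPoly
  have h := Real.tendsto_harmonic_sub_log.sub_const Real.eulerMascheroniConstant
  rw [sub_self] at h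
  refine h.congr fun N => ?_
  rw [truncSum_one, Polynomial.eval_X]
  ring

theorem zetaReg_one : zetaReg [1] = 0 := by
  rw [zetaReg, regPoly_one, Polynomial.eval_X]

/-- The stuffle product of `1` with any index is respected. Together with the values at
admissible indices and `ζ^*(1) = 0` this determines `ζ^*`. -/
theorem sum_zetaReg_stuffleOne (k : List ℕ+) : ((stuffleOne k).map zetaReg).sum = 0 := by
  obtain ⟨P, hP⟩ := hasExpansion_truncSum k
  obtain ⟨Q, hQ⟩ := hasExpansion_one
  have hsum : ∀ l : List (List ℕ+), Tendsto (fun N : ℕ => (l.map (truncSum N 0)).sum -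
      ((l.map regPoly).sum).eval (logGamma N)) atTop (𝓝 0) := by
    intro l
    induction l with
    | nil => simp
    | cons v l ih =>
      have h := Tendsto.add (isRegPoly_regPoly v) ih
      rw [add_zero] at h
      refine h.congr fun N => ?_
      simp only [List.map_cons, List.sum_cons, Polynomial.eval_add, logGamma]
      ring
  have hQX : Q = Polynomial.X := by
    rw [← regPoly_one]
    apply IsRegPoly.eq_regPoly
    simpa [IsRegPoly, logGamma] using hQ 0
  have hprod := ((hP.mul_eval Q).add (hQ.mul_eval P)).add (hP.mul hQ) 0
  have hzero : Tendsto (fun N : ℕ =>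
      (Q * P - ((stuffleOne k).map regPoly).sum).eval (logGamma N)) atTop (𝓝 0) := by
    have h := (hsum (stuffleOne k)).sub hprod
    rw [sub_zero] at h
    refine h.congr fun N => ?_
    rw [← truncSum_one_mul, Polynomial.eval_sub, Polynomial.eval_mul]
    ring
  have heq := sub_eq_zero.1 (eq_zero_of_tendsto hzero)
  have h2 : ∀ l : List (List ℕ+), (l.map zetaReg).sum = ((l.map regPoly).sum).eval 0 := by
    intro l
    induction l with
    | nil => simp
    | cons v l ih => simp [ih, zetaReg]
  rw [h2, ← heq, hQX]
  simp

/-- All the indices `x □ k₁ □ ⋯ □ k_d` where each `□` is a comma or a plus sign. -/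
def mergingsFrom : ℕ+ → List ℕ+ → List (List ℕ+)
  | x, [] => [[x]]
  | x, y :: k => (mergingsFrom y k).map (x :: ·) ++ mergingsFrom (x + y) k

/-- All the indices `k₁ □ ⋯ □ k_d` where each `□` is a comma or a plus sign. -/
def mergings : List ℕ+ → List (List ℕ+)
  | [] => [[]]
  | x :: k => mergingsFrom x k

/-- The stuffle regularized multiple zeta star value `ζ^{⋆,*}(k₁, …, k_d)`. -/
noncomputable def zetaStarReg (k : List ℕ+) : ℝ := ((mergings k).map zetaReg).sum

/-- `ζ_a^*(k₁, …, k_d)`, the sum of `(-1)^a ∏ⱼ (kⱼ - 1 + aⱼ choose aⱼ) ζ^*(k₁ + a₁, …, k_d + a_d)`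
over `a₁ + ⋯ + a_d = a`. Here `(kⱼ - 1 + aⱼ).succPNat` is `kⱼ + aⱼ`. -/
noncomputable def zetaTaylor (a : ℕ) (k : List ℕ+) : ℝ :=
  (-1) ^ a * ∑ α ∈ Finset.Nat.antidiagonalTuple k.length a,
    zetaReg (List.ofFn fun j => Nat.succPNat ((k.get j : ℕ) - 1 + α j)) *
      ∏ j, ((((k.get j : ℕ) - 1 + α j).choose (α j) : ℕ) : ℝ)

/-- `δ^{k₁, …, k_d}`: it is `(-1)^n π^(2n) / (2n)!` if the index is `(1, …, 1)` of length `2n`,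
and `0` otherwise. -/
noncomputable def deltaTerm (k : List ℕ+) : ℝ :=
  if Even k.length ∧ k = List.replicate k.length 1 then
    (-1) ^ (k.length / 2) * Real.pi ^ k.length / (k.length.factorial : ℝ)
  else 0

/-- The weight `k₁ + ⋯ + k_d`. -/
def weight (k : List ℕ+) : ℕ := (k.map fun x => (x : ℕ)).sum

/-- The triples `(a, m, b)` of natural numbers with `a + 2m + b = n`. -/
def triples (n : ℕ) : Finset (ℕ × ℕ × ℕ) :=
  (Finset.range (n + 1) ×ˢ Finset.range (n + 1) ×ˢ Finset.range (n + 1)).filter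
    fun t => t.1 + 2 * t.2.1 + t.2.2 = n

end MZV

/-! The proof compares multitangent functions with monotangent functions. Formally, the multitangent
function of `k` is the sum of `1 / ((z + n₁) ^ k₁ ⋯ (z + n_d) ^ k_d)` over all integers `n₁ < ⋯ <
n_d`. Sorting the integers by sign factors it, for deconcatenation convolution, as `negPart * point
* posPart`, where the outer factors are regularized multiple Hurwitz zeta functions at `1 - z` and
`1 + z`. These are holomorphic near `0`, with Taylor coefficients given by `zetaTaylor`
(`hurwitz_one`, `deriv_hurwitz`).

The multitangent function has period `1` (`multitangent_add_one`). Its only pole in the strip `-1 <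
Re z < 1` is at `0` and comes from the middle factor. Subtracting the monotangent functions with the
same principal part leaves a function that is holomorphic, periodic and bounded on a closed strip of
width `1`, hence constant by Liouville (`eq_of_periodic_of_bounded`). The mean of its limits at
`±i∞` identifies the constant as `deltaTerm k`: the regularizing logarithms combine into `log (1 -
z) - log (1 + z)`, which tends to `∓πi`.

Evaluation at `0` (`multitangentAway_zero`) involves the finite symmetric sum `∑ᵢ (-1)^(k₁ + ⋯ + kᵢ)
ζ^*(kᵢ, …, k₁) ζ^*(kᵢ₊₁, …, k_d)`. The principal parts contribute products of Taylor coefficients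
with even zeta values, which gives the Bernoulli numbers in `symmetricSum_eq`.

Finally, the antipode relation (`conv_zetaStar_reverse`) says that signed star values are
convolution inverse to reversed ordinary values. Hence `ζ^*` is the convolution of signed star
values with symmetric sums (`zetaReg_eq_conv`). Under the parity hypothesis the term with empty
second factor is `-ζ^{⋆,*}(k)`. Halving the resulting formula for `ζ^* + ζ^{⋆,*}` gives the theorem.
-/

namespace MZV

/-! ### Deconcatenation convolution of functions on words -/

section Convolution

variable {α R : Type*} [CommRing R]

/-- The convolution `∑ f u * g v` over all factorizations `k = u ++ v`. -/
def conv (f g : List α → R) : List α → R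
  | [] => f [] * g []
  | x :: k => f [] * g (x :: k) + conv (fun l => f (x :: l)) g k

/-- The unit for the convolution. -/
def convUnit : List α → R
  | [] => 1
  | _ :: _ => 0

/-- The function on words that is `1` on the empty word, `u x` on one-letter words and `0` on
longer words. -/
def letterFun (u : α → R) : List α → R
  | [] => 1
  | [x] => u x
  | _ :: _ :: _ => 0

theorem conv_nil (f g : List α → R) : conv f g [] = f [] * g [] := rfl

theorem conv_cons (f g : List α → R) (x : α) (k : List α) :
    conv f g (x :: k) = f [] * g (x :: k) + conv (fun l => f (x :: l)) g k := rfl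

theorem conv_add_left (f f' g : List α → R) (k : List α) :
    conv (fun l => f l + f' l) g k = conv f g k + conv f' g k := by
  induction k generalizing f f' with
  | nil => simp only [conv_nil]; ring
  | cons x k ih => simp only [conv_cons, ih]; ring

theorem conv_mul_left (c : R) (f g : List α → R) (k : List α) :
    conv (fun l => c * f l) g k = c * conv f g k := by
  induction k generalizing f with
  | nil => simp only [conv_nil]; ring
  | cons x k ih => simp only [conv_cons, ih]; ring

theorem conv_zero_left (g : List α → R) (k : List α) : conv (fun _ => 0) g k = 0 := by
  induction k with
  | nil => simp [conv_nil]
  | cons x k ih => simp [conv_cons, ih]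

theorem conv_assoc (f g h : List α → R) : conv (conv f g) h = conv f (conv g h) := by
  funext k
  induction k generalizing f g with
  | nil => simp only [conv_nil]; ring
  | cons x k ih =>
    have h1 : (fun l => conv f g (x :: l)) =
        fun l => f [] * g (x :: l) + conv (fun l => f (x :: l)) g l := rfl
    rw [conv_cons, h1, conv_add_left, conv_mul_left, ih, conv_cons, conv_cons, conv_nil]
    ring

theorem conv_unit_left (g : List α → R) : conv convUnit g = g := by
  funext k
  cases k with
  | nil => simp [conv_nil, convUnit]
  | cons x k => simp [conv_cons, convUnit, conv_zero_left]

theorem conv_eq_sum (f g : List α → R) (k : List α) :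
    conv f g k = ∑ i ∈ Finset.range (k.length + 1), f (k.take i) * g (k.drop i) := by
  induction k generalizing f with
  | nil => simp [conv_nil]
  | cons x k ih =>
    rw [conv_cons, ih, List.length_cons, Finset.sum_range_succ' _ (k.length + 1)]
    simp [add_comm]

theorem conv_append_singleton (f g : List α → R) (k : List α) (x : α) :
    conv f g (k ++ [x]) = conv f (fun l => g (l ++ [x])) k + f (k ++ [x]) * g [] := by
  induction k generalizing f with
  | nil => simp [conv_nil, conv_cons]
  | cons y k ih =>
    rw [List.cons_append, conv_cons, conv_cons, ih]
    simp [add_assoc]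

theorem conv_zero_right (f : List α → R) (k : List α) : conv f (fun _ => 0) k = 0 := by
  simp [conv_eq_sum]

theorem conv_unit_right (f : List α → R) : conv f convUnit = f := by
  funext k
  induction k using List.reverseRecOn with
  | nil => simp [conv_nil, convUnit]
  | append_singleton k x ih =>
    have h : (fun l : List α => (convUnit (l ++ [x]) : R)) = fun _ => 0 := by
      funext l
      cases l <;> rfl
    rw [conv_append_singleton, h, conv_zero_right]
    simp [convUnit]

theorem conv_letterFun_nil (u : α → R) (g : List α → R) : conv (letterFun u) g [] = g [] := by
  simp [conv_nil, letterFun]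

theorem conv_letterFun_cons (u : α → R) (g : List α → R) (x : α) (k : List α) :
    conv (letterFun u) g (x :: k) = g (x :: k) + u x * g k := by
  rw [conv_cons]
  cases k with
  | nil => simp [conv_nil, letterFun]
  | cons y k =>
    rw [conv_cons]
    have : (fun l => letterFun u (x :: y :: l)) = fun _ => (0 : R) := rfl
    rw [this, conv_zero_left]
    simp [letterFun]

theorem conv_letterFun_append (u : α → R) (f : List α → R) (x : α) (k : List α) :
    conv f (letterFun u) (k ++ [x]) = f (k ++ [x]) + u x * f k := by
  rw [conv_append_singleton]
  have h : (fun l : List α => letterFun u (l ++ [x])) = fun l => u x * convUnit l := by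
    funext l
    rcases l with _ | ⟨y, _ | ⟨z, l⟩⟩ <;> simp [letterFun, convUnit]
  have h2 : conv f (fun l => u x * convUnit l) k = u x * f k := by
    have h3 := congrFun (conv_unit_right f) k
    rw [conv_eq_sum] at h3 ⊢
    rw [← h3, Finset.mul_sum]
    exact Finset.sum_congr rfl fun i _ => by ring
  rw [h, h2]
  simp [letterFun, add_comm]

/-- For multitangent functions the middle factor is the integer `0`: either no summation index
equals it, or exactly one does, at some position `j`. This separates the regular part from the
poles. -/
theorem conv_letterFun_middle (u : α → R) (f g : List α → R) (k : List α) :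
    conv f (conv (letterFun u) g) k = conv f g k +
      ∑ j : Fin k.length, f (k.take j) * u (k.get j) * g (k.drop (j + 1)) := by
  induction k generalizing f with
  | nil => simp [conv_nil, letterFun]
  | cons x k ih =>
    rw [conv_cons, ih, conv_letterFun_cons, conv_cons]
    have := Fin.sum_univ_succ (n := k.length) (fun j : Fin (k.length + 1) =>
      f ((x :: k).take j) * u ((x :: k).get j) * g ((x :: k).drop (j + 1)))
    simp only [List.length_cons]
    rw [this]
    simp
    ring

/-- Multiplying by a multiplicative function is compatible with the convolution. -/
theorem conv_mul_mul (c f g : List α → R) (hc : ∀ u v, c (u ++ v) = c u * c v) (k : List α) :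
    conv (fun l => c l * f l) (fun l => c l * g l) k = c k * conv f g k := by
  rw [conv_eq_sum, conv_eq_sum, Finset.mul_sum]
  refine Finset.sum_congr rfl fun i _ => ?_
  have h := hc (k.take i) (k.drop i)
  rw [List.take_append_drop] at h
  rw [h]
  ring

/-- This is the binomial theorem, i.e. `exp a * exp b = exp (a + b)` degree by degree. It multiplies
the logarithmic leading terms of all-ones words. -/
theorem conv_pow_div_factorial {K : Type*} [Field K] [CharZero K] (a b : K) (k : List α) :
    conv (fun l => a ^ l.length / (l.length.factorial : K))
      (fun l => b ^ l.length / (l.length.factorial : K)) k =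
      (a + b) ^ k.length / (k.length.factorial : K) := by
  rw [conv_eq_sum, add_pow, Finset.sum_div]
  refine Finset.sum_congr rfl fun i hi => ?_
  have hi' : i ≤ k.length := by simpa [Nat.lt_succ_iff] using hi
  rw [List.length_take, List.length_drop, min_eq_left hi']
  have h := Nat.choose_mul_factorial_mul_factorial hi'
  have h' : (k.length.choose i : K) * i.factorial * (k.length - i).factorial =
      k.length.factorial := by exact_mod_cast h
  have h1 : (i.factorial : K) ≠ 0 := by exact_mod_cast i.factorial_ne_zero
  have h2 : ((k.length - i).factorial : K) ≠ 0 := by exact_mod_cast (k.length - i).factorial_ne_zero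
  have h3 : (k.length.factorial : K) ≠ 0 := by exact_mod_cast k.length.factorial_ne_zero
  field_simp
  rw [← h']
  ring

end Convolution

/-! ### Growth classes -/

/-- `g` is `O(ρ ^ (r + ε))` on `S` for every `ε > 0`. -/
def GrowsLike {X : Type*} (S : Set X) (ρ : X → ℝ) (r : ℝ) (g : X → ℂ) : Prop :=
  ∀ ε > 0, ∃ C, ∀ w ∈ S, ‖g w‖ ≤ C * ρ w ^ (r + ε)

section Growth

variable {X : Type*} {S : Set X} {ρ : X → ℝ} {r s : ℝ} {f g : X → ℂ}

theorem GrowsLike.add (hf : GrowsLike S ρ r f)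
    (hg : GrowsLike S ρ r g) : GrowsLike S ρ r (fun w => f w + g w) := by
  intro ε hε
  obtain ⟨C, hC⟩ := hf ε hε
  obtain ⟨D, hD⟩ := hg ε hε
  refine ⟨C + D, fun w hw => ?_⟩
  rw [add_mul]
  exact (norm_add_le _ _).trans (add_le_add (hC w hw) (hD w hw))

theorem GrowsLike.mul (hρ : ∀ w ∈ S, 1 / 2 ≤ ρ w) (hf : GrowsLike S ρ r f)
    (hg : GrowsLike S ρ s g) : GrowsLike S ρ (r + s) (fun w => f w * g w) := by
  intro ε hε
  obtain ⟨C, hC⟩ := hf (ε / 2) (by positivity)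
  obtain ⟨D, hD⟩ := hg (ε / 2) (by positivity)
  refine ⟨C * D, fun w hw => ?_⟩
  have h0 : 0 < ρ w := by linarith [hρ w hw]
  have h1 : r + s + ε = (r + ε / 2) + (s + ε / 2) := by ring
  rw [norm_mul, h1, Real.rpow_add h0]
  calc ‖f w‖ * ‖g w‖ ≤ (C * ρ w ^ (r + ε / 2)) * (D * ρ w ^ (s + ε / 2)) :=
        mul_le_mul (hC w hw) (hD w hw) (norm_nonneg _) ((norm_nonneg _).trans (hC w hw))
    _ = _ := by ring

/-- The size function is only bounded below by `1 / 2`, not by `1`, so lowering the exponent costs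
the constant `(1 / 2) ^ (r - s)`. -/
theorem GrowsLike.mono (hρ : ∀ w ∈ S, 1 / 2 ≤ ρ w) (hrs : r ≤ s) (hf : GrowsLike S ρ r f) :
    GrowsLike S ρ s f := by
  intro ε hε
  obtain ⟨C, hC⟩ := hf ε hε
  refine ⟨C * (1 / 2) ^ (r - s), fun w hw => ?_⟩
  have h0 : 0 < ρ w := by linarith [hρ w hw]
  have h1 : r + ε = (r - s) + (s + ε) := by ring
  have hC0 : 0 ≤ C := by
    have := (norm_nonneg _).trans (hC w hw)
    exact nonneg_of_mul_nonneg_left this (by positivity)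
  refine (hC w hw).trans ?_
  rw [h1, Real.rpow_add h0, mul_assoc]
  gcongr C * (?_ * _)
  exact Real.rpow_le_rpow_of_nonpos (by norm_num) (hρ w hw) (by linarith)

theorem growsLike_of_le_one (hρ : ∀ w ∈ S, 1 / 2 ≤ ρ w)
    (h : ∀ ε > 0, ε ≤ 1 → ∃ C, ∀ w ∈ S, ‖f w‖ ≤ C * ρ w ^ (r + ε)) : GrowsLike S ρ r f := by
  intro ε hε
  rcases le_or_gt ε 1 with h1 | h1
  · exact h ε hε h1
  · obtain ⟨C, hC⟩ := h 1 one_pos le_rfl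
    refine ⟨C * (1 / 2) ^ (1 - ε), fun w hw => ?_⟩
    have h0 : 0 < ρ w := by linarith [hρ w hw]
    have h1 : r + 1 = (1 - ε) + (r + ε) := by ring
    have hC0 : 0 ≤ C := by
      have := (norm_nonneg _).trans (hC w hw)
      exact nonneg_of_mul_nonneg_left this (by positivity)
    refine (hC w hw).trans ?_
    rw [h1, Real.rpow_add h0, mul_assoc]
    gcongr C * (?_ * _)
    exact Real.rpow_le_rpow_of_nonpos (by norm_num) (hρ w hw) (by linarith)

theorem GrowsLike.congr (hf : GrowsLike S ρ r f) (h : ∀ w ∈ S, g w = f w) :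
    GrowsLike S ρ r g := by
  intro ε hε
  obtain ⟨C, hC⟩ := hf ε hε
  exact ⟨C, fun w hw => by rw [h w hw]; exact hC w hw⟩

theorem growsLike_const (hρ : ∀ w ∈ S, 1 / 2 ≤ ρ w) (c : ℂ) :
    GrowsLike S ρ 0 (fun _ => c) := by
  intro ε hε
  refine ⟨‖c‖ * (1 / 2) ^ (-ε), fun w hw => ?_⟩
  have h0 : 0 < ρ w := by linarith [hρ w hw]
  have h1 : 1 ≤ (1 / 2 : ℝ) ^ (-ε) * ρ w ^ (0 + ε) := by
    rw [zero_add, Real.rpow_neg (by norm_num), ← div_eq_inv_mul, one_le_div (by positivity)]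
    exact Real.rpow_le_rpow (by norm_num) (hρ w hw) hε.le
  rw [mul_assoc]
  exact le_mul_of_one_le_right (norm_nonneg _) h1

theorem growsLike_zero : GrowsLike S ρ r (fun _ => 0) :=
  fun _ _ => ⟨0, fun w _ => by simp⟩

theorem GrowsLike.const_mul (hρ : ∀ w ∈ S, 1 / 2 ≤ ρ w) (c : ℂ) (hf : GrowsLike S ρ r f) :
    GrowsLike S ρ r (fun w => c * f w) := by
  simpa using (growsLike_const hρ c).mul hρ hf

theorem GrowsLike.sub (hρ : ∀ w ∈ S, 1 / 2 ≤ ρ w) (hf : GrowsLike S ρ r f)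
    (hg : GrowsLike S ρ r g) : GrowsLike S ρ r (fun w => f w - g w) :=
  (hf.add (hg.const_mul hρ (-1))).congr fun w _ => by ring

theorem GrowsLike.pow (hρ : ∀ w ∈ S, 1 / 2 ≤ ρ w) (hf : GrowsLike S ρ 0 f) (n : ℕ) :
    GrowsLike S ρ 0 (fun w => f w ^ n) := by
  induction n with
  | zero => simpa using growsLike_const hρ 1
  | succ n ih => simpa [pow_succ] using ih.mul hρ hf

theorem GrowsLike.finset_sum {ι : Type*} (t : Finset ι)
    {F : ι → X → ℂ} (hF : ∀ i ∈ t, GrowsLike S ρ r (F i)) :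
    GrowsLike S ρ r (fun w => ∑ i ∈ t, F i w) := by
  classical
  induction t using Finset.induction_on with
  | empty => simpa using growsLike_zero
  | insert a t ha ih =>
    simp only [Finset.sum_insert ha]
    exact (hF a (by simp)).add (ih fun i hi => hF i (by simp [hi]))

/-- The exponent may have either sign, so comparability is needed in both directions. -/
theorem rpow_le_of_comparable {a b c : ℝ} (hc : 1 ≤ c) (ha : 0 < a) (hb : 0 < b)
    (hab : a ≤ c * b) (hba : b ≤ c * a) (t : ℝ) : a ^ t ≤ c ^ |t| * b ^ t := by
  rcases le_total 0 t with ht | ht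
  · rw [abs_of_nonneg ht, ← Real.mul_rpow (by positivity) hb.le]
    exact Real.rpow_le_rpow ha.le hab ht
  · rw [abs_of_nonpos ht]
    have h1 : a⁻¹ ≤ c * b⁻¹ := by
      rw [← div_eq_mul_inv, inv_le_comm₀ ha (by positivity), inv_div, div_le_iff₀ (by positivity)]
      linarith
    have h2 : ∀ x : ℝ, 0 < x → x ^ t = x⁻¹ ^ (-t) := fun x hx => by
      rw [Real.inv_rpow hx.le, Real.rpow_neg hx.le, inv_inv]
    rw [h2 a ha, h2 b hb, ← Real.mul_rpow (by positivity) (by positivity)]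
    exact Real.rpow_le_rpow (by positivity) h1 (by linarith)

/-- Pulling back along a map, with a change to a comparable size function. -/
theorem GrowsLike.comp {Y : Type*} {S' : Set Y} {ρ' : Y → ℝ} {c : ℝ} (hc : 1 ≤ c)
    (hf : GrowsLike S ρ r f) (φ : Y → X) (hφ : ∀ y ∈ S', φ y ∈ S)
    (h0 : ∀ y ∈ S', 0 < ρ (φ y)) (h0' : ∀ y ∈ S', 0 < ρ' y)
    (h1 : ∀ y ∈ S', ρ (φ y) ≤ c * ρ' y) (h2 : ∀ y ∈ S', ρ' y ≤ c * ρ (φ y)) :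
    GrowsLike S' ρ' r (fun y => f (φ y)) := by
  intro ε hε
  obtain ⟨C, hC⟩ := hf ε hε
  refine ⟨C * c ^ |r + ε|, fun y hy => ?_⟩
  have hC0 : 0 ≤ C := by
    have := (norm_nonneg _).trans (hC _ (hφ y hy))
    exact nonneg_of_mul_nonneg_left this (Real.rpow_pos_of_pos (h0 y hy) _)
  refine (hC _ (hφ y hy)).trans ?_
  rw [mul_assoc]
  exact mul_le_mul_of_nonneg_left
    (rpow_le_of_comparable hc (h0 y hy) (h0' y hy) (h1 y hy) (h2 y hy) _) hC0

theorem GrowsLike.bounded (hr : r < 0) (hf : GrowsLike S ρ r f) :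
    ∃ C, ∀ w ∈ S, ‖f w‖ ≤ C := by
  obtain ⟨C, hC⟩ := hf (-r) (by linarith)
  exact ⟨C, fun w hw => by simpa using hC w hw⟩

theorem GrowsLike.tendsto_zero {Y : Type*} {l : Filter Y} {φ : Y → X} (hr : r < 0)
    (hf : GrowsLike S ρ r f)
    (hφ : ∀ᶠ y in l, φ y ∈ S) (h : Tendsto (fun y => ρ (φ y)) l atTop) :
    Tendsto (fun y => f (φ y)) l (𝓝 0) := by
  obtain ⟨C, hC⟩ := hf (-r / 2) (by linarith)
  have h1 : Tendsto (fun y => C * ρ (φ y) ^ (r + -r / 2)) l (𝓝 0) := by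
    have h2 := ((tendsto_rpow_neg_atTop (y := -r / 2) (by linarith)).comp h).const_mul C
    rw [mul_zero] at h2
    refine h2.congr fun y => ?_
    simp only [Function.comp]
    congr 2
    ring
  exact squeeze_zero_norm' (hφ.mono fun y hy => hC _ hy) h1

end Growth

/-! ### Growth on a right half plane, and estimates for the logarithm -/

/-- The half plane `1 / 2 ≤ Re w`. -/
def halfPlane : Set ℂ := {w | 1 / 2 ≤ w.re}

/-- Growth classes on the half plane `1 / 2 ≤ Re w`. -/
abbrev Grows (r : ℝ) (g : ℂ → ℂ) : Prop := GrowsLike halfPlane (fun w => ‖w‖) r g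

theorem half_le_norm : ∀ w ∈ halfPlane, 1 / 2 ≤ ‖w‖ := fun w hw =>
  (show 1 / 2 ≤ w.re from hw).trans (Complex.re_le_norm w)

theorem norm_add_nonneg_le (w : ℂ) (hw : 0 ≤ w.re) (t : ℝ) (ht : 0 ≤ t) :
    ‖w‖ ≤ ‖w + t‖ := by
  rw [← sq_le_sq₀ (norm_nonneg _) (norm_nonneg _), ← Complex.normSq_eq_norm_sq,
    ← Complex.normSq_eq_norm_sq, Complex.normSq_apply, Complex.normSq_apply]
  simp only [Complex.add_re, Complex.ofReal_re, Complex.add_im, Complex.ofReal_im, add_zero]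
  nlinarith

theorem Grows.comp_add_one {r : ℝ} {g : ℂ → ℂ} (hg : Grows r g) :
    Grows r (fun w => g (w + 1)) := by
  have key : ∀ y ∈ halfPlane, y + 1 ∈ halfPlane := fun y hy => by
    have : 1 / 2 ≤ y.re := hy
    change 1 / 2 ≤ (y + 1).re
    simp
    linarith
  refine GrowsLike.comp (c := 3) (by norm_num) hg (fun w => w + 1) key
    (fun y hy => by linarith [half_le_norm _ (key y hy)])
    (fun y hy => by linarith [half_le_norm _ hy]) (fun y hy => ?_) (fun y hy => ?_)
  · have h1 := norm_add_le y 1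
    rw [norm_one] at h1
    linarith [half_le_norm _ hy]
  · have hy' : 1 / 2 ≤ y.re := hy
    have h1 := norm_add_nonneg_le y (by linarith) 1 zero_le_one
    rw [Complex.ofReal_one] at h1
    linarith [norm_nonneg y]

theorem grows_inv_pow (n : ℕ) : Grows (-n) (fun w => (w ^ n)⁻¹) := by
  intro ε hε
  refine ⟨(1 / 2) ^ (-ε), fun w hw => ?_⟩
  have h0 := half_le_norm w hw
  have h1 : 0 < ‖w‖ := by linarith
  have h2 : 1 ≤ (1 / 2 : ℝ) ^ (-ε) * ‖w‖ ^ ε := by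
    rw [Real.rpow_neg (by norm_num), ← div_eq_inv_mul, one_le_div (by positivity)]
    exact Real.rpow_le_rpow (by norm_num) h0 hε.le
  rw [norm_inv, norm_pow, Real.rpow_add h1, Real.rpow_neg h1.le, Real.rpow_natCast,
    ← mul_assoc, mul_right_comm]
  exact le_mul_of_one_le_left (by positivity) h2

theorem grows_inv : Grows (-1) (fun w => w⁻¹) := by
  simpa using grows_inv_pow 1

theorem grows_log : Grows 0 Complex.log := by
  intro ε hε
  refine ⟨1 / ε + (1 / 2) ^ (-ε) / ε * (1 / 2) ^ (-ε) + Real.pi * (1 / 2) ^ (-ε), fun w hw => ?_⟩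
  have h0 := half_le_norm w hw
  have h1 : 0 < ‖w‖ := by linarith
  have h2 : 1 ≤ (1 / 2 : ℝ) ^ (-ε) * ‖w‖ ^ ε := by
    rw [Real.rpow_neg (by norm_num), ← div_eq_inv_mul, one_le_div (by positivity)]
    exact Real.rpow_le_rpow (by norm_num) h0 hε.le
  have h3 := Complex.norm_le_abs_re_add_abs_im (Complex.log w)
  rw [Complex.log_re, Complex.log_im] at h3
  have h4 := Complex.abs_arg_le_pi w
  have h5 : |Real.log ‖w‖| ≤ ‖w‖ ^ ε / ε + (1 / 2) ^ (-ε) / ε := by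
    have h6 := Real.log_le_rpow_div h1.le hε
    have h7 := Real.log_le_rpow_div (x := ‖w‖⁻¹) (by positivity) hε
    have h8 : ‖w‖⁻¹ ^ ε ≤ (1 / 2) ^ (-ε) := by
      rw [Real.inv_rpow h1.le, ← Real.rpow_neg h1.le]
      exact Real.rpow_le_rpow_of_nonpos (by norm_num) h0 (by linarith)
    have h9 : ‖w‖⁻¹ ^ ε / ε ≤ (1 / 2) ^ (-ε) / ε := by gcongr
    rw [Real.log_inv] at h7
    have h10 : 0 ≤ ‖w‖ ^ ε / ε := by positivity
    have h11 : (0 : ℝ) ≤ (1 / 2) ^ (-ε) / ε := by positivity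
    rw [abs_le]
    constructor <;> linarith
  rw [zero_add]
  set a := ‖w‖ ^ ε
  set b := (1 / 2 : ℝ) ^ (-ε)
  have hpi := Real.pi_pos
  have h12 : b / ε ≤ b / ε * (b * a) := le_mul_of_one_le_right (by positivity) h2
  have h13 : Real.pi ≤ Real.pi * (b * a) := le_mul_of_one_le_right hpi.le h2
  calc ‖Complex.log w‖ ≤ a / ε + b / ε + Real.pi := by linarith
    _ ≤ a / ε + b / ε * (b * a) + Real.pi * (b * a) := by linarith
    _ = _ := by ring

/-- The right half plane. -/
def rightHalf : Set ℂ := {w | 0 < w.re}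

theorem isOpen_rightHalf : IsOpen rightHalf := isOpen_lt continuous_const Complex.continuous_re

theorem halfPlane_subset : halfPlane ⊆ rightHalf := fun w hw => by
  have : 1 / 2 ≤ w.re := hw
  change 0 < w.re
  linarith

theorem add_real_mem_rightHalf {w : ℂ} (hw : w ∈ rightHalf) {t : ℝ} (ht : 0 ≤ t) :
    w + t ∈ rightHalf := by
  have : 0 < w.re := hw
  change 0 < (w + t).re
  simp
  linarith

theorem add_one_mem_rightHalf {w : ℂ} (hw : w ∈ rightHalf) : w + 1 ∈ rightHalf := by
  simpa using add_real_mem_rightHalf hw zero_le_one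

theorem ne_zero_of_mem_rightHalf {w : ℂ} (hw : w ∈ rightHalf) : w ≠ 0 := by
  rintro rfl
  simp [rightHalf] at hw

theorem hasDerivWithinAt_log_add {w : ℂ} (hw : w ∈ rightHalf) {t : ℝ} (ht : 0 ≤ t) (s : Set ℝ) :
    HasDerivWithinAt (fun t : ℝ => Complex.log (w + t)) (w + t)⁻¹ s t := by
  have h1 : HasDerivAt (fun t : ℝ => w + (t : ℂ)) 1 t := (Complex.ofRealCLM.hasDerivAt).const_add w
  have h2 := h1.clog_real (Or.inl (add_real_mem_rightHalf hw ht))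
  rw [one_div] at h2
  exact h2.hasDerivWithinAt

/-- Mean value inequality along the segment from `w` to `w + 1`, where the derivative `1 / (w + t)`
is at most `1 / |w|` in norm. -/
theorem grows_log_add_one_sub : Grows (-1) (fun w => Complex.log (w + 1) - Complex.log w) := by
  intro ε hε
  obtain ⟨C, hC⟩ := grows_inv ε hε
  refine ⟨C, fun w hw => le_trans ?_ (hC w hw)⟩
  have hw' := halfPlane_subset hw
  have h := norm_image_sub_le_of_norm_deriv_le_segment_01' (C := ‖w⁻¹‖)
    (fun t ht => hasDerivWithinAt_log_add hw' (Set.mem_Icc.1 ht).1 _) fun t ht => by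
      rw [norm_inv, norm_inv]
      exact inv_anti₀ (by linarith [half_le_norm w hw])
        (norm_add_nonneg_le w hw'.le t ht.1)
  simpa using h

/-- Along the segment the derivative of `t / w - log (w + t)` is `t / (w (w + t))`, of norm at most
`1 / |w| ^ 2`. This second-order gain makes the regularized Hurwitz sums converge. -/
theorem grows_inv_sub_log : Grows (-2)
    (fun w => w⁻¹ - (Complex.log (w + 1) - Complex.log w)) := by
  intro ε hε
  obtain ⟨C, hC⟩ := grows_inv_pow 2 ε hε
  refine ⟨C, fun w hw => le_trans ?_ (hC w hw)⟩
  have hw' := halfPlane_subset hw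
  have hw0 := ne_zero_of_mem_rightHalf hw'
  have hderiv : ∀ t ∈ Set.Icc (0 : ℝ) 1,
      HasDerivWithinAt (fun t : ℝ => t * w⁻¹ - Complex.log (w + t)) (w⁻¹ - (w + t)⁻¹)
        (Set.Icc 0 1) t := fun t ht => by
    have h1 : HasDerivAt (fun t : ℝ => (t : ℂ) * w⁻¹) w⁻¹ t := by
      simpa using (Complex.ofRealCLM.hasDerivAt (x := t)).mul_const w⁻¹
    exact h1.hasDerivWithinAt.sub (hasDerivWithinAt_log_add hw' ht.1 _)
  have h := norm_image_sub_le_of_norm_deriv_le_segment_01' (C := ‖(w ^ 2)⁻¹‖) hderiv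
    fun t ht => by
      have h0 := ne_zero_of_mem_rightHalf (add_real_mem_rightHalf hw' ht.1)
      have h1 : w⁻¹ - (w + t)⁻¹ = t * (w⁻¹ * (w + t)⁻¹) := by
        field_simp
        ring
      have h2 : ‖(w + (t : ℂ))⁻¹‖ ≤ ‖w⁻¹‖ := by
        rw [norm_inv, norm_inv]
        exact inv_anti₀ (by linarith [half_le_norm w hw]) (norm_add_nonneg_le w hw'.le t ht.1)
      have h3 : ‖(t : ℂ)‖ ≤ 1 := by
        rw [Complex.norm_real, Real.norm_eq_abs, abs_of_nonneg ht.1]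
        exact ht.2.le
      rw [h1, pow_two, mul_inv, norm_mul, norm_mul, norm_mul]
      calc ‖(t : ℂ)‖ * (‖w⁻¹‖ * ‖(w + (t : ℂ))⁻¹‖) ≤ 1 * (‖w⁻¹‖ * ‖w⁻¹‖) := by gcongr
        _ = _ := one_mul _
  have h4 : w⁻¹ - (Complex.log (w + 1) - Complex.log w) =
      (((1 : ℝ) : ℂ) * w⁻¹ - Complex.log (w + ((1 : ℝ) : ℂ))) -
        (((0 : ℝ) : ℂ) * w⁻¹ - Complex.log (w + ((0 : ℝ) : ℂ))) := by
    simp only [Complex.ofReal_one, Complex.ofReal_zero, add_zero]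
    ring
  beta_reduce
  rw [h4]
  exact h

/-! ### Sums over the translates of a function -/

/-- `∑ₙ s (w + n)` over the natural numbers. -/
noncomputable def sumShift (s : ℂ → ℂ) (w : ℂ) : ℂ := ∑' n : ℕ, s (w + n)

theorem summable_half_rpow {c : ℝ} (hc : c < -1) :
    Summable fun n : ℕ => (((n : ℝ) + 1) / 2) ^ c := by
  have h1 : Summable fun n : ℕ => ((n + 1 : ℕ) : ℝ) ^ c :=
    (summable_nat_add_iff 1).2 (Real.summable_nat_rpow.2 hc)
  refine (h1.mul_right ((1 / 2) ^ c)).congr fun n => ?_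
  rw [← Real.mul_rpow (by positivity) (by norm_num)]
  push_cast
  congr 1
  ring

theorem add_natCast_mem_halfPlane {w : ℂ} (hw : w ∈ halfPlane) (n : ℕ) :
    w + n ∈ halfPlane := by
  have : 1 / 2 ≤ w.re := hw
  change 1 / 2 ≤ (w + n).re
  simp only [Complex.add_re, Complex.natCast_re]
  linarith [(Nat.cast_nonneg n : (0 : ℝ) ≤ n)]

theorem half_le_norm_add_natCast {w : ℂ} (hw : w ∈ halfPlane) (n : ℕ) :
    ((n : ℝ) + 1) / 2 ≤ ‖w + n‖ := by
  have h : 1 / 2 ≤ w.re := hw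
  refine le_trans ?_ (Complex.re_le_norm _)
  simp only [Complex.add_re, Complex.natCast_re]
  linarith [(Nat.cast_nonneg n : (0 : ℝ) ≤ n)]

section SumShift

variable {s : ℂ → ℂ}

theorem exists_norm_shift_le (hs : Grows (-2) s) : ∃ u : ℕ → ℝ, Summable u ∧
    ∀ n : ℕ, ∀ w ∈ halfPlane, ‖s (w + n)‖ ≤ u n := by
  obtain ⟨C, hC⟩ := hs (1 / 2) (by norm_num)
  refine ⟨fun n => C * (((n : ℝ) + 1) / 2) ^ (-2 + 1 / 2 : ℝ),
    (summable_half_rpow (by norm_num)).mul_left C, fun n w hw => ?_⟩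
  have h1 := hC _ (add_natCast_mem_halfPlane hw n)
  have h2 := half_le_norm_add_natCast hw n
  have h3 : (0 : ℝ) < ((n : ℝ) + 1) / 2 := by positivity
  have hC0 : 0 ≤ C := by
    have := (norm_nonneg _).trans h1
    exact nonneg_of_mul_nonneg_left this (Real.rpow_pos_of_pos (by linarith) _)
  refine h1.trans (mul_le_mul_of_nonneg_left ?_ hC0)
  exact Real.rpow_le_rpow_of_nonpos h3 h2 (by norm_num)

theorem add_one_mem_halfPlane {w : ℂ} (hw : w ∈ rightHalf) : w + 1 ∈ halfPlane := by
  have : 0 < w.re := hw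
  change 1 / 2 ≤ (w + 1).re
  simp
  linarith

theorem summable_shift (hs : Grows (-2) s) {w : ℂ} (hw : w ∈ rightHalf) :
    Summable fun n : ℕ => s (w + n) := by
  obtain ⟨u, hu, hle⟩ := exists_norm_shift_le hs
  -- The growth bound holds only for `Re w ≥ 1 / 2`. Dropping the first term replaces `w` by `w +
  -- 1`, which satisfies this.
  rw [← summable_nat_add_iff 1]
  refine Summable.of_norm_bounded hu fun n => ?_
  have := hle n _ (add_one_mem_halfPlane hw)
  rwa [add_assoc, add_comm (1 : ℂ), ← Nat.cast_add_one] at this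

theorem sumShift_eq (hs : Grows (-2) s) {w : ℂ} (hw : w ∈ rightHalf) :
    sumShift s w = s w + sumShift s (w + 1) := by
  rw [sumShift, (summable_shift hs hw).tsum_eq_zero_add, sumShift]
  congr 1
  · simp
  · refine tsum_congr fun n => ?_
    push_cast
    rw [add_assoc, add_comm (1 : ℂ)]

theorem differentiableOn_sumShift (hs : Grows (-2) s) (hd : DifferentiableOn ℂ s rightHalf) :
    DifferentiableOn ℂ (sumShift s) rightHalf := by
  obtain ⟨u, hu, hle⟩ := exists_norm_shift_le hs
  have h1 : DifferentiableOn ℂ (fun w => sumShift s (w + 1)) rightHalf := by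
    refine Complex.differentiableOn_tsum_of_summable_norm hu (fun n => ?_) isOpen_rightHalf
      fun n w hw => hle n _ (add_one_mem_halfPlane hw)
    refine hd.comp (by fun_prop) fun w hw => ?_
    have := add_real_mem_rightHalf (add_one_mem_rightHalf hw) (Nat.cast_nonneg n)
    simpa using this
  exact (hd.add h1).congr fun w hw => sumShift_eq hs hw

theorem Grows.sumShift (hs : Grows (-2) s) : Grows (-1) (sumShift s) := by
  refine growsLike_of_le_one half_le_norm fun ε hε hε1 => ?_
  obtain ⟨C, hC⟩ := hs (ε / 2) (by positivity)
  set v : ℕ → ℝ := fun n => (((n : ℝ) + 1) / 2) ^ (-1 - ε / 2 : ℝ) with hv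
  have hvs : Summable v := summable_half_rpow (by linarith)
  refine ⟨C * ∑' n, v n, fun w hw => ?_⟩
  have h0 := half_le_norm w hw
  have hC0 : 0 ≤ C := by
    have := (norm_nonneg _).trans (hC w hw)
    exact nonneg_of_mul_nonneg_left this (Real.rpow_pos_of_pos (by linarith) _)
  have hbound : ∀ n : ℕ, ‖s (w + n)‖ ≤ C * ‖w‖ ^ (-1 + ε) * v n := by
    intro n
    have h1 := hC _ (add_natCast_mem_halfPlane hw n)
    have h2 := half_le_norm_add_natCast hw n
    have h3 : (0 : ℝ) < ((n : ℝ) + 1) / 2 := by positivity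
    have h4 : ‖w‖ ≤ ‖w + n‖ := by
      simpa using norm_add_nonneg_le w (halfPlane_subset hw).le n (Nat.cast_nonneg n)
    -- The first exponent is spent on the decay in `w`, the second on summability in `n`. The first
    -- is nonpositive because `ε ≤ 1`, so `|w + n|` may be replaced by `|w|`.
    have h5 : (-2 + ε / 2 : ℝ) = (-1 + ε) + (-1 - ε / 2) := by ring
    rw [h5, Real.rpow_add (by linarith)] at h1
    refine h1.trans ?_
    rw [mul_assoc]
    refine mul_le_mul_of_nonneg_left (mul_le_mul ?_ ?_ (by positivity) (by positivity)) hC0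
    · exact Real.rpow_le_rpow_of_nonpos (by linarith) h4 (by linarith)
    · exact Real.rpow_le_rpow_of_nonpos h3 h2 (by linarith)
  have h6 := tsum_of_norm_bounded (hvs.mul_left (C * ‖w‖ ^ (-1 + ε))).hasSum hbound
  rw [tsum_mul_left] at h6
  rw [MZV.sumShift]
  calc _ ≤ _ := h6
    _ = _ := by ring

end SumShift

/-! ### Regularized multiple Hurwitz zeta functions -/

/-- `-(log w + γ)` -/
noncomputable def negLogGamma (w : ℂ) : ℂ :=
  -(Complex.log w + (Real.eulerMascheroniConstant : ℂ))

/-- The leading term of the regularized multiple Hurwitz zeta function at infinity. -/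
noncomputable def hurwitzLead (k : List ℕ+) (w : ℂ) : ℂ :=
  if k = List.replicate k.length 1 then negLogGamma w ^ k.length / (k.length.factorial : ℂ) else 0

/-- The regularized multiple Hurwitz zeta function
`∑_{0 ≤ n₁ < ⋯ < n_d} 1 / ((w + n₁) ^ k₁ ⋯ (w + n_d) ^ k_d)`. -/
noncomputable def hurwitz : List ℕ+ → ℂ → ℂ
  | [], _ => 1
  | x :: k, w => hurwitzLead (x :: k) w + sumShift (fun v =>
      hurwitzLead (x :: k) (v + 1) - hurwitzLead (x :: k) v + (v ^ (x : ℕ))⁻¹ * hurwitz k (v + 1)) w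

/-- The function whose translates are summed in the definition of `hurwitz`. -/
noncomputable def hurwitzStep (x : ℕ+) (k : List ℕ+) (v : ℂ) : ℂ :=
  hurwitzLead (x :: k) (v + 1) - hurwitzLead (x :: k) v + (v ^ (x : ℕ))⁻¹ * hurwitz k (v + 1)

theorem hurwitz_cons (x : ℕ+) (k : List ℕ+) (w : ℂ) :
    hurwitz (x :: k) w = hurwitzLead (x :: k) w + sumShift (hurwitzStep x k) w := rfl

theorem cons_eq_replicate_one {x : ℕ+} {k : List ℕ+} :
    x :: k = List.replicate (x :: k).length 1 ↔ x = 1 ∧ k = List.replicate k.length 1 := by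
  rw [List.length_cons, List.replicate_succ, List.cons.injEq]

theorem append_eq_replicate_one {k l : List ℕ+} :
    k ++ l = List.replicate (k ++ l).length 1 ↔
      k = List.replicate k.length 1 ∧ l = List.replicate l.length 1 := by
  simp only [List.eq_replicate_length, List.mem_append]
  exact ⟨fun h => ⟨fun b hb => h b (Or.inl hb), fun b hb => h b (Or.inr hb)⟩,
    fun h b hb => hb.elim (h.1 b) (h.2 b)⟩

theorem reverse_eq_replicate_one {k : List ℕ+} :
    k.reverse = List.replicate k.reverse.length 1 ↔ k = List.replicate k.length 1 := by
  rw [List.eq_replicate_length, List.eq_replicate_length]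
  simp

theorem hurwitzLead_nil (w : ℂ) : hurwitzLead [] w = 1 := by simp [hurwitzLead]

theorem grows_negLogGamma : Grows 0 negLogGamma :=
  ((grows_log.add (growsLike_const half_le_norm
    (Real.eulerMascheroniConstant : ℂ))).const_mul half_le_norm (-1)).congr
    fun w _ => by simp [negLogGamma]

theorem grows_hurwitzLead (k : List ℕ+) : Grows 0 (hurwitzLead k) := by
  by_cases h : k = List.replicate k.length 1
  · refine ((grows_negLogGamma.pow half_le_norm k.length).const_mul half_le_norm
      (k.length.factorial : ℂ)⁻¹).congr fun w _ => ?_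
    rw [hurwitzLead, if_pos h]
    ring
  · refine growsLike_zero.congr fun w _ => ?_
    rw [hurwitzLead, if_neg h]

theorem differentiableOn_hurwitzLead (k : List ℕ+) :
    DifferentiableOn ℂ (hurwitzLead k) rightHalf := by
  by_cases h : k = List.replicate k.length 1
  · have h1 : DifferentiableOn ℂ negLogGamma rightHalf := fun w hw =>
      ((Complex.differentiableAt_log (Or.inl hw)).add_const _).neg.differentiableWithinAt
    refine ((h1.pow k.length).div_const (k.length.factorial : ℂ)).congr fun w _ => ?_
    rw [hurwitzLead, if_pos h]
    rfl
  · have h2 : hurwitzLead k = fun _ => 0 := by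
      funext w
      rw [hurwitzLead, if_neg h]
    rw [h2]
    exact differentiableOn_const 0

/-- The binomial expansion beyond the linear term: everything left contains `δ ^ 2`, and powers of
`a` cost nothing in the growth exponent. -/
theorem grows_add_pow_sub {a δ : ℂ → ℂ} (ha : Grows 0 a) (hδ : Grows (-1) δ) (p : ℕ) :
    Grows (-2) (fun w => (a w + δ w) ^ (p + 1) - a w ^ (p + 1) - (p + 1) * a w ^ p * δ w) := by
  induction p with
  | zero => exact growsLike_zero.congr fun w _ => by push_cast; ring
  | succ p ih =>
    have h1 : Grows 0 (fun w => a w + δ w) :=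
      ha.add (hδ.mono half_le_norm (by norm_num))
    have h2 := h1.mul half_le_norm ih
    have h3 := ((ha.pow half_le_norm p).const_mul half_le_norm ((p : ℂ) + 1)).mul half_le_norm
      (hδ.mul half_le_norm hδ)
    norm_num at h2 h3
    refine (h2.add h3).congr fun w _ => ?_
    push_cast
    ring

/-- If `x :: k` consists of ones, the first-order change of the leading term under `v ↦ v + 1`
cancels `v⁻¹` times the leading term of `hurwitz k`. Otherwise all leading terms of `x :: k` vanish,
and decay of order `2` comes either from `v ^ (-x)` with `x ≥ 2` or from `v⁻¹` times a function
`hurwitz k` without leading term. -/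
theorem grows_hurwitzStep {x : ℕ+} {k : List ℕ+}
    (hk : Grows (-1) (fun w => hurwitz k w - hurwitzLead k w)) :
    Grows (-2) (hurwitzStep x k) := by
  have hk0 : Grows 0 (hurwitz k) :=
    ((hk.mono half_le_norm (by norm_num)).add (grows_hurwitzLead k)).congr fun w _ => by ring
  by_cases hx : x = 1
  · subst hx
    by_cases h1 : k = List.replicate k.length 1
    · set p := k.length with hp
      -- the leading terms cancel up to second order
      have hδ : Grows (-1) (fun w => negLogGamma w - negLogGamma (w + 1)) :=
        grows_log_add_one_sub.congr fun w _ => by simp only [negLogGamma]; ring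
      have h2 := (grows_add_pow_sub grows_negLogGamma.comp_add_one hδ p).const_mul half_le_norm
        (-((p + 1).factorial : ℂ)⁻¹)
      have h3 := (((grows_negLogGamma.comp_add_one).pow half_le_norm p).const_mul half_le_norm
        (p.factorial : ℂ)⁻¹).mul half_le_norm grows_inv_sub_log
      have h4 := grows_inv.mul half_le_norm hk.comp_add_one
      norm_num at h2 h3 h4
      refine ((h2.add h3).add h4).congr fun w _ => ?_
      have hL : Complex.log (w + 1) - Complex.log w = negLogGamma w - negLogGamma (w + 1) := by
        simp only [negLogGamma]; ring
      have hf : ((p + 1).factorial : ℂ) = (p + 1) * p.factorial := by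
        rw [Nat.factorial_succ]; push_cast; ring
      have hp0 : (p.factorial : ℂ) ≠ 0 := by exact_mod_cast p.factorial_ne_zero
      have hp1 : (p : ℂ) + 1 ≠ 0 := by exact_mod_cast p.succ_ne_zero
      rw [hL, hurwitzStep, hurwitzLead, hurwitzLead, hurwitzLead,
        if_pos (cons_eq_replicate_one.2 ⟨rfl, h1⟩), if_pos (cons_eq_replicate_one.2 ⟨rfl, h1⟩),
        if_pos h1, List.length_cons, ← hp, hf, PNat.one_coe, pow_one]
      field_simp
      ring
    · have h2 : ¬ (1 :: k = List.replicate (1 :: k).length 1) := fun h =>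
        h1 (cons_eq_replicate_one.1 h).2
      have h4 := grows_inv.mul half_le_norm hk.comp_add_one
      norm_num at h4
      refine h4.congr fun w _ => ?_
      rw [hurwitzStep, hurwitzLead, hurwitzLead, hurwitzLead, if_neg h2, if_neg h2, if_neg h1]
      simp
  · have h2 : ¬ (x :: k = List.replicate (x :: k).length 1) := fun h =>
      hx (cons_eq_replicate_one.1 h).1
    have hx2 : (2 : ℝ) ≤ (x : ℕ) := by
      have h1 : (x : ℕ) ≠ 1 := fun h => hx (PNat.coe_eq_one_iff.1 h)
      have := x.pos
      exact_mod_cast (by omega : 2 ≤ (x : ℕ))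
    have h4 := ((grows_inv_pow (x : ℕ)).mono half_le_norm (s := -2) (by linarith)).mul half_le_norm
      hk0.comp_add_one
    rw [add_zero] at h4
    refine h4.congr fun w _ => ?_
    rw [hurwitzStep, hurwitzLead, hurwitzLead, if_neg h2, if_neg h2]
    simp

theorem grows_hurwitz_sub_lead (k : List ℕ+) :
    Grows (-1) (fun w => hurwitz k w - hurwitzLead k w) := by
  induction k with
  | nil => exact growsLike_zero.congr fun w _ => by simp [hurwitz, hurwitzLead_nil]
  | cons x k ih =>
    exact (grows_hurwitzStep ih).sumShift.congr fun w _ => by rw [hurwitz_cons]; ring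

theorem grows_hurwitz (k : List ℕ+) : Grows 0 (hurwitz k) :=
  (((grows_hurwitz_sub_lead k).mono half_le_norm (by norm_num)).add
    (grows_hurwitzLead k)).congr fun w _ => by ring

theorem differentiableOn_hurwitz (k : List ℕ+) :
    DifferentiableOn ℂ (hurwitz k) rightHalf := by
  induction k with
  | nil => exact differentiableOn_const 1
  | cons x k ih =>
    have hmaps : Set.MapsTo (fun w : ℂ => w + 1) rightHalf rightHalf :=
      fun w hw => add_one_mem_rightHalf hw
    refine (differentiableOn_hurwitzLead _).add (differentiableOn_sumShift
      (grows_hurwitzStep (grows_hurwitz_sub_lead k)) ?_)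
    refine DifferentiableOn.add (DifferentiableOn.sub
      ((differentiableOn_hurwitzLead _).comp (by fun_prop) hmaps)
      (differentiableOn_hurwitzLead _)) (DifferentiableOn.mul ?_ (ih.comp (by fun_prop) hmaps))
    exact (differentiableOn_id.pow _).inv fun w hw => pow_ne_zero _ (ne_zero_of_mem_rightHalf hw)

/-- Peeling off the first translate makes the leading terms telescope. What remains is the recursion
of the formal nested sum according to whether its smallest index is `0`. -/
theorem hurwitz_cons_eq (x : ℕ+) (k : List ℕ+) {w : ℂ} (hw : w ∈ rightHalf) :
    hurwitz (x :: k) w = hurwitz (x :: k) (w + 1) + (w ^ (x : ℕ))⁻¹ * hurwitz k (w + 1) := by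
  rw [hurwitz_cons, sumShift_eq (grows_hurwitzStep (grows_hurwitz_sub_lead k)) hw, hurwitz_cons,
    hurwitzStep]
  ring

/-- The function on words supported on words of length at most one, with value `u ^ (-x)` at a
one-letter word `x`. -/
noncomputable def point (u : ℂ) : List ℕ+ → ℂ := letterFun fun x => (u ^ (x : ℕ))⁻¹

theorem hurwitz_eq_conv {w : ℂ} (hw : w ∈ rightHalf) :
    (fun k => hurwitz k w) = conv (point w) (fun k => hurwitz k (w + 1)) := by
  funext k
  cases k with
  | nil => simp [point, conv_letterFun_nil, hurwitz]
  | cons x k => rw [point, conv_letterFun_cons, hurwitz_cons_eq x k hw]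

/-! ### Derivatives and Taylor coefficients -/

/-- `∑ⱼ kⱼ F (k₁, …, kⱼ + 1, …, k_d)` -/
def raise {R : Type*} [CommRing R] : (List ℕ+ → R) → List ℕ+ → R
  | _, [] => 0
  | F, x :: k => ((x : ℕ) : R) * F ((x + 1) :: k) + raise (fun l => F (x :: l)) k

section Raise

variable {R : Type*} [CommRing R]

theorem raise_cons (F : List ℕ+ → R) (x : ℕ+) (k : List ℕ+) :
    raise F (x :: k) = ((x : ℕ) : R) * F ((x + 1) :: k) + raise (fun l => F (x :: l)) k := rfl

theorem raise_add (F G : List ℕ+ → R) (k : List ℕ+) :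
    raise (fun l => F l + G l) k = raise F k + raise G k := by
  induction k generalizing F G with
  | nil => simp [raise]
  | cons x k ih => simp only [raise_cons, ih]; ring

theorem raise_mul (c : R) (F : List ℕ+ → R) (k : List ℕ+) :
    raise (fun l => c * F l) k = c * raise F k := by
  induction k generalizing F with
  | nil => simp [raise]
  | cons x k ih => simp only [raise_cons, ih]; ring

theorem raise_sum {ι : Type*} (s : Finset ι) (F : ι → List ℕ+ → R) (k : List ℕ+) :
    raise (fun l => ∑ i ∈ s, F i l) k = ∑ i ∈ s, raise (F i) k := by
  induction k generalizing F with
  | nil => simp [raise]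
  | cons x k ih => simp only [raise_cons, ih, Finset.mul_sum, Finset.sum_add_distrib]

end Raise

theorem hurwitzLead_eq_zero {k : List ℕ+} (h : k ≠ List.replicate k.length 1) (w : ℂ) :
    hurwitzLead k w = 0 := by
  rw [hurwitzLead, if_neg h]

theorem grows_hurwitz_of_ne {k : List ℕ+} (h : k ≠ List.replicate k.length 1) :
    Grows (-1) (hurwitz k) :=
  (grows_hurwitz_sub_lead k).congr fun w _ => by rw [hurwitzLead_eq_zero h, sub_zero]

/-- Every word that occurs has a raised entry, which is at least `2`, so its leading term vanishes.
The prefix `p` is there for the induction, since `raise` moves letters to the front. -/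
theorem grows_raise_hurwitz (p k : List ℕ+) :
    Grows (-1) (fun w => raise (fun l => hurwitz (p ++ l) w) k) := by
  induction k generalizing p with
  | nil => exact growsLike_zero
  | cons x k ih =>
    have h : p ++ (x + 1) :: k ≠ List.replicate (p ++ (x + 1) :: k).length 1 := fun h =>
      add_one_ne_one x (cons_eq_replicate_one.1 (append_eq_replicate_one.1 h).2).1
    refine (((grows_hurwitz_of_ne h).const_mul half_le_norm ((x : ℕ) : ℂ)).add
      (ih (p ++ [x]))).congr fun w _ => ?_
    simp [raise_cons]

theorem mem_rightHalf_nhds {w : ℂ} (hw : w ∈ rightHalf) : rightHalf ∈ 𝓝 w :=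
  isOpen_rightHalf.mem_nhds hw

theorem differentiableAt_hurwitz (k : List ℕ+) {w : ℂ} (hw : w ∈ rightHalf) :
    DifferentiableAt ℂ (hurwitz k) w :=
  (differentiableOn_hurwitz k).differentiableAt (mem_rightHalf_nhds hw)

theorem tendsto_norm_add_natCast (w : ℂ) :
    Tendsto (fun n : ℕ => ‖w + n‖) atTop atTop := by
  have h : Tendsto (fun n : ℕ => (n : ℝ) - ‖w‖) atTop atTop :=
    tendsto_atTop_add_const_right _ _ tendsto_natCast_atTop_atTop
  refine tendsto_atTop_mono (fun n => ?_) h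
  have h1 := norm_sub_norm_le (n : ℂ) (-w)
  rw [norm_neg, sub_neg_eq_add, Complex.norm_natCast] at h1
  rwa [add_comm w]

/-- Slowly growing holomorphic functions have small derivatives. -/
theorem tendsto_deriv_of_grows {g : ℂ → ℂ} (hg : Grows 0 g) (hd : DifferentiableOn ℂ g rightHalf)
    {w : ℂ} (hw : w ∈ rightHalf) : Tendsto (fun n : ℕ => deriv g (w + n)) atTop (𝓝 0) := by
  have hw' : 0 < w.re := hw
  obtain ⟨C, hC⟩ := hg (1 / 2) (by norm_num)
  rw [zero_add] at hC
  -- This is Cauchy's bound on the circle of radius `n / 2` about `w + n`. There `|v| ≤ n / 2 + |w|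
  -- + n ≤ 3 n` once `|w| ≤ n`, and `Re v ≥ 1 / 2`.
  have hlim : Tendsto (fun n : ℕ => C * (3 * (n : ℝ)) ^ (1 / 2 : ℝ) / (n / 2)) atTop (𝓝 0) := by
    have h1 := ((tendsto_rpow_neg_atTop (y := 1 / 2) (by norm_num)).comp
      (tendsto_natCast_atTop_atTop (R := ℝ))).const_mul (C * 3 ^ (1 / 2 : ℝ) * 2)
    rw [mul_zero] at h1
    refine h1.congr' ?_
    filter_upwards [eventually_ge_atTop 1] with n hn
    have hn' : (0 : ℝ) < n := by exact_mod_cast hn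
    have h2 : (n : ℝ) ^ (1 / 2 : ℝ) = n * (n : ℝ) ^ (-(1 / 2) : ℝ) := by
      nth_rw 2 [← Real.rpow_one (n : ℝ)]
      rw [← Real.rpow_add hn']
      norm_num
    rw [Real.mul_rpow (by norm_num) hn'.le, h2]
    simp only [Function.comp]
    field_simp
  refine squeeze_zero_norm' ?_ hlim
  filter_upwards [eventually_ge_atTop 1, eventually_ge_atTop ⌈‖w‖⌉₊] with n hn hnw
  have hn' : (1 : ℝ) ≤ n := by exact_mod_cast hn
  have hnw' : ‖w‖ ≤ n := Nat.ceil_le.1 hnw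
  have hC0 : 0 ≤ C := by
    have h := (norm_nonneg _).trans (hC 1 (by norm_num [halfPlane]))
    simpa using h
  have hball : ∀ v ∈ Metric.closedBall (w + n) ((n : ℝ) / 2), v ∈ halfPlane := fun v hv => by
    have h1 := (Complex.abs_re_le_norm (v - (w + n))).trans (mem_closedBall_iff_norm.1 hv)
    rw [abs_le] at h1
    simp at h1
    change 1 / 2 ≤ v.re
    linarith
  refine Complex.norm_deriv_le_of_forall_mem_sphere_norm_le (by linarith) ?_ fun v hv => ?_
  · refine DifferentiableOn.diffContOnCl ?_
    rw [closure_ball _ (by linarith)]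
    exact hd.mono fun v hv => halfPlane_subset (hball v hv)
  · have h1 := hball v (Metric.sphere_subset_closedBall hv)
    refine (hC v h1).trans (mul_le_mul_of_nonneg_left ?_ hC0)
    refine Real.rpow_le_rpow (norm_nonneg _) ?_ (by norm_num)
    have h2 : ‖v - (w + n)‖ = n / 2 := mem_sphere_iff_norm.1 hv
    have h3 := norm_add₃_le (a := v - (w + n)) (b := w) (c := (n : ℂ))
    rw [h2, Complex.norm_natCast, sub_add_eq_add_sub, add_assoc, add_sub_assoc, add_assoc] at h3
    simp at h3
    linarith

/-- Termwise differentiation of the formal sum predicts this, but the regularization needs an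
argument. By the recursion and induction, the defect `D` between the two sides is invariant under `w
↦ w + 1`. It tends to `0` along `w + n`, by Cauchy's estimate for one part and by the missing
leading terms for the other. Hence it vanishes. -/
theorem deriv_hurwitz (k : List ℕ+) {w : ℂ} (hw : w ∈ rightHalf) :
    deriv (hurwitz k) w = -raise (fun l => hurwitz l w) k := by
  induction k generalizing w with
  | nil =>
    have h : hurwitz [] = fun _ => 1 := rfl
    simp [h, raise]
  | cons x k ih =>
    set D : ℂ → ℂ := fun w =>
      deriv (hurwitz (x :: k)) w + raise (fun l => hurwitz l w) (x :: k) with hD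
    have hstep : ∀ w ∈ rightHalf, D w = D (w + 1) := by
      intro w hw
      have hw0 := ne_zero_of_mem_rightHalf hw
      have hw1 := add_one_mem_rightHalf hw
      have h1 : hurwitz (x :: k) =ᶠ[𝓝 w] fun v =>
          hurwitz (x :: k) (v + 1) + (v ^ (x : ℕ))⁻¹ * hurwitz k (v + 1) := by
        filter_upwards [mem_rightHalf_nhds hw] with v hv
        exact hurwitz_cons_eq x k hv
      have hA : ∀ l, HasDerivAt (fun v => hurwitz l (v + 1)) (deriv (hurwitz l) (w + 1)) w :=
        fun l => HasDerivAt.comp_add_const w 1 (differentiableAt_hurwitz l hw1).hasDerivAt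
      have hB := ((hasDerivAt_pow (x : ℕ) w).fun_inv (pow_ne_zero _ hw0)).mul (hA k)
      have h2 := h1.deriv_eq.trans ((hA (x :: k)).add hB).deriv
      have h3 : raise (fun l => hurwitz (x :: l) w) k =
          raise (fun l => hurwitz (x :: l) (w + 1)) k +
            (w ^ (x : ℕ))⁻¹ * raise (fun l => hurwitz l (w + 1)) k := by
        rw [← raise_mul, ← raise_add]
        congr 1
        funext l
        exact hurwitz_cons_eq x l hw
      have h4 := hurwitz_cons_eq (x + 1) k hw
      have h5 := ih hw1
      simp only [hD]
      rw [h2, raise_cons, raise_cons, h3, h4, h5, PNat.add_coe, PNat.one_coe]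
      obtain ⟨m, hm⟩ := Nat.exists_eq_succ_of_ne_zero x.ne_zero
      rw [hm]
      simp only [Nat.succ_eq_add_one, Nat.add_sub_cancel]
      field_simp
      ring
    have hconst : ∀ n : ℕ, D (w + n) = D w := by
      intro n
      induction n with
      | zero => simp
      | succ n ihn =>
        have h := hstep (w + n) (by simpa using add_real_mem_rightHalf hw (Nat.cast_nonneg n))
        rw [← ihn, h]
        push_cast
        rw [add_assoc]
    have hlim : Tendsto (fun n : ℕ => D (w + n)) atTop (𝓝 0) := by
      have h1 := tendsto_deriv_of_grows (grows_hurwitz (x :: k)) (differentiableOn_hurwitz _) hw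
      have h2 := (grows_raise_hurwitz [] (x :: k)).tendsto_zero (φ := fun n : ℕ => w + n)
        (l := atTop) (by norm_num) ?_ (tendsto_norm_add_natCast w)
      · simpa using h1.add h2
      · filter_upwards [eventually_ge_atTop 1] with n hn
        have hn' : (1 : ℝ) ≤ n := by exact_mod_cast hn
        have hw' : 0 < w.re := hw
        change 1 / 2 ≤ (w + n).re
        simp
        linarith
    simp only [hconst] at hlim
    have := tendsto_nhds_unique hlim tendsto_const_nhds
    linear_combination -this

/-- The `a`-th coefficient of the Taylor expansion of `g` at `0`. -/
noncomputable def taylorCoeff (a : ℕ) (g : ℂ → ℂ) : ℂ := iteratedDeriv a g 0 / (a.factorial : ℂ)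

section TaylorSum

variable {R : Type*} [CommRing R]

/-- The sum over `a₁ + ⋯ + a_d = a` of
`(-1)^a ∏ⱼ (kⱼ - 1 + aⱼ choose aⱼ) F (k₁ + a₁, …, k_d + a_d)`. -/
def taylorSum : (List ℕ+ → R) → ℕ → List ℕ+ → R
  | F, a, [] => if a = 0 then F [] else 0
  | F, a, x :: k => ∑ p ∈ Finset.HasAntidiagonal.antidiagonal a,
      (-1) ^ p.1 * (((x : ℕ) - 1 + p.1).choose p.1 : R) *
        taylorSum (fun l => F (Nat.succPNat ((x : ℕ) - 1 + p.1) :: l)) p.2 k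

theorem taylorSum_zero (F : List ℕ+ → R) (k : List ℕ+) : taylorSum F 0 k = F k := by
  induction k generalizing F with
  | nil => simp [taylorSum]
  | cons x k ih =>
    have : Nat.succPNat ((x : ℕ) - 1) = x := PNat.succPNat_natPred x
    simp [taylorSum, ih, this]

/-- The factor `a + 1` is the sum of the two coordinates. Each coordinate, as a weight, kills the
terms where it is `0`, which allows a shift of the index. -/
theorem sum_antidiagonal_succ_weighted (f : ℕ → ℕ → R) (a : ℕ) :
    ((a : R) + 1) * ∑ p ∈ Finset.HasAntidiagonal.antidiagonal (a + 1), f p.1 p.2 =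
      ∑ p ∈ Finset.HasAntidiagonal.antidiagonal a, ((p.1 : R) + 1) * f (p.1 + 1) p.2 +
        ∑ p ∈ Finset.HasAntidiagonal.antidiagonal a, ((p.2 : R) + 1) * f p.1 (p.2 + 1) := by
  have h1 := Finset.Nat.sum_antidiagonal_succ (n := a)
    (f := fun p : ℕ × ℕ => (p.1 : R) * f p.1 p.2)
  have h2 := Finset.Nat.sum_antidiagonal_succ' (n := a)
    (f := fun p : ℕ × ℕ => (p.2 : R) * f p.1 p.2)
  push_cast at h1 h2
  simp only [zero_mul, zero_add] at h1 h2
  rw [← h1, ← h2, ← Finset.sum_add_distrib, Finset.mul_sum]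
  refine Finset.sum_congr rfl fun p hp => ?_
  rw [← add_mul, ← Nat.cast_add, Finset.HasAntidiagonal.mem_antidiagonal.1 hp]
  push_cast
  rfl

/-- This recursion matches differentiation of the Hurwitz functions, which is `-raise`. It
identifies their Taylor coefficients with the binomial sums. -/
theorem taylorSum_succ (F : List ℕ+ → R) (a : ℕ) (k : List ℕ+) :
    ((a : R) + 1) * taylorSum F (a + 1) k = -raise (taylorSum F a) k := by
  induction k generalizing F a with
  | nil => simp [taylorSum, raise]
  | cons x k ih =>
    rw [raise_cons]
    simp only [taylorSum]
    rw [sum_antidiagonal_succ_weighted (fun b c =>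
      (-1) ^ b * (((x : ℕ) - 1 + b).choose b : R) *
        taylorSum (fun l => F (Nat.succPNat ((x : ℕ) - 1 + b) :: l)) c k), raise_sum, neg_add]
    congr 1
    · rw [Finset.mul_sum, ← Finset.sum_neg_distrib]
      refine Finset.sum_congr rfl fun p _ => ?_
      have hx := x.pos
      have h1 : (((x + 1 : ℕ+) : ℕ) - 1 + p.1) = (x : ℕ) - 1 + (p.1 + 1) := by
        rw [PNat.add_coe, PNat.one_coe]; omega
      -- With `b = p.1`, both binomials have upper index `x + b`, so this is the absorption identity
      -- `(b + 1) C(x + b, b + 1) = x C(x + b, b)`.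
      have h2 : (p.1 + 1) * ((x : ℕ) - 1 + (p.1 + 1)).choose (p.1 + 1) =
          x * ((x : ℕ) - 1 + (p.1 + 1)).choose p.1 := by
        have h3 := Nat.choose_succ_right_eq ((x : ℕ) - 1 + (p.1 + 1)) p.1
        have h4 : (x : ℕ) - 1 + (p.1 + 1) - p.1 = x := by omega
        rw [h4] at h3
        linarith
      have h2' : ((p.1 : R) + 1) * (((x : ℕ) - 1 + (p.1 + 1)).choose (p.1 + 1) : R) =
          (x : ℕ) * (((x : ℕ) - 1 + (p.1 + 1)).choose p.1 : R) := by
        have h3 := congrArg (Nat.cast : ℕ → R) h2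
        rw [Nat.cast_mul, Nat.cast_mul, Nat.cast_add, Nat.cast_one] at h3
        exact h3
      rw [h1, pow_succ]
      linear_combination ((-1) ^ p.1 * (-1) * taylorSum
        (fun l => F (Nat.succPNat ((x : ℕ) - 1 + (p.1 + 1)) :: l)) p.2 k) * h2'
    · rw [← Finset.sum_neg_distrib]
      refine Finset.sum_congr rfl fun p _ => ?_
      rw [raise_mul]
      linear_combination ((-1) ^ p.1 * (((x : ℕ) - 1 + p.1).choose p.1 : R)) *
        ih (fun l => F (Nat.succPNat ((x : ℕ) - 1 + p.1) :: l)) p.2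

theorem sum_antidiagonalTuple_succ (n a : ℕ) (f : (Fin (n + 1) → ℕ) → R) :
    ∑ α ∈ Finset.Nat.antidiagonalTuple (n + 1) a, f α =
      ∑ p ∈ Finset.HasAntidiagonal.antidiagonal a, ∑ β ∈ Finset.Nat.antidiagonalTuple n p.2,
        f (Fin.cons p.1 β) := by
  rw [Finset.sum_sigma']
  refine Finset.sum_bij' (fun α _ => ⟨(α 0, ∑ i, Fin.tail α i), Fin.tail α⟩)
    (fun q _ => Fin.cons q.1.1 q.2) ?_ ?_ ?_ ?_ ?_
  · intro α hα
    rw [Finset.Nat.mem_antidiagonalTuple, Fin.sum_univ_succ] at hα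
    simp only [Finset.mem_sigma, Finset.HasAntidiagonal.mem_antidiagonal, Finset.Nat.mem_antidiagonalTuple]
    exact ⟨hα, trivial⟩
  · rintro ⟨⟨b, c⟩, β⟩ hq
    simp only [Finset.mem_sigma, Finset.HasAntidiagonal.mem_antidiagonal,
      Finset.Nat.mem_antidiagonalTuple] at hq
    rw [Finset.Nat.mem_antidiagonalTuple, Fin.sum_univ_succ]
    simp [hq.1, hq.2]
  · intro α _
    exact Fin.cons_self_tail α
  · rintro ⟨⟨b, c⟩, β⟩ hq
    simp only [Finset.mem_sigma, Finset.HasAntidiagonal.mem_antidiagonal,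
      Finset.Nat.mem_antidiagonalTuple] at hq
    simp [hq.2]
  · intro α _
    simp only [Fin.cons_self_tail]

theorem taylorSum_eq (F : List ℕ+ → R) (a : ℕ) (k : List ℕ+) :
    taylorSum F a k = (-1) ^ a * ∑ α ∈ Finset.Nat.antidiagonalTuple k.length a,
      F (List.ofFn fun j => Nat.succPNat ((k.get j : ℕ) - 1 + α j)) *
        ∏ j, ((((k.get j : ℕ) - 1 + α j).choose (α j) : ℕ) : R) := by
  induction k generalizing F a with
  | nil =>
    cases a <;> simp [taylorSum]
  | cons x k ih =>
    simp only [List.length_cons]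
    rw [sum_antidiagonalTuple_succ, Finset.mul_sum, taylorSum]
    refine Finset.sum_congr rfl fun p hp => ?_
    rw [ih, ← Finset.HasAntidiagonal.mem_antidiagonal.1 hp, pow_add, Finset.mul_sum, Finset.mul_sum,
      Finset.mul_sum]
    refine Finset.sum_congr rfl fun β _ => ?_
    rw [Fin.prod_univ_succ, List.ofFn_succ]
    simp only [Fin.cons_zero, Fin.cons_succ, List.get_eq_getElem, List.getElem_cons_succ,
      Fin.val_succ, Fin.val_zero, List.getElem_cons_zero]
    ring

end TaylorSum

theorem zetaTaylor_eq (a : ℕ) (k : List ℕ+) : zetaTaylor a k = taylorSum zetaReg a k :=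
  (taylorSum_eq zetaReg a k).symm

theorem contDiffAt_hurwitz (k : List ℕ+) {w : ℂ} (hw : w ∈ rightHalf) (n : WithTop ℕ∞) :
    ContDiffAt ℂ n (hurwitz k) w :=
  ((differentiableOn_hurwitz k).analyticAt (mem_rightHalf_nhds hw)).contDiffAt

theorem contDiffAt_raise {G : List ℕ+ → ℂ → ℂ} {w : ℂ} {n : WithTop ℕ∞}
    (hG : ∀ l, ContDiffAt ℂ n (G l) w) (k : List ℕ+) :
    ContDiffAt ℂ n (fun v => raise (fun l => G l v) k) w := by
  induction k generalizing G with
  | nil => exact contDiffAt_const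
  | cons x k ih => exact (contDiffAt_const.mul (hG _)).add (ih fun l => hG _)

theorem iteratedDeriv_raise {G : List ℕ+ → ℂ → ℂ} {w : ℂ} {a : ℕ}
    (hG : ∀ l, ContDiffAt ℂ a (G l) w) (k : List ℕ+) :
    iteratedDeriv a (fun v => raise (fun l => G l v) k) w =
      raise (fun l => iteratedDeriv a (G l) w) k := by
  induction k generalizing G with
  | nil => simp [raise]
  | cons x k ih =>
    simp only [raise_cons]
    rw [iteratedDeriv_fun_add (contDiffAt_const.mul (hG _)) (contDiffAt_raise (fun l => hG _) k),
      iteratedDeriv_const_mul_field, ih fun l => hG _]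

theorem iteratedDeriv_hurwitz (a : ℕ) (k : List ℕ+) {w : ℂ} (hw : w ∈ rightHalf) :
    iteratedDeriv a (hurwitz k) w =
      (a.factorial : ℂ) * taylorSum (fun l => hurwitz l w) a k := by
  induction a generalizing k with
  | zero => simp [taylorSum_zero]
  | succ a ih =>
    have h1 : deriv (hurwitz k) =ᶠ[𝓝 w] fun v => -raise (fun l => hurwitz l v) k := by
      filter_upwards [mem_rightHalf_nhds hw] with v hv
      exact deriv_hurwitz k hv
    rw [iteratedDeriv_succ', h1.iteratedDeriv_eq, iteratedDeriv_fun_neg,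
      iteratedDeriv_raise fun l => contDiffAt_hurwitz l hw _]
    simp only [ih, raise_mul]
    rw [Nat.factorial_succ]
    push_cast
    linear_combination (-(a.factorial : ℂ)) * taylorSum_succ (fun l => hurwitz l w) a k

/-! ### Comparison with the regularized multiple zeta values -/

/-- `f` agrees with the polynomial `P` in `log N + γ`, up to a negligible error. -/
def ExpandsTo (f : ℕ → ℝ) (P : Polynomial ℝ) : Prop :=
  Negligible fun N => f N - P.eval (logGamma N)

section ExpandsTo

variable {f g : ℕ → ℝ} {P Q : Polynomial ℝ}

theorem ExpandsTo.add (hf : ExpandsTo f P) (hg : ExpandsTo g Q) :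
    ExpandsTo (fun N => f N + g N) (P + Q) := by
  have h := Negligible.add hf hg
  unfold ExpandsTo
  convert h using 2 with N
  rw [Polynomial.eval_add]
  ring

theorem ExpandsTo.mul (hf : ExpandsTo f P) (hg : ExpandsTo g Q) :
    ExpandsTo (fun N => f N * g N) (P * Q) := by
  have h := ((Negligible.mul_eval hf Q).add (Negligible.mul_eval hg P)).add (Negligible.mul hf hg)
  unfold ExpandsTo
  convert h using 2 with N
  rw [Polynomial.eval_mul]
  ring

theorem expandsTo_const (c : ℝ) : ExpandsTo (fun _ => c) (Polynomial.C c) := fun j => by simp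

theorem ExpandsTo.const_mul (c : ℝ) (hf : ExpandsTo f P) :
    ExpandsTo (fun N => c * f N) (Polynomial.C c * P) :=
  (expandsTo_const c).mul hf

theorem ExpandsTo.finset_sum {ι : Type*} (s : Finset ι) {F : ι → ℕ → ℝ}
    {p : ι → Polynomial ℝ} (h : ∀ i ∈ s, ExpandsTo (F i) (p i)) :
    ExpandsTo (fun N => ∑ i ∈ s, F i N) (∑ i ∈ s, p i) := by
  classical
  induction s using Finset.induction_on with
  | empty => simpa using expandsTo_const 0
  | insert a s ha ih =>
    simp only [Finset.sum_insert ha]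
    exact (h a (by simp)).add (ih fun i hi => h i (by simp [hi]))

theorem ExpandsTo.list_sum (l : List (List ℕ+)) {F : List ℕ+ → ℕ → ℝ}
    {p : List ℕ+ → Polynomial ℝ} (h : ∀ v, ExpandsTo (F v) (p v)) :
    ExpandsTo (fun N => (l.map fun v => F v N).sum) (l.map p).sum := by
  induction l with
  | nil => simpa using expandsTo_const 0
  | cons v l ih =>
    simp only [List.map_cons, List.sum_cons]
    exact (h v).add ih

theorem ExpandsTo.unique (hP : ExpandsTo f P) (hQ : ExpandsTo f Q) : P = Q := by
  refine sub_eq_zero.1 (eq_zero_of_tendsto ?_)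
  have h := (hQ 0).sub (hP 0)
  rw [sub_zero] at h
  refine h.congr fun N => ?_
  rw [Polynomial.eval_sub]
  ring

end ExpandsTo

theorem expandsTo_truncSum (k : List ℕ+) : ExpandsTo (fun N => truncSum N 0 k) (regPoly k) := by
  obtain ⟨P, hP⟩ := hasExpansion_truncSum k
  have h : IsRegPoly k P := by simpa [IsRegPoly, logGamma] using hP 0
  rwa [h.eq_regPoly] at hP

theorem truncSum_append_conv (N : ℕ) : (fun k => (truncSum (N + 1) 0 k : ℂ)) =
    conv (fun k => (truncSum N 0 k : ℂ)) (point (N + 1)) := by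
  funext k
  induction k using List.reverseRecOn with
  | nil => simp [truncSum, conv_nil, point, letterFun]
  | append_singleton k x _ =>
    rw [point, conv_letterFun_append, truncSum_succ N x k 0 (Nat.zero_le N)]
    push_cast
    ring

theorem natCast_add_one_mem_rightHalf (N : ℕ) : (N : ℂ) + 1 ∈ rightHalf := by
  change 0 < ((N : ℂ) + 1).re
  simp
  positivity

/-- Cutting the range of summation at `N` gives a value independent of `N`: the recursion of the
Hurwitz functions hands the integer `N + 1` over to the truncated sums. -/
theorem conv_truncSum_hurwitz (N : ℕ) :
    conv (fun k => (truncSum N 0 k : ℂ)) (fun k => hurwitz k (N + 1)) =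
      fun k => hurwitz k 1 := by
  induction N with
  | zero =>
    have h : (fun k => (truncSum 0 0 k : ℂ)) = convUnit := by
      funext k
      cases k <;> simp [truncSum, convUnit]
    rw [h, conv_unit_left]
    simp
  | succ N ih =>
    rw [truncSum_append_conv, conv_assoc, ← ih, hurwitz_eq_conv (natCast_add_one_mem_rightHalf N)]
    push_cast
    rfl

theorem expandsTo_neg_log :
    ExpandsTo (fun N => -(Real.log (N + 1) + Real.eulerMascheroniConstant)) (-Polynomial.X) := by
  refine negligible_of_le 1 ?_
  filter_upwards [eventually_ge_atTop 1] with N hN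
  have hN' : (1 : ℝ) ≤ N := by exact_mod_cast hN
  have h3 : Real.log ((N : ℝ) + 1) - Real.log N ≤ 1 / N := by
    rw [← Real.log_div (by positivity) (by positivity)]
    have := Real.log_le_sub_one_of_pos (x := ((N : ℝ) + 1) / N) (by positivity)
    have h4 : ((N : ℝ) + 1) / N - 1 = 1 / N := by field_simp; ring
    linarith
  have h5 : 1 / (N : ℝ) ≤ (N : ℝ) ^ (-(1 / 2) : ℝ) := by
    rw [one_div, ← Real.rpow_neg_one]
    exact Real.rpow_le_rpow_of_exponent_le hN' (by norm_num)
  have h6 : Real.log (N : ℝ) ≤ Real.log ((N : ℝ) + 1) :=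
    Real.log_le_log (by linarith) (by linarith)
  rw [Polynomial.eval_neg, Polynomial.eval_X, logGamma, abs_le]
  constructor <;> linarith

/-- The polynomial that describes `hurwitzLead k (N + 1)`. -/
noncomputable def leadPoly (k : List ℕ+) : Polynomial ℝ :=
  if k = List.replicate k.length 1 then
    Polynomial.C (k.length.factorial : ℝ)⁻¹ * (-Polynomial.X) ^ k.length else 0

theorem hurwitzLead_natCast (k : List ℕ+) (N : ℕ) : hurwitzLead k (N + 1) =
    ((if k = List.replicate k.length 1 then (k.length.factorial : ℝ)⁻¹ *
      (-(Real.log (N + 1) + Real.eulerMascheroniConstant)) ^ k.length else 0 : ℝ) : ℂ) := by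
  have h : Complex.log ((N : ℂ) + 1) = ((Real.log ((N : ℝ) + 1) : ℝ) : ℂ) := by
    rw [Complex.ofReal_log (by positivity)]
    push_cast
    rfl
  rw [hurwitzLead, negLogGamma, h]
  split_ifs
  · push_cast
    ring
  · simp

theorem ExpandsTo.pow {f : ℕ → ℝ} {P : Polynomial ℝ} (hf : ExpandsTo f P) (n : ℕ) :
    ExpandsTo (fun N => f N ^ n) (P ^ n) := by
  induction n with
  | zero => simpa using expandsTo_const 1
  | succ n ih => simpa [pow_succ] using ih.mul hf

/-- Taking `ε = 1 / 2` in the growth class leaves a bound by `N ^ (-1 / 2)`, which beats every power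
of `log N + γ`. -/
theorem negligible_of_grows {g : ℂ → ℂ} (hg : Grows (-1) g) {f : ℕ → ℝ}
    (hf : ∀ N, |f N| ≤ ‖g (N + 1)‖) : Negligible f := by
  obtain ⟨C, hC⟩ := hg (1 / 2) (by norm_num)
  refine negligible_of_le C ?_
  filter_upwards [eventually_ge_atTop 1] with N hN
  have hN' : (1 : ℝ) ≤ N := by exact_mod_cast hN
  have hmem : (N : ℂ) + 1 ∈ halfPlane := by
    change 1 / 2 ≤ ((N : ℂ) + 1).re
    simp
    linarith
  have hC0 : 0 ≤ C := by
    have h := (norm_nonneg _).trans (hC 1 (by norm_num [halfPlane]))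
    simpa using h
  have hnorm : ‖(N : ℂ) + 1‖ = (N : ℝ) + 1 := by
    have h := Complex.norm_natCast (N + 1)
    push_cast at h
    exact h
  refine (hf N).trans ((hC _ hmem).trans (mul_le_mul_of_nonneg_left ?_ hC0))
  beta_reduce
  rw [hnorm]
  norm_num
  exact Real.rpow_le_rpow_of_nonpos (by linarith) (by linarith) (by norm_num)

theorem expandsTo_re_hurwitz (k : List ℕ+) :
    ExpandsTo (fun N => (hurwitz k (N + 1)).re) (leadPoly k) := by
  have h1 : ExpandsTo (fun N => (hurwitzLead k (N + 1)).re) (leadPoly k) := by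
    simp only [hurwitzLead_natCast, Complex.ofReal_re, leadPoly]
    split_ifs
    · exact (expandsTo_neg_log.pow _).const_mul _
    · simpa using expandsTo_const 0
  have h2 : ExpandsTo (fun N => (hurwitz k (N + 1) - hurwitzLead k (N + 1)).re) 0 := by
    have := negligible_of_grows (grows_hurwitz_sub_lead k) fun N => Complex.abs_re_le_norm _
    simpa [ExpandsTo] using this
  simpa using h1.add h2

theorem expandsTo_im_hurwitz (k : List ℕ+) :
    ExpandsTo (fun N => (hurwitz k (N + 1)).im) 0 := by
  have := negligible_of_grows (grows_hurwitz_sub_lead k) fun N => Complex.abs_im_le_norm _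
  simpa [ExpandsTo, hurwitzLead_natCast] using this

/-- In the cut at `N`, both factors expand in powers of `T = log N + γ`, while the total does not
depend on `N`. By uniqueness of expansions `T = 0` may be substituted. The Hurwitz factor then
contributes `0` unless its word is empty, because the leading term is a pure power of `-T`. This is
why the Hurwitz functions are regularized with `log w + γ`. -/
theorem hurwitz_one (k : List ℕ+) : hurwitz k 1 = (zetaReg k : ℂ) := by
  have hsum : ∀ N : ℕ, hurwitz k 1 = ∑ i ∈ Finset.range (k.length + 1),
      (truncSum N 0 (k.take i) : ℂ) * hurwitz (k.drop i) (N + 1) := fun N => by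
    rw [← conv_eq_sum (fun k => (truncSum N 0 k : ℂ)) (fun k => hurwitz k (N + 1)),
      conv_truncSum_hurwitz]
  apply Complex.ext
  · have h1 := ExpandsTo.finset_sum (Finset.range (k.length + 1)) fun i _ =>
      (expandsTo_truncSum (k.take i)).mul (expandsTo_re_hurwitz (k.drop i))
    have h2 : (fun N : ℕ => ∑ i ∈ Finset.range (k.length + 1),
        truncSum N 0 (k.take i) * (hurwitz (k.drop i) (N + 1)).re) =
        fun _ => (hurwitz k 1).re := by
      funext N
      rw [hsum N, Complex.re_sum]
      simp
    rw [h2] at h1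
    have h3 := congrArg (Polynomial.eval 0) ((expandsTo_const _).unique h1)
    rw [Polynomial.eval_C, Polynomial.eval_finsetSum, Finset.sum_range_succ,
      Finset.sum_eq_zero] at h3
    · rw [h3]
      simp [leadPoly, zetaReg]
    · intro i hi
      have hi' : k.length - i ≠ 0 := by
        have := Finset.mem_range.1 hi
        omega
      rw [Polynomial.eval_mul, leadPoly]
      split_ifs <;> simp [hi']
  · have h1 := ExpandsTo.finset_sum (Finset.range (k.length + 1)) fun i _ =>
      (expandsTo_truncSum (k.take i)).mul (expandsTo_im_hurwitz (k.drop i))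
    have h2 : (fun N : ℕ => ∑ i ∈ Finset.range (k.length + 1),
        truncSum N 0 (k.take i) * (hurwitz (k.drop i) (N + 1)).im) =
        fun _ => (hurwitz k 1).im := by
      funext N
      rw [hsum N, Complex.im_sum]
      simp
    rw [h2] at h1
    have h3 := congrArg (Polynomial.eval 0) ((expandsTo_const _).unique h1)
    simpa using h3

theorem taylorSum_ofReal (F : List ℕ+ → ℝ) (a : ℕ) (k : List ℕ+) :
    taylorSum (fun l => (F l : ℂ)) a k = ((taylorSum F a k : ℝ) : ℂ) := by
  rw [taylorSum_eq, taylorSum_eq]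
  push_cast
  rfl

theorem iteratedDeriv_hurwitz_one (a : ℕ) (k : List ℕ+) :
    iteratedDeriv a (hurwitz k) 1 / (a.factorial : ℂ) = (zetaTaylor a k : ℂ) := by
  have ha : (a.factorial : ℂ) ≠ 0 := by exact_mod_cast a.factorial_ne_zero
  rw [iteratedDeriv_hurwitz a k (by simp [rightHalf]), mul_div_cancel_left₀ _ ha, zetaTaylor_eq,
    ← taylorSum_ofReal]
  simp only [hurwitz_one]

/-! ### The antipode relation between star values and ordinary values -/

theorem truncSum_self_eq (N : ℕ) : truncSum N N = convUnit := by
  funext k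
  cases k with
  | nil => rfl
  | cons x k => exact truncSum_self N x k

theorem truncSum_cons_eq {N a : ℕ} (ha : a < N) (x : ℕ+) (k : List ℕ+) :
    truncSum N a (x :: k) =
      truncSum N (a + 1) (x :: k) + (((a : ℝ) + 1) ^ (x : ℕ))⁻¹ * truncSum N (a + 1) k := by
  rw [truncSum, truncSum, ← Finset.insert_Ioc_add_one_left_eq_Ioc ha, Finset.sum_insert (by simp)]
  push_cast
  ring

/-- Truncated star sums with lower bound `a`. -/
noncomputable def truncStar (N a : ℕ) (k : List ℕ+) : ℝ := ((mergings k).map (truncSum N a)).sum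

theorem mergingsFrom_ne_nil (x : ℕ+) (k : List ℕ+) : ∀ v ∈ mergingsFrom x k, v ≠ [] := by
  induction k generalizing x with
  | nil => simp [mergingsFrom]
  | cons y k ih =>
    intro v hv
    rw [mergingsFrom, List.mem_append, List.mem_map] at hv
    rcases hv with ⟨w, -, rfl⟩ | hv
    · simp
    · exact ih _ v hv

theorem truncStar_self (N : ℕ) : truncStar N N = convUnit := by
  funext k
  cases k with
  | nil => simp [truncStar, mergings, truncSum, convUnit]
  | cons x k =>
    rw [truncStar, mergings, truncSum_self_eq, convUnit]
    refine List.sum_eq_zero fun r hr => ?_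
    obtain ⟨v, hv, rfl⟩ := List.mem_map.1 hr
    obtain ⟨y, l, rfl⟩ := List.exists_cons_of_ne_nil (mergingsFrom_ne_nil x k v hv)
    rfl

/-- Star sums run over weakly increasing indices: after the value `a + 1` is used for the first
letter, it stays available for the others. So the last factor keeps the lower bound `a`, in contrast
to `truncSum_cons_eq`. -/
theorem truncStar_cons_eq {N a : ℕ} (ha : a < N) (x : ℕ+) (k : List ℕ+) :
    truncStar N a (x :: k) =
      truncStar N (a + 1) (x :: k) + (((a : ℝ) + 1) ^ (x : ℕ))⁻¹ * truncStar N a k := by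
  simp only [truncStar]
  induction k generalizing x with
  | nil =>
    have h := truncSum_cons_eq ha x []
    simpa [mergings, mergingsFrom, truncSum] using h
  | cons y k ih =>
    have h1 : ∀ b, ((mergings (x :: y :: k)).map (truncSum N b)).sum =
        ((mergings (y :: k)).map fun v => truncSum N b (x :: v)).sum +
          ((mergings ((x + y) :: k)).map (truncSum N b)).sum := fun b => by
      simp [mergings, mergingsFrom, Function.comp_def]
    have h2 : ((mergings (y :: k)).map fun v => truncSum N a (x :: v)).sum =
        ((mergings (y :: k)).map fun v => truncSum N (a + 1) (x :: v)).sum +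
          (((a : ℝ) + 1) ^ (x : ℕ))⁻¹ * ((mergings (y :: k)).map (truncSum N (a + 1))).sum := by
      simp only [truncSum_cons_eq ha, List.sum_map_add, List.sum_map_mul_left]
    rw [h1, h1, h2, ih, ih y, PNat.add_coe, pow_add, mul_inv]
    ring

/-- The sign `(-1) ^ d` of a word of length `d`. -/
def lengthSign {R : Type*} [CommRing R] (k : List ℕ+) : R := (-1) ^ k.length

/-- Lowering the bound from `a + 1` to `a` multiplies the signed star sums on the left by `e⁻¹` and
the reversed ordinary sums on the right by `e`, where `e` is the letter function of the integer `a +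
1`. If the product was the unit, it stays the unit. -/
theorem conv_truncStar_reverse {N a : ℕ} (ha : a ≤ N) :
    conv (fun l => lengthSign l * truncStar N a l) (fun l => truncSum N a l.reverse) =
      convUnit := by
  induction ha using Nat.decreasingInduction with
  | self =>
    rw [truncStar_self, truncSum_self_eq]
    have h1 : (fun l : List ℕ+ => lengthSign l * convUnit l) = (convUnit : List ℕ+ → ℝ) := by
      funext l
      cases l <;> simp [convUnit, lengthSign]
    have h2 : (fun l : List ℕ+ => (convUnit l.reverse : ℝ)) = convUnit := by
      funext l
      induction l using List.reverseRecOn with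
      | nil => rfl
      | append_singleton l x _ => cases l <;> simp [convUnit]
    rw [h1, h2, conv_unit_left]
  | of_succ a ha ih =>
    set e : List ℕ+ → ℝ := letterFun fun x => (((a : ℝ) + 1) ^ (x : ℕ))⁻¹ with he
    set s : ℕ → List ℕ+ → ℝ := fun a l => lengthSign l * truncStar N a l with hs
    set t : ℕ → List ℕ+ → ℝ := fun a l => truncSum N a l.reverse with ht
    have h1 : conv e (s a) = s (a + 1) := by
      funext k
      cases k with
      | nil => simp [he, conv_letterFun_nil, hs, lengthSign, truncStar, mergings, truncSum]
      | cons x k =>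
        rw [he, conv_letterFun_cons]
        simp only [hs, lengthSign, List.length_cons, truncStar_cons_eq ha]
        ring
    have h2 : conv (t (a + 1)) e = t a := by
      funext k
      induction k using List.reverseRecOn with
      | nil => simp [he, conv_nil, ht, truncSum, letterFun]
      | append_singleton k x _ =>
        rw [he, conv_letterFun_append]
        simp only [ht, List.reverse_append, List.reverse_singleton, List.singleton_append]
        rw [truncSum_cons_eq ha]
    have ih' : conv (s (a + 1)) (t (a + 1)) = convUnit := ih
    -- the letter function is invertible
    set e' : List ℕ+ → ℝ := fun l => lengthSign l *
      (l.map fun x : ℕ+ => (((a : ℝ) + 1) ^ (x : ℕ))⁻¹).prod with he'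
    have h3 : conv e' e = convUnit := by
      funext k
      induction k using List.reverseRecOn with
      | nil => simp [he, he', conv_nil, lengthSign, letterFun, convUnit]
      | append_singleton k x _ =>
        rw [he, conv_letterFun_append]
        have : (convUnit (k ++ [x]) : ℝ) = 0 := by cases k <;> rfl
        rw [this]
        simp only [he', lengthSign, List.length_append, List.length_singleton, List.map_append,
          List.prod_append, List.map_singleton, List.prod_singleton]
        ring
    have h4 : s a = conv e' (s (a + 1)) := by
      rw [← h1, ← conv_assoc, h3, conv_unit_left]
    change conv (s a) (t a) = convUnit
    rw [h4, ← h2, conv_assoc, ← conv_assoc (s (a + 1)), ih', conv_unit_left, h3]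

theorem conv_zetaStar_reverse :
    conv (fun l => lengthSign l * zetaStarReg l) (fun l => zetaReg l.reverse) = convUnit := by
  funext k
  have h1 : ExpandsTo (fun _ => convUnit k) (∑ i ∈ Finset.range (k.length + 1),
      Polynomial.C (lengthSign (k.take i)) * ((mergings (k.take i)).map regPoly).sum *
        regPoly (k.drop i).reverse) := by
    have h2 := ExpandsTo.finset_sum (Finset.range (k.length + 1)) fun i _ =>
      ((ExpandsTo.list_sum (mergings (k.take i)) expandsTo_truncSum).const_mul
        (lengthSign (k.take i))).mul (expandsTo_truncSum (k.drop i).reverse)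
    convert h2 using 2 with N
    rw [← conv_truncStar_reverse (Nat.zero_le N), conv_eq_sum]
    rfl
  have h3 := congrArg (Polynomial.eval 0) ((expandsTo_const _).unique h1)
  have h4 : ∀ l : List (List ℕ+), ((l.map regPoly).sum).eval 0 = (l.map zetaReg).sum := by
    intro l
    induction l with
    | nil => simp
    | cons v l ih => simp [ih, zetaReg]
  rw [Polynomial.eval_C, Polynomial.eval_finsetSum] at h3
  rw [h3, conv_eq_sum]
  refine Finset.sum_congr rfl fun i _ => ?_
  rw [Polynomial.eval_mul, Polynomial.eval_mul, Polynomial.eval_C, h4]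
  rfl

/-! ### Multitangent functions -/

/-- The sign `(-1) ^ (k₁ + ⋯ + k_d)`. -/
def weightSign {R : Type*} [CommRing R] (k : List ℕ+) : R := (-1) ^ weight k

theorem weight_nil : weight [] = 0 := by simp [weight]

theorem weight_cons (x : ℕ+) (k : List ℕ+) : weight (x :: k) = x + weight k := by
  simp [weight]

theorem weight_append (k l : List ℕ+) : weight (k ++ l) = weight k + weight l := by
  simp [weight]

theorem weightSign_append {R : Type*} [CommRing R] (k l : List ℕ+) :
    (weightSign (k ++ l) : R) = weightSign k * weightSign l := by
  rw [weightSign, weight_append, pow_add]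
  rfl

/-- The contribution of the positive integers to a multitangent function. -/
noncomputable def posPart (z : ℂ) (k : List ℕ+) : ℂ := hurwitz k (1 + z)

/-- The contribution of the negative integers to a multitangent function. -/
noncomputable def negPart (z : ℂ) (k : List ℕ+) : ℂ :=
  weightSign k * hurwitz k.reverse (1 - z)

/-- The multitangent function, without the summands that involve the integer `0`. -/
noncomputable def multitangentAway (k : List ℕ+) (z : ℂ) : ℂ := conv (negPart z) (posPart z) k

/-- The regularized multitangent function
`∑_{n₁ < ⋯ < n_d} 1 / ((z + n₁) ^ k₁ ⋯ (z + n_d) ^ k_d)`. -/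
noncomputable def multitangent (k : List ℕ+) (z : ℂ) : ℂ :=
  conv (negPart z) (conv (point z) (posPart z)) k

/-- The strip `-1 < Re z < 1`. -/
def openStrip : Set ℂ := {z | -1 < z.re ∧ z.re < 1}

/-- The strip `-1/2 ≤ Re z ≤ 1/2`. -/
def closedStrip : Set ℂ := {z | |z.re| ≤ 1 / 2}

theorem closedStrip_subset : closedStrip ⊆ openStrip := fun z hz => by
  have h := abs_le.1 (show |z.re| ≤ 1 / 2 from hz)
  constructor <;> linarith

theorem isOpen_openStrip : IsOpen openStrip :=
  (isOpen_lt continuous_const Complex.continuous_re).inter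
    (isOpen_lt Complex.continuous_re continuous_const)

theorem zero_mem_openStrip : (0 : ℂ) ∈ openStrip := by simp [openStrip]

theorem one_add_mem_rightHalf {z : ℂ} (hz : z ∈ openStrip) : 1 + z ∈ rightHalf := by
  change 0 < (1 + z).re
  simp only [Complex.add_re, Complex.one_re]
  linarith [hz.1]

theorem one_sub_mem_rightHalf {z : ℂ} (hz : z ∈ openStrip) : 1 - z ∈ rightHalf := by
  change 0 < (1 - z).re
  simp only [Complex.sub_re, Complex.one_re]
  linarith [hz.2]

theorem differentiableOn_posPart (k : List ℕ+) :
    DifferentiableOn ℂ (fun z => posPart z k) openStrip :=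
  (differentiableOn_hurwitz k).comp (by fun_prop) fun _ hz => one_add_mem_rightHalf hz

theorem differentiableOn_negPart (k : List ℕ+) :
    DifferentiableOn ℂ (fun z => negPart z k) openStrip :=
  ((differentiableOn_hurwitz k.reverse).comp (by fun_prop)
    fun _ hz => one_sub_mem_rightHalf hz).const_mul _

theorem differentiableOn_multitangentAway (k : List ℕ+) :
    DifferentiableOn ℂ (multitangentAway k) openStrip := by
  have h : multitangentAway k = fun z => ∑ i ∈ Finset.range (k.length + 1),
      negPart z (k.take i) * posPart z (k.drop i) := by
    funext z
    rw [multitangentAway, conv_eq_sum]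
  rw [h]
  exact DifferentiableOn.fun_sum fun i _ =>
    (differentiableOn_negPart _).mul (differentiableOn_posPart _)

theorem multitangent_eq (k : List ℕ+) (z : ℂ) : multitangent k z = multitangentAway k z +
    ∑ j : Fin k.length, (z ^ (k.get j : ℕ))⁻¹ *
      (negPart z (k.take j) * posPart z (k.drop (j + 1))) := by
  rw [multitangent, point, conv_letterFun_middle, multitangentAway]
  congr 1
  exact Finset.sum_congr rfl fun j _ => by ring

theorem multitangent_singleton (x : ℕ+) (z : ℂ) :
    multitangent [x] z = multitangentAway [x] z + (z ^ (x : ℕ))⁻¹ := by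
  rw [multitangent_eq]
  simp [negPart, posPart, hurwitz, weightSign, weight]

/-- Under the shift one integer changes sides: `posPart z` releases the factor `point (z + 1)` on
its left, and `negPart (z + 1)` releases `point z` on its right. Associativity of the convolution
identifies the two products. The strip is chosen so that `z` and `z + 1` both lie in `openStrip`. -/
theorem multitangent_add_one (k : List ℕ+) {z : ℂ} (h1 : -1 < z.re) (h2 : z.re < 0) :
    multitangent k (z + 1) = multitangent k z := by
  have hz : z ≠ 0 := by
    rintro rfl
    simp at h2
  have hpos : posPart z = conv (point (z + 1)) (posPart (z + 1)) := by
    have h : 1 + z ∈ rightHalf := one_add_mem_rightHalf ⟨h1, by linarith⟩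
    have h' := hurwitz_eq_conv h
    rw [add_comm 1 z] at h'
    convert h' using 1
    · funext k
      rw [posPart, add_comm]
    · congr 1
      funext k
      rw [posPart, add_comm]
  have hneg : negPart (z + 1) = conv (negPart z) (point z) := by
    funext k
    induction k using List.reverseRecOn with
    | nil => simp [negPart, conv_nil, hurwitz, point, letterFun, weightSign, weight]
    | append_singleton k x _ =>
      have hmem : -z ∈ rightHalf := by
        change 0 < (-z).re
        simpa using h2
      have h3 : (1 : ℂ) - (z + 1) = -z := by ring
      have h4 : -z + 1 = 1 - z := by ring
      -- The Hurwitz recursion at `-z` yields a power of `-z`; the weight sign in `negPart` turns it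
      -- into a power of `z`.
      have h5 : (weightSign [x] : ℂ) * ((-z) ^ (x : ℕ))⁻¹ = (z ^ (x : ℕ))⁻¹ := by
        rw [neg_pow, mul_inv]
        rw [weightSign, weight_cons, weight_nil, add_zero, ← mul_assoc, mul_inv_cancel₀ (pow_ne_zero _ (by norm_num)), one_mul]
      rw [point, conv_letterFun_append, ← h5, negPart, negPart, negPart, weightSign_append, h3,
        List.reverse_append, List.reverse_singleton, List.singleton_append,
        hurwitz_cons_eq x _ hmem, h4]
      ring
  rw [multitangent, multitangent, hpos, hneg, conv_assoc]

/-! ### Behaviour on the closed strip -/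

/-- The size function on the closed strip. -/
noncomputable def stripSize (z : ℂ) : ℝ := ‖1 + z‖

theorem one_add_mem_halfPlane {z : ℂ} (hz : z ∈ closedStrip) : 1 + z ∈ halfPlane := by
  have h := abs_le.1 (show |z.re| ≤ 1 / 2 from hz)
  change 1 / 2 ≤ (1 + z).re
  simp only [Complex.add_re, Complex.one_re]
  linarith

theorem one_sub_mem_halfPlane {z : ℂ} (hz : z ∈ closedStrip) : 1 - z ∈ halfPlane := by
  have h := abs_le.1 (show |z.re| ≤ 1 / 2 from hz)
  change 1 / 2 ≤ (1 - z).re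
  simp only [Complex.sub_re, Complex.one_re]
  linarith

theorem half_le_stripSize : ∀ z ∈ closedStrip, 1 / 2 ≤ stripSize z := fun _ hz =>
  half_le_norm _ (one_add_mem_halfPlane hz)

/-- The extreme case is the real point `z = -1 / 2`, where the two norms are `3 / 2` and `1 / 2`. -/
theorem norm_one_sub_le {z : ℂ} (hz : z ∈ closedStrip) : ‖1 - z‖ ≤ 3 * ‖1 + z‖ := by
  have h := abs_le.1 (show |z.re| ≤ 1 / 2 from hz)
  rw [← sq_le_sq₀ (norm_nonneg _) (by positivity), mul_pow, ← Complex.normSq_eq_norm_sq,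
    ← Complex.normSq_eq_norm_sq, Complex.normSq_apply, Complex.normSq_apply]
  simp only [Complex.add_re, Complex.one_re, Complex.add_im, Complex.one_im, Complex.sub_re,
    Complex.sub_im, zero_add, zero_sub]
  nlinarith [mul_self_nonneg z.im]

theorem neg_mem_closedStrip {z : ℂ} (hz : z ∈ closedStrip) : -z ∈ closedStrip := by
  change |(-z).re| ≤ 1 / 2
  rw [Complex.neg_re, abs_neg]
  exact hz

theorem norm_one_add_le {z : ℂ} (hz : z ∈ closedStrip) : ‖1 + z‖ ≤ 3 * ‖1 - z‖ := by
  have h := norm_one_sub_le (neg_mem_closedStrip hz)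
  rwa [sub_neg_eq_add, ← sub_eq_add_neg] at h

theorem Grows.one_add {r : ℝ} {g : ℂ → ℂ} (hg : Grows r g) :
    GrowsLike closedStrip stripSize r (fun z => g (1 + z)) := fun ε hε => by
  obtain ⟨C, hC⟩ := hg ε hε
  exact ⟨C, fun z hz => hC _ (one_add_mem_halfPlane hz)⟩

theorem Grows.one_sub {r : ℝ} {g : ℂ → ℂ} (hg : Grows r g) :
    GrowsLike closedStrip stripSize r (fun z => g (1 - z)) :=
  GrowsLike.comp (c := 3) (by norm_num) hg (fun z => 1 - z) (fun _ hz => one_sub_mem_halfPlane hz)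
    (fun _ hz => by linarith [half_le_norm _ (one_sub_mem_halfPlane hz)])
    (fun _ hz => by linarith [half_le_stripSize _ hz])
    (fun _ hz => norm_one_sub_le hz) (fun _ hz => norm_one_add_le hz)

/-! ### Leading terms on the strip, boundedness and limits at `±i∞` -/

/-- The leading term of `posPart`. -/
noncomputable def posLead (z : ℂ) (k : List ℕ+) : ℂ := hurwitzLead k (1 + z)

/-- The leading term of `negPart`. -/
noncomputable def negLead (z : ℂ) (k : List ℕ+) : ℂ :=
  weightSign k * hurwitzLead k.reverse (1 - z)

/-- The leading term of a multitangent function. -/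
noncomputable def tangentLead (k : List ℕ+) (z : ℂ) : ℂ :=
  if k = List.replicate k.length 1 then
    (Complex.log (1 - z) - Complex.log (1 + z)) ^ k.length / (k.length.factorial : ℂ) else 0

theorem weight_of_eq_replicate {k : List ℕ+} (h : k = List.replicate k.length 1) :
    weight k = k.length := by
  have h1 : ∀ n, weight (List.replicate n 1) = n := fun n => by
    induction n with
    | zero => simp [weight_nil]
    | succ n ih => rw [List.replicate_succ, weight_cons, ih, PNat.one_coe, add_comm]
  conv_lhs => rw [h]
  exact h1 _

/-- On all-ones words both leading terms are divided powers, so the binomial theorem applies. The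
weight sign reverses the sign of the logarithm at `1 - z`, and Euler's constant cancels. -/
theorem conv_lead (k : List ℕ+) (z : ℂ) : conv (negLead z) (posLead z) k = tangentLead k z := by
  rw [tangentLead]
  by_cases h : k = List.replicate k.length 1
  · have h1 : Complex.log (1 - z) - Complex.log (1 + z) =
        -negLogGamma (1 - z) + negLogGamma (1 + z) := by
      simp only [negLogGamma]
      ring
    rw [if_pos h, h1, ← conv_pow_div_factorial, conv_eq_sum, conv_eq_sum]
    refine Finset.sum_congr rfl fun i _ => ?_
    have h2 := h
    rw [← List.take_append_drop i k, append_eq_replicate_one] at h2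
    rw [negLead, posLead, hurwitzLead, hurwitzLead, if_pos h2.2,
      if_pos (reverse_eq_replicate_one.2 h2.1), List.length_reverse, weightSign,
      weight_of_eq_replicate h2.1, neg_pow]
    ring
  · rw [if_neg h, conv_eq_sum]
    refine Finset.sum_eq_zero fun i _ => ?_
    rw [← List.take_append_drop i k, append_eq_replicate_one, not_and_or] at h
    rw [negLead, posLead]
    rcases h with h | h
    · rw [hurwitzLead_eq_zero (fun h' => h (reverse_eq_replicate_one.1 h')), mul_zero, zero_mul]
    · rw [hurwitzLead_eq_zero h, mul_zero]

theorem growsLike_multitangentAway_sub_lead (k : List ℕ+) :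
    GrowsLike closedStrip stripSize (-1) (fun z => multitangentAway k z - tangentLead k z) := by
  have h1 := GrowsLike.finset_sum (S := closedStrip) (ρ := stripSize) (r := -1)
    (Finset.range (k.length + 1)) (F := fun i z =>
      (negPart z (k.take i) - negLead z (k.take i)) * posPart z (k.drop i) +
        negLead z (k.take i) * (posPart z (k.drop i) - posLead z (k.drop i))) fun i _ => ?_
  · refine h1.congr fun z _ => ?_
    rw [← conv_lead, multitangentAway, conv_eq_sum, conv_eq_sum, ← Finset.sum_sub_distrib]
    exact Finset.sum_congr rfl fun i _ => by ring
  · have h2 := (((grows_hurwitz_sub_lead (k.take i).reverse).one_sub.const_mul half_le_stripSize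
      (weightSign (k.take i))).mul half_le_stripSize (grows_hurwitz (k.drop i)).one_add)
    have h3 := (((grows_hurwitzLead (k.take i).reverse).one_sub.const_mul half_le_stripSize
      (weightSign (k.take i))).mul half_le_stripSize (grows_hurwitz_sub_lead (k.drop i)).one_add)
    rw [add_zero] at h2
    rw [zero_add] at h3
    refine (h2.add h3).congr fun z _ => ?_
    simp only [negPart, negLead, posPart, posLead]
    ring

theorem norm_log_sub_log_le {z : ℂ} (hz : z ∈ closedStrip) :
    ‖Complex.log (1 - z) - Complex.log (1 + z)‖ ≤ Real.log 3 + 2 * Real.pi := by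
  have h1 := half_le_norm _ (one_add_mem_halfPlane hz)
  have h2 := half_le_norm _ (one_sub_mem_halfPlane hz)
  have h3 := Complex.norm_le_abs_re_add_abs_im (Complex.log (1 - z) - Complex.log (1 + z))
  rw [Complex.sub_re, Complex.sub_im, Complex.log_re, Complex.log_re, Complex.log_im,
    Complex.log_im] at h3
  have h4 := abs_le.1 (Complex.abs_arg_le_pi (1 - z))
  have h5 := abs_le.1 (Complex.abs_arg_le_pi (1 + z))
  have h6 : |Complex.arg (1 - z) - Complex.arg (1 + z)| ≤ 2 * Real.pi := by
    rw [abs_le]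
    constructor <;> linarith [h4.1, h4.2, h5.1, h5.2]
  have h7 : |Real.log ‖1 - z‖ - Real.log ‖1 + z‖| ≤ Real.log 3 := by
    have h8 := Real.log_le_log (by linarith) (norm_one_sub_le hz)
    have h9 := Real.log_le_log (by linarith) (norm_one_add_le hz)
    rw [Real.log_mul (by norm_num) (by linarith)] at h8 h9
    rw [abs_le]
    constructor <;> linarith
  linarith

/-- The two sides may each grow logarithmically, but their combined leading term involves only a
difference of logarithms, which is bounded on the strip. -/
theorem bounded_multitangentAway (k : List ℕ+) :
    ∃ C, ∀ z ∈ closedStrip, ‖multitangentAway k z‖ ≤ C := by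
  obtain ⟨C, hC⟩ := (growsLike_multitangentAway_sub_lead k).bounded (by norm_num)
  refine ⟨C + (Real.log 3 + 2 * Real.pi) ^ k.length, fun z hz => ?_⟩
  have h1 : ‖tangentLead k z‖ ≤ (Real.log 3 + 2 * Real.pi) ^ k.length := by
    have h0 : 0 ≤ Real.log 3 + 2 * Real.pi := (norm_nonneg _).trans (norm_log_sub_log_le hz)
    rw [tangentLead]
    split_ifs
    · rw [norm_div, norm_pow, Complex.norm_natCast]
      refine (div_le_self (by positivity) ?_).trans
        (pow_le_pow_left₀ (norm_nonneg _) (norm_log_sub_log_le hz) _)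
      exact_mod_cast Nat.one_le_iff_ne_zero.2 (Nat.factorial_ne_zero _)
    · rw [norm_zero]
      positivity
  have h2 := norm_add_le (multitangentAway k z - tangentLead k z) (tangentLead k z)
  rw [sub_add_cancel] at h2
  linarith [hC z hz]

/-- The two arguments are complex conjugates, so the difference is `-2i arg (1 + iy)`, and the
argument tends to `π / 2`. -/
theorem tendsto_log_sub_log : Tendsto (fun y : ℝ =>
    Complex.log (1 - y * Complex.I) - Complex.log (1 + y * Complex.I)) atTop
    (𝓝 (-(Real.pi * Complex.I))) := by
  have harg : Tendsto (fun y : ℝ => Complex.arg (1 + y * Complex.I)) atTop (𝓝 (Real.pi / 2)) := by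
    have h1 : Tendsto (fun y : ℝ => ((y⁻¹ : ℝ) : ℂ) + Complex.I) atTop (𝓝 Complex.I) := by
      have h2 := (Complex.continuous_ofReal.tendsto 0).comp tendsto_inv_atTop_zero
      simpa using h2.add_const Complex.I
    have h3 : ContinuousAt Complex.arg Complex.I :=
      Complex.continuousAt_arg (Or.inr (by simp))
    have h4 := h3.tendsto.comp h1
    rw [Complex.arg_I] at h4
    refine h4.congr' ?_
    filter_upwards [eventually_gt_atTop 0] with y hy
    have hy' : (y : ℂ) ≠ 0 := by exact_mod_cast hy.ne'
    rw [Function.comp, ← Complex.arg_real_mul _ hy]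
    congr 1
    push_cast
    field_simp
  have h5 := ((Complex.continuous_ofReal.tendsto _).comp harg).const_mul (-(2 * Complex.I))
  have h6 : -(2 * Complex.I) * ((Real.pi / 2 : ℝ) : ℂ) = -(Real.pi * Complex.I) := by
    push_cast
    ring
  rw [h6] at h5
  refine h5.congr fun y => ?_
  have h7 : (1 : ℂ) - y * Complex.I = (starRingEnd ℂ) (1 + y * Complex.I) := by
    simp [sub_eq_add_neg]
  have h8 : Complex.arg (1 + y * Complex.I) ≠ Real.pi := by
    intro h
    have := Complex.arg_eq_pi_iff.1 h
    norm_num at this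
  rw [h7, Complex.log_conj _ h8]
  apply Complex.ext <;> simp [Complex.log_im]
  ring

theorem imaginary_mem_closedStrip (y : ℝ) : (y : ℂ) * Complex.I ∈ closedStrip := by
  simp [closedStrip]

theorem tendsto_stripSize_imaginary :
    Tendsto (fun y : ℝ => stripSize (y * Complex.I)) atTop atTop := by
  refine tendsto_atTop_mono (fun y => ?_) tendsto_id
  have h := Complex.im_le_norm (1 + y * Complex.I)
  simpa [stripSize] using h

theorem tendsto_stripSize_neg_imaginary :
    Tendsto (fun y : ℝ => stripSize (-(y * Complex.I))) atTop atTop := by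
  refine tendsto_atTop_mono (fun y => ?_) tendsto_id
  have h := (neg_le_abs _).trans (Complex.abs_im_le_norm (1 + -(y * Complex.I)))
  simpa [stripSize] using h

/-- For all-ones words of length `d` the limits at `+i∞` and `-i∞` are `(∓πi)^d / d!`. They cancel
for odd `d` and agree for even `d`, which is the origin of `deltaTerm`. -/
theorem tendsto_multitangentAway (k : List ℕ+) : Tendsto (fun y : ℝ =>
    multitangentAway k (y * Complex.I) + multitangentAway k (-(y * Complex.I))) atTop
    (𝓝 (2 * (deltaTerm k : ℂ))) := by
  have h1 := (growsLike_multitangentAway_sub_lead k).tendsto_zero (l := atTop)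
    (φ := fun y : ℝ => y * Complex.I) (by norm_num)
    (Eventually.of_forall imaginary_mem_closedStrip) tendsto_stripSize_imaginary
  have h2 := (growsLike_multitangentAway_sub_lead k).tendsto_zero (l := atTop)
    (φ := fun y : ℝ => -(y * Complex.I)) (by norm_num)
    (Eventually.of_forall fun y => neg_mem_closedStrip (imaginary_mem_closedStrip y))
    tendsto_stripSize_neg_imaginary
  have h3 : Tendsto (fun y : ℝ => tangentLead k (y * Complex.I) +
      tangentLead k (-(y * Complex.I))) atTop (𝓝 (2 * (deltaTerm k : ℂ))) := by
    by_cases h : k = List.replicate k.length 1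
    · have h4 := ((tendsto_log_sub_log.pow k.length).add
        (tendsto_log_sub_log.neg.pow k.length)).div_const (k.length.factorial : ℂ)
      have h5 : ((-(Real.pi * Complex.I)) ^ k.length + (-(-(Real.pi * Complex.I))) ^ k.length) /
          (k.length.factorial : ℂ) = 2 * (deltaTerm k : ℂ) := by
        rw [deltaTerm, neg_neg]
        rcases Nat.even_or_odd k.length with he | ho
        · rw [if_pos ⟨he, h⟩, he.neg_pow]
          obtain ⟨m, hm⟩ := he
          have hm2 : k.length / 2 = m := by omega
          have hI : Complex.I ^ (m + m) = (-1) ^ m := by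
            rw [← two_mul, pow_mul, Complex.I_sq]
          rw [hm2, hm, mul_pow, hI]
          push_cast
          ring
        · rw [if_neg fun h' => (Nat.not_even_iff_odd.2 ho) h'.1, ho.neg_pow]
          simp
      rw [h5] at h4
      refine h4.congr fun y => ?_
      rw [tangentLead, tangentLead, if_pos h, if_pos h, neg_sub, sub_neg_eq_add, add_div,
        ← sub_eq_add_neg]
    · have h5 : (deltaTerm k : ℂ) = 0 := by
        rw [deltaTerm, if_neg fun h' => h h'.2, Complex.ofReal_zero]
      rw [h5, mul_zero]
      refine tendsto_const_nhds.congr fun y => ?_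
      rw [tangentLead, tangentLead, if_neg h, if_neg h, add_zero]
  have h4 := (h1.add h2).add h3
  rw [add_zero, zero_add] at h4
  refine h4.congr fun y => ?_
  ring

/-! ### Division by powers of the variable -/

theorem hasFPowerSeriesAt_taylorCoeff {g : ℂ → ℂ} (hg : AnalyticAt ℂ g 0) :
    HasFPowerSeriesAt g (FormalMultilinearSeries.ofScalars ℂ fun n => taylorCoeff n g) 0 :=
  hg.hasFPowerSeriesAt

theorem taylorCoeff_zero (g : ℂ → ℂ) : taylorCoeff 0 g = g 0 := by simp [taylorCoeff]

theorem taylorCoeff_dslope {g : ℂ → ℂ} (hg : AnalyticAt ℂ g 0) (n : ℕ) :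
    taylorCoeff n (dslope g 0) = taylorCoeff (n + 1) g := by
  have h1 := (hasFPowerSeriesAt_taylorCoeff hg).has_fpower_series_dslope_fslope
  have h2 := h1.eq_formalMultilinearSeries (hasFPowerSeriesAt_taylorCoeff h1.analyticAt)
  have h3 := congrArg (fun p => FormalMultilinearSeries.coeff p n) h2
  simp only [FormalMultilinearSeries.coeff_fslope, FormalMultilinearSeries.coeff_ofScalars] at h3
  exact h3.symm

theorem taylorCoeff_mul {f g : ℂ → ℂ} (hf : AnalyticAt ℂ f 0) (hg : AnalyticAt ℂ g 0) (n : ℕ) :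
    taylorCoeff n (fun z => f z * g z) = ∑ p ∈ Finset.HasAntidiagonal.antidiagonal n,
      taylorCoeff p.1 f * taylorCoeff p.2 g := by
  rw [taylorCoeff, iteratedDeriv_fun_mul hf.contDiffAt hg.contDiffAt, Finset.sum_div,
    Finset.Nat.sum_antidiagonal_eq_sum_range_succ (fun a b => taylorCoeff a f * taylorCoeff b g)]
  refine Finset.sum_congr rfl fun i hi => ?_
  have hi' : i ≤ n := by simpa [Nat.lt_succ_iff] using hi
  have h : (n.choose i : ℂ) * i.factorial * (n - i).factorial = n.factorial := by
    exact_mod_cast Nat.choose_mul_factorial_mul_factorial hi'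
  have h1 : (i.factorial : ℂ) ≠ 0 := by exact_mod_cast i.factorial_ne_zero
  have h2 : ((n - i).factorial : ℂ) ≠ 0 := by exact_mod_cast (n - i).factorial_ne_zero
  have h3 : (n.factorial : ℂ) ≠ 0 := by exact_mod_cast n.factorial_ne_zero
  rw [taylorCoeff, taylorCoeff]
  field_simp
  rw [← h]
  ring

/-- Iterating the divided slope at `0` removes the principal part of `g / z ^ n` without leaving the
holomorphic functions on `V`. The value at `0` becomes the `n`-th coefficient. -/
theorem exists_taylor_remainder {V : Set ℂ} (hV : V ∈ 𝓝 (0 : ℂ)) (n : ℕ) {g : ℂ → ℂ}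
    (hg : DifferentiableOn ℂ g V) : ∃ R : ℂ → ℂ, DifferentiableOn ℂ R V ∧
      R 0 = taylorCoeff n g ∧ ∀ z, z ≠ 0 → R z = (z ^ n)⁻¹ * g z -
        ∑ t ∈ Finset.range n, taylorCoeff t g * (z ^ (n - t))⁻¹ := by
  induction n generalizing g with
  | zero => exact ⟨g, hg, (taylorCoeff_zero g).symm, fun z _ => by simp⟩
  | succ n ih =>
    have hd := (Complex.differentiableOn_dslope hV).2 hg
    obtain ⟨R, hR, hR0, hRz⟩ := ih hd
    have hcoeff : ∀ m, taylorCoeff m (dslope g 0) = taylorCoeff (m + 1) g :=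
      taylorCoeff_dslope (hg.analyticAt hV)
    refine ⟨R, hR, by rw [hR0, hcoeff], fun z hz => ?_⟩
    rw [hRz z hz, Finset.sum_range_succ', dslope_of_ne _ hz, slope_def_field, taylorCoeff_zero]
    simp only [hcoeff, Nat.add_sub_add_right, Nat.sub_zero, sub_zero]
    field_simp
    ring

theorem analyticAt_posPart (k : List ℕ+) : AnalyticAt ℂ (fun z => posPart z k) 0 :=
  (differentiableOn_posPart k).analyticAt (isOpen_openStrip.mem_nhds zero_mem_openStrip)

theorem analyticAt_negPart (k : List ℕ+) : AnalyticAt ℂ (fun z => negPart z k) 0 :=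
  (differentiableOn_negPart k).analyticAt (isOpen_openStrip.mem_nhds zero_mem_openStrip)

theorem taylorCoeff_posPart (a : ℕ) (k : List ℕ+) :
    taylorCoeff a (fun z => posPart z k) = (zetaTaylor a k : ℂ) := by
  rw [← iteratedDeriv_hurwitz_one, taylorCoeff]
  simp only [posPart]
  rw [iteratedDeriv_comp_const_add]
  beta_reduce
  rw [add_zero]

theorem taylorCoeff_negPart (a : ℕ) (k : List ℕ+) : taylorCoeff a (fun z => negPart z k) =
    weightSign k * (-1) ^ a * (zetaTaylor a k.reverse : ℂ) := by
  rw [← iteratedDeriv_hurwitz_one, taylorCoeff]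
  simp only [negPart]
  rw [iteratedDeriv_const_mul_field, iteratedDeriv_comp_const_sub]
  beta_reduce
  rw [sub_zero, smul_eq_mul]
  ring

/-! ### Periodic functions that are bounded on a strip -/

/-- Translating each point into the strip `|Re z| ≤ 1 / 2` extends `f` to an entire periodic
function bounded by its bound there, so Liouville's theorem applies. -/
theorem eq_of_periodic_of_bounded {f : ℂ → ℂ} (hd : DifferentiableOn ℂ f openStrip)
    (hp : ∀ z : ℂ, -1 < z.re → z.re < 0 → f (z + 1) = f z)
    (hb : ∃ C, ∀ z ∈ closedStrip, ‖f z‖ ≤ C) {z : ℂ} (hz : |z.re| < 1 / 2) : f z = f 0 := by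
  obtain ⟨C, hC⟩ := hb
  set F : ℂ → ℂ := fun z => f (z - (round z.re : ℤ)) with hF
  have hF0 : ∀ w : ℂ, |w.re| < 1 / 2 → F w = f w := fun w hw => by
    have : round w.re = 0 := by
      rw [round_eq_zero_iff]
      rw [abs_lt] at hw
      constructor <;> linarith
    simp [hF, this]
  -- Rounding jumps at half-integers. Near `z₀` one can use the translation of `z₀` instead: real
  -- parts stay below `1 / 2 + 1 / 4 < 1` in absolute value, the two roundings differ by at most
  -- `1`, and periodicity bridges the difference.
  have hlocal : ∀ z₀ : ℂ, ∀ z : ℂ, |z.re - z₀.re| < 1 / 4 →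
      z - (round z₀.re : ℤ) ∈ openStrip ∧ F z = f (z - (round z₀.re : ℤ)) := by
    intro z₀ z h
    set n := round z₀.re with hn
    set m := round z.re with hm
    have h1 := abs_le.1 (abs_sub_round z₀.re)
    have h2 := abs_le.1 (abs_sub_round z.re)
    rw [← hn] at h1
    rw [← hm] at h2
    rw [abs_lt] at h
    have hre : (z - (n : ℂ)).re = z.re - n := by simp
    refine ⟨⟨by rw [hre]; linarith, by rw [hre]; linarith⟩, ?_⟩
    have h3 : m - n < 2 := by
      have : ((m - n : ℤ) : ℝ) < 2 := by push_cast; linarith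
      exact_mod_cast this
    have h4 : -2 < m - n := by
      have : (-2 : ℝ) < ((m - n : ℤ) : ℝ) := by push_cast; linarith
      exact_mod_cast this
    rcases (by omega : m = n ∨ m = n + 1 ∨ n = m + 1) with h5 | h5 | h5
    · simp only [hF, ← hm, h5]
    · have hmr : (m : ℝ) = n + 1 := by exact_mod_cast h5
      have h6 := hp (z - m) (by simp; linarith) (by simp; linarith)
      simp only [hF, ← hm]
      rw [← h6, h5]
      congr 1
      push_cast
      ring
    · have hmr : (n : ℝ) = m + 1 := by exact_mod_cast h5
      have h6 := hp (z - n) (by simp; linarith) (by simp; linarith)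
      simp only [hF, ← hm]
      rw [← h6, h5]
      congr 1
      push_cast
      ring
  have hFd : Differentiable ℂ F := by
    intro z₀
    have hev : F =ᶠ[𝓝 z₀] fun z => f (z - (round z₀.re : ℤ)) := by
      have hopen : IsOpen {z : ℂ | |z.re - z₀.re| < 1 / 4} :=
        isOpen_lt (by fun_prop) continuous_const
      filter_upwards [hopen.mem_nhds (by simp : z₀ ∈ {z : ℂ | |z.re - z₀.re| < 1 / 4})] with z h
      exact (hlocal z₀ z h).2
    refine DifferentiableAt.congr_of_eventuallyEq ?_ hev
    have hmem := (hlocal z₀ z₀ (by simp)).1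
    have hat := hd.differentiableAt (isOpen_openStrip.mem_nhds hmem)
    exact hat.comp z₀ (by fun_prop : DifferentiableAt ℂ (fun z : ℂ => z - ((round z₀.re : ℤ) : ℂ)) z₀)
  have hFb : Bornology.IsBounded (Set.range F) := by
    rw [isBounded_iff_forall_norm_le]
    refine ⟨C, ?_⟩
    rintro _ ⟨w, rfl⟩
    refine hC _ ?_
    have := abs_sub_round w.re
    simpa [closedStrip] using this
  rw [← hF0 z hz, ← hF0 0 (by simp)]
  exact hFd.apply_eq_apply_of_bounded hFb z 0

/-! ### Reduction of multitangent functions -/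

/-- The part of the closed strip away from the real axis. -/
def farStrip : Set ℂ := {z | z ∈ closedStrip ∧ 1 ≤ |z.im|}

theorem half_le_stripSize_far : ∀ z ∈ farStrip, 1 / 2 ≤ stripSize z :=
  fun z hz => half_le_stripSize z hz.1

theorem growsLike_inv_pow_far {n : ℕ} (hn : n ≠ 0) :
    GrowsLike farStrip stripSize (-1) (fun z => (z ^ n)⁻¹) := by
  intro ε hε
  refine ⟨2, fun z hz => ?_⟩
  have h1 : 1 ≤ ‖z‖ := hz.2.trans (Complex.abs_im_le_norm z)
  have h2 : 1 ≤ stripSize z := by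
    refine hz.2.trans ?_
    have := Complex.abs_im_le_norm (1 + z)
    simpa [stripSize] using this
  have h3 : stripSize z ≤ 2 * ‖z‖ := by
    have := norm_add_le 1 z
    rw [norm_one] at this
    rw [stripSize]
    linarith
  have h4 : ‖(z ^ n)⁻¹‖ ≤ ‖z‖⁻¹ := by
    rw [norm_inv, norm_pow]
    exact inv_anti₀ (by linarith) (le_self_pow₀ h1 hn)
  have h5 : ‖z‖⁻¹ ≤ 2 * (stripSize z)⁻¹ := by
    rw [inv_le_comm₀ (by linarith) (by positivity), mul_inv, inv_inv]
    linarith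
  have h6 : (stripSize z)⁻¹ ≤ stripSize z ^ (-1 + ε) := by
    rw [← Real.rpow_neg_one]
    exact Real.rpow_le_rpow_of_exponent_le h2 (by linarith)
  linarith

theorem growsLike_posPart (k : List ℕ+) :
    GrowsLike closedStrip stripSize 0 (fun z => posPart z k) :=
  (grows_hurwitz k).one_add

theorem growsLike_negPart (k : List ℕ+) :
    GrowsLike closedStrip stripSize 0 (fun z => negPart z k) :=
  (grows_hurwitz k.reverse).one_sub.const_mul half_le_stripSize _

theorem GrowsLike.mono_set {X : Type*} {S T : Set X} {ρ : X → ℝ} {r : ℝ} {f : X → ℂ}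
    (hf : GrowsLike S ρ r f) (h : T ⊆ S) : GrowsLike T ρ r f := fun ε hε => by
  obtain ⟨C, hC⟩ := hf ε hε
  exact ⟨C, fun w hw => hC w (h hw)⟩

/-- The product of which a principal part is taken at the integer with index `j`. -/
noncomputable def sideProduct (k : List ℕ+) (j : ℕ) (z : ℂ) : ℂ :=
  negPart z (k.take j) * posPart z (k.drop (j + 1))

/-- Functions that differ from a product of the given shape by its principal part. -/
theorem exists_bounded_remainder (k : List ℕ+) (j : ℕ) {n : ℕ} (hn : n ≠ 0) :
    ∃ R : ℂ → ℂ, DifferentiableOn ℂ R openStrip ∧ R 0 = taylorCoeff n (sideProduct k j) ∧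
      (∀ z, z ≠ 0 → R z = (z ^ n)⁻¹ * sideProduct k j z -
        ∑ t ∈ Finset.range n, taylorCoeff t (sideProduct k j) * (z ^ (n - t))⁻¹) ∧
      (∃ C, ∀ z ∈ closedStrip, ‖R z‖ ≤ C) ∧
      Tendsto (fun y : ℝ => R (y * Complex.I) + R (-(y * Complex.I))) atTop (𝓝 0) := by
  have hd : DifferentiableOn ℂ (sideProduct k j) openStrip :=
    (differentiableOn_negPart _).mul (differentiableOn_posPart _)
  obtain ⟨R, hR, hR0, hRz⟩ := exists_taylor_remainder
    (isOpen_openStrip.mem_nhds zero_mem_openStrip) n hd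
  -- Away from the real axis every negative power of `z` decays like `1 / |z|`, while the parts grow
  -- slower than any positive power. Near the axis the bound comes from compactness.
  have hgrow : GrowsLike farStrip stripSize (-1) R := by
    have h1 := (growsLike_inv_pow_far hn).mul half_le_stripSize_far
      (((growsLike_negPart (k.take j)).mul half_le_stripSize
        (growsLike_posPart (k.drop (j + 1)))).mono_set fun z hz => hz.1)
    have h2 := GrowsLike.finset_sum (S := farStrip) (ρ := stripSize) (r := -1) (Finset.range n)
      (F := fun t z => taylorCoeff t (sideProduct k j) * (z ^ (n - t))⁻¹) fun t ht =>
        (growsLike_inv_pow_far (by have := Finset.mem_range.1 ht; omega)).const_mul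
          half_le_stripSize_far _
    norm_num at h1
    refine (h1.sub half_le_stripSize_far h2).congr fun z hz => ?_
    have hz0 : z ≠ 0 := by
      rintro rfl
      have := hz.2
      norm_num at this
    rw [hRz z hz0, sideProduct]
  refine ⟨R, hR, hR0, hRz, ?_, ?_⟩
  · obtain ⟨C, hC⟩ := hgrow.bounded (by norm_num)
    have hcomp : IsCompact (Set.Icc (-(1 / 2) : ℝ) (1 / 2) ×ℂ Set.Icc (-1 : ℝ) 1) :=
      isCompact_Icc.reProdIm isCompact_Icc
    have hsub : Set.Icc (-(1 / 2) : ℝ) (1 / 2) ×ℂ Set.Icc (-1 : ℝ) 1 ⊆ openStrip := fun z hz =>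
      closedStrip_subset (abs_le.2 hz.1)
    obtain ⟨D, hD⟩ := hcomp.exists_bound_of_continuousOn (hR.continuousOn.mono hsub)
    refine ⟨max C D, fun z hz => ?_⟩
    rcases le_total 1 |z.im| with h | h
    · exact (hC z ⟨hz, h⟩).trans (le_max_left _ _)
    · exact (hD z ⟨abs_le.1 hz, abs_le.1 h⟩).trans (le_max_right _ _)
  · have h1 := hgrow.tendsto_zero (l := atTop) (φ := fun y : ℝ => y * Complex.I) (by norm_num)
      ?_ tendsto_stripSize_imaginary
    have h2 := hgrow.tendsto_zero (l := atTop) (φ := fun y : ℝ => -(y * Complex.I)) (by norm_num)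
      ?_ tendsto_stripSize_neg_imaginary
    · simpa using h1.add h2
    · filter_upwards [eventually_ge_atTop 1] with y hy
      refine ⟨neg_mem_closedStrip (imaginary_mem_closedStrip y), ?_⟩
      simpa using hy.trans (le_abs_self y)
    · filter_upwards [eventually_ge_atTop 1] with y hy
      refine ⟨imaginary_mem_closedStrip y, ?_⟩
      simpa using hy.trans (le_abs_self y)

theorem deltaTerm_singleton (x : ℕ+) : deltaTerm [x] = 0 := by
  rw [deltaTerm, if_neg]
  rintro ⟨h, -⟩
  simp at h

/-- The constant terms in the reduction of a multitangent function to monotangent functions. -/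
theorem multitangentAway_zero (k : List ℕ+) :
    multitangentAway k 0 + ∑ j : Fin k.length,
      (taylorCoeff (k.get j) (sideProduct k j) - ∑ t ∈ Finset.range (k.get j),
        taylorCoeff t (sideProduct k j) *
          multitangentAway [Nat.succPNat ((k.get j : ℕ) - 1 - t)] 0) = (deltaTerm k : ℂ) := by
  choose R hRd hR0 hRz hRb hRlim using fun j : Fin k.length =>
    exists_bounded_remainder k j (k.get j).ne_zero
  -- This is the holomorphic extension over `0` of the multitangent function minus the monotangent
  -- functions matching its principal part. The entry `((k.get j : ℕ) - 1 - t).succPNat` is the pole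
  -- order `kⱼ - t`.
  set f : ℂ → ℂ := fun z => multitangentAway k z + ∑ j : Fin k.length,
      (R j z - ∑ t ∈ Finset.range (k.get j), taylorCoeff t (sideProduct k j) *
        multitangentAway [Nat.succPNat ((k.get j : ℕ) - 1 - t)] z) with hf
  have hfz : ∀ z, z ≠ 0 → f z = multitangent k z - ∑ j : Fin k.length,
      ∑ t ∈ Finset.range (k.get j), taylorCoeff t (sideProduct k j) *
        multitangent [Nat.succPNat ((k.get j : ℕ) - 1 - t)] z := by
    intro z hz
    rw [multitangent_eq, add_sub_assoc, ← Finset.sum_sub_distrib]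
    simp only [hf]
    congr 1
    refine Finset.sum_congr rfl fun j _ => ?_
    rw [hRz j z hz, sub_sub, ← Finset.sum_add_distrib]
    congr 1
    refine Finset.sum_congr rfl fun t ht => ?_
    have ht' := Finset.mem_range.1 ht
    rw [multitangent_singleton, Nat.succPNat_coe,
      (by omega : ((k.get j : ℕ) - 1 - t).succ = (k.get j : ℕ) - t)]
    ring
  have hfd : DifferentiableOn ℂ f openStrip :=
    (differentiableOn_multitangentAway k).add (DifferentiableOn.fun_sum fun j _ =>
      (hRd j).sub (DifferentiableOn.fun_sum fun t _ =>
        (differentiableOn_multitangentAway _).const_mul _))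
  have hfp : ∀ z : ℂ, -1 < z.re → z.re < 0 → f (z + 1) = f z := by
    intro z h1 h2
    have hz : z ≠ 0 := by
      rintro rfl
      simp at h2
    have hz1 : z + 1 ≠ 0 := by
      intro h
      have := congrArg Complex.re h
      simp at this
      linarith
    rw [hfz z hz, hfz _ hz1, multitangent_add_one k h1 h2]
    simp only [multitangent_add_one _ h1 h2]
  have hfb : ∃ C, ∀ z ∈ closedStrip, ‖f z‖ ≤ C := by
    choose B hB using bounded_multitangentAway
    choose D hD using hRb
    refine ⟨B k + ∑ j : Fin k.length, (D j + ∑ t ∈ Finset.range (k.get j),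
      ‖taylorCoeff t (sideProduct k j)‖ * B [Nat.succPNat ((k.get j : ℕ) - 1 - t)]),
      fun z hz => ?_⟩
    refine (norm_add_le _ _).trans (add_le_add (hB k z hz) ((norm_sum_le _ _).trans
      (Finset.sum_le_sum fun j _ => (norm_sub_le _ _).trans (add_le_add (hD j z hz)
        ((norm_sum_le _ _).trans (Finset.sum_le_sum fun t _ => ?_))))))
    rw [norm_mul]
    exact mul_le_mul_of_nonneg_left (hB _ z hz) (norm_nonneg _)
  have hconst : ∀ y : ℝ, f (y * Complex.I) + f (-(y * Complex.I)) = 2 * f 0 := fun y => by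
    rw [eq_of_periodic_of_bounded hfd hfp hfb (z := y * Complex.I) (by simp),
      eq_of_periodic_of_bounded hfd hfp hfb (z := -(y * Complex.I)) (by simp), two_mul]
  have hlim : Tendsto (fun y : ℝ => f (y * Complex.I) + f (-(y * Complex.I))) atTop
      (𝓝 (2 * (deltaTerm k : ℂ))) := by
    have h1 := (tendsto_multitangentAway k).add (tendsto_finsetSum Finset.univ
      fun j (_ : j ∈ (Finset.univ : Finset (Fin k.length))) => (hRlim j).sub
        (tendsto_finsetSum (Finset.range (k.get j)) fun t _ =>
          (tendsto_multitangentAway [Nat.succPNat ((k.get j : ℕ) - 1 - t)]).const_mul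
            (taylorCoeff t (sideProduct k j))))
    simp only [deltaTerm_singleton, Complex.ofReal_zero, mul_zero, Finset.sum_const_zero,
      sub_zero, add_zero] at h1
    refine h1.congr fun y => ?_
    simp only [hf, mul_add, Finset.sum_add_distrib, Finset.sum_sub_distrib]
    ring
  simp only [hconst] at hlim
  have h2 := tendsto_nhds_unique tendsto_const_nhds hlim
  have h3 := mul_left_cancel₀ two_ne_zero h2
  rw [← h3]
  simp only [hf, hR0]

/-! ### Even zeta values and the final rearrangement -/

theorem zetaReg_singleton_even {m : ℕ} (hm : m ≠ 0) {x : ℕ+} (hx : (x : ℕ) = 2 * m) :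
    zetaReg [x] = (-1) ^ (m + 1) * 2 ^ (2 * m - 1) * Real.pi ^ (2 * m) * (bernoulli (2 * m) : ℝ) /
      ((2 * m).factorial : ℝ) := by
  have hx1 : x ≠ 1 := by
    rintro rfl
    rw [PNat.one_coe] at hx
    omega
  have h1 := tendsto_truncSum_zetaReg [] x hx1
  have h2 := ((hasSum_zeta_nat hm).tendsto_sum_nat).comp (tendsto_add_atTop_nat 1)
  refine tendsto_nhds_unique h1 (h2.congr fun N => ?_)
  -- The series for the zeta value starts at `n = 0`, where its term is `1 / 0 = 0` by convention.
  have hr : Finset.range (N + 1) = insert 0 (Finset.Ioc 0 N) := by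
    ext n
    simp only [Finset.mem_range, Finset.mem_insert, Finset.mem_Ioc]
    omega
  rw [Function.comp, hr, Finset.sum_insert (by simp)]
  simp [truncSum, hx, hm]

/-- The value at `0` of the regular part of a monotangent function. -/
theorem zetaReg_singleton_add (x : ℕ+) :
    zetaReg [x] + (-1) ^ (x : ℕ) * zetaReg [x] =
      -(if Even (x : ℕ) then (-1) ^ ((x : ℕ) / 2) * ((2 * Real.pi) ^ (2 * ((x : ℕ) / 2)) /
        ((2 * ((x : ℕ) / 2)).factorial : ℝ)) * (bernoulli (2 * ((x : ℕ) / 2)) : ℝ) else 0) := by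
  split_ifs with h
  · obtain ⟨m, hm⟩ := h
    have hm0 : m ≠ 0 := by
      rintro rfl
      exact x.ne_zero hm
    have hx : (x : ℕ) = 2 * m := by omega
    have hd : (x : ℕ) / 2 = m := by omega
    have h3 : (-1 : ℝ) ^ (2 * m) = 1 := by rw [pow_mul, neg_one_sq, one_pow]
    have h2 : (2 : ℝ) * 2 ^ (2 * m - 1) = 2 ^ (2 * m) := by
      rw [← pow_succ']
      congr 1
      omega
    rw [hd, zetaReg_singleton_even hm0 hx, hx, h3, mul_pow, ← h2]
    ring
  · rw [(Nat.not_even_iff_odd.1 h).neg_one_pow]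
    ring

theorem mem_triples {n a m c : ℕ} : (a, m, c) ∈ triples n ↔ a + 2 * m + c = n := by
  simp only [triples, Finset.mem_filter, Finset.mem_product, Finset.mem_range]
  omega

/-- Grouping by `p = (a + c, 2m)` isolates the Taylor coefficient of a product of two functions, at
the cost of zero terms for odd second coordinate. -/
theorem sum_triples {R : Type*} [CommRing R] (n : ℕ) (u v b : ℕ → R) :
    ∑ t ∈ triples n, u t.1 * b t.2.1 * v t.2.2 =
      ∑ p ∈ Finset.HasAntidiagonal.antidiagonal n,
        (∑ r ∈ Finset.HasAntidiagonal.antidiagonal p.1, u r.1 * v r.2) *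
          (if Even p.2 then b (p.2 / 2) else 0) := by
  simp only [Finset.sum_mul]
  rw [Finset.sum_sigma']
  refine Finset.sum_of_injOn (fun t => ⟨(t.1 + t.2.2, 2 * t.2.1), (t.1, t.2.2)⟩) ?_ ?_ ?_ ?_
  · rintro ⟨a, m, c⟩ _ ⟨a', m', c'⟩ _ h
    simp only [Sigma.mk.injEq, Prod.mk.injEq, heq_eq_eq] at h
    simp only [Prod.mk.injEq]
    omega
  · rintro ⟨a, m, c⟩ h
    rw [Finset.mem_coe, mem_triples] at h
    rw [Finset.mem_coe, Finset.mem_sigma]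
    refine ⟨Finset.HasAntidiagonal.mem_antidiagonal.2 ?_,
      Finset.HasAntidiagonal.mem_antidiagonal.2 rfl⟩
    change a + c + 2 * m = n
    omega
  · rintro ⟨⟨s, e⟩, ⟨a, c⟩⟩ h h'
    simp only [Finset.mem_sigma, Finset.HasAntidiagonal.mem_antidiagonal] at h
    rw [if_neg, mul_zero]
    rintro ⟨m, hm⟩
    refine h' ⟨(a, m, c), ?_, ?_⟩
    · rw [Finset.mem_coe, mem_triples]
      simp only at hm
      omega
    · simp only [Sigma.mk.injEq, Prod.mk.injEq, heq_eq_eq, and_true]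
      simp only at hm
      omega
  · rintro ⟨a, m, c⟩ _
    simp
    ring

/-! ### Symmetric sums and the passage to the parity formula -/

/-- The finite symmetric sums `∑ᵢ (-1) ^ (k₁ + ⋯ + kᵢ) ζ^*(kᵢ, …, k₁) ζ^*(kᵢ₊₁, …, k_d)`. -/
noncomputable def symmetricSum (k : List ℕ+) : ℝ :=
  conv (fun l => weightSign l * zetaReg l.reverse) zetaReg k

theorem multitangentAway_zero_eq (k : List ℕ+) :
    multitangentAway k 0 = (symmetricSum k : ℂ) := by
  rw [multitangentAway, symmetricSum, conv_eq_sum, conv_eq_sum]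
  push_cast
  refine Finset.sum_congr rfl fun i _ => ?_
  simp only [negPart, posPart, sub_zero, add_zero, hurwitz_one, weightSign]
  push_cast
  rfl

theorem symmetricSum_singleton (x : ℕ+) :
    symmetricSum [x] = zetaReg [x] + (-1) ^ (x : ℕ) * zetaReg [x] := by
  simp [symmetricSum, conv_cons, conv_nil, zetaReg_nil, weightSign, weight_cons, weight_nil]

/-- The Taylor coefficients of `sideProduct`. -/
noncomputable def sideCoeff (k : List ℕ+) (j t : ℕ) : ℝ :=
  ∑ p ∈ Finset.HasAntidiagonal.antidiagonal t, (weightSign (k.take j) * (-1) ^ p.1 *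
    zetaTaylor p.1 (k.take j).reverse) * zetaTaylor p.2 (k.drop (j + 1))

theorem taylorCoeff_sideProduct (k : List ℕ+) (j t : ℕ) :
    taylorCoeff t (sideProduct k j) = (sideCoeff k j t : ℂ) := by
  have h := taylorCoeff_mul (analyticAt_negPart (k.take j)) (analyticAt_posPart (k.drop (j + 1))) t
  rw [sideCoeff]
  refine h.trans ?_
  push_cast
  refine Finset.sum_congr rfl fun p _ => ?_
  rw [taylorCoeff_negPart, taylorCoeff_posPart, weightSign, weightSign]
  push_cast
  rfl

/-- In the sum over triples, `m = 0` is the constant term of the remainder at position `j`, and `m >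
0` is the monotangent function of order `2m`, whose constant is an even zeta value. Odd orders
contribute nothing by symmetry. -/
theorem symmetricSum_eq (k : List ℕ+) : symmetricSum k = deltaTerm k -
    ∑ j : Fin k.length, ∑ t ∈ triples (k.get j),
      (-1) ^ (t.2.1 + t.2.2 + weight (k.take (j + 1))) *
        ((2 * Real.pi) ^ (2 * t.2.1) / ((2 * t.2.1).factorial : ℝ)) *
        (bernoulli (2 * t.2.1) : ℝ) * zetaTaylor t.1 (k.take j).reverse *
        zetaTaylor t.2.2 (k.drop (j + 1)) := by
  have h := multitangentAway_zero k
  simp only [multitangentAway_zero_eq, taylorCoeff_sideProduct] at h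
  norm_cast at h
  rw [← h, add_sub_assoc, eq_comm, add_eq_left, ← Finset.sum_sub_distrib]
  refine Finset.sum_eq_zero fun j _ => ?_
  set n : ℕ := (k.get j : ℕ) with hn
  have hn0 : 0 < n := (k.get j).pos
  have hw : weight (k.take (j + 1)) = weight (k.take j) + n := by
    rw [List.take_succ_eq_append_getElem j.isLt, weight_append, weight_cons, weight_nil, add_zero]
    rfl
  set u : ℕ → ℝ := fun a =>
    weightSign (k.take j) * (-1) ^ a * zetaTaylor a (k.take j).reverse with hu
  set v : ℕ → ℝ := fun b => zetaTaylor b (k.drop (j + 1)) with hv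
  set c : ℕ → ℝ := fun m => (-1) ^ m * ((2 * Real.pi) ^ (2 * m) / ((2 * m).factorial : ℝ)) *
    (bernoulli (2 * m) : ℝ) with hc
  have h1 : ∑ t ∈ triples n, (-1) ^ (t.2.1 + t.2.2 + weight (k.take (j + 1))) *
        ((2 * Real.pi) ^ (2 * t.2.1) / ((2 * t.2.1).factorial : ℝ)) *
        (bernoulli (2 * t.2.1) : ℝ) * zetaTaylor t.1 (k.take j).reverse *
        zetaTaylor t.2.2 (k.drop (j + 1)) = ∑ t ∈ triples n, u t.1 * c t.2.1 * v t.2.2 := by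
    refine Finset.sum_congr rfl fun t ht => ?_
    have ht' : t.1 + 2 * t.2.1 + t.2.2 = n := (Finset.mem_filter.1 ht).2
    -- As `kⱼ = a + 2m + b`, the sign `(-1)^(b + kⱼ)` equals `(-1)^a`, which is the sign produced by
    -- differentiating in `1 - z`.
    have hs : (-1 : ℝ) ^ (t.2.1 + t.2.2 + weight (k.take (j + 1))) =
        (-1) ^ (weight (k.take j)) * (-1) ^ t.1 * (-1) ^ t.2.1 := by
      rw [hw, ← ht', ← pow_add, ← pow_add, (by ring : t.2.1 + t.2.2 + (weight (k.take j) +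
        (t.1 + 2 * t.2.1 + t.2.2)) = weight (k.take j) + t.1 + t.2.1 + 2 * (t.2.1 + t.2.2)),
        pow_add _ _ (2 * _), pow_mul (-1 : ℝ) 2, neg_one_sq, one_pow, mul_one]
    rw [hs]
    simp only [hu, hv, hc, weightSign]
    ring
  rw [h1, sum_triples, Finset.Nat.sum_antidiagonal_eq_sum_range_succ (fun p s =>
    (∑ r ∈ Finset.HasAntidiagonal.antidiagonal p, u r.1 * v r.2) *
      (if Even s then c (s / 2) else 0)), Finset.sum_range_succ]
  have h2 : ∀ t ∈ Finset.range n, symmetricSum [(n - 1 - t).succPNat] =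
        -(if Even (n - t) then c ((n - t) / 2) else 0) := fun t ht => by
    have ht' := Finset.mem_range.1 ht
    rw [symmetricSum_singleton, zetaReg_singleton_add, Nat.succPNat_coe, (by omega : (n - 1 - t).succ = n - t)]
  have h3 : ∑ t ∈ Finset.range n, sideCoeff k j t * symmetricSum [(n - 1 - t).succPNat] =
      -∑ t ∈ Finset.range n, sideCoeff k j t * (if Even (n - t) then c ((n - t) / 2) else 0) := by
    rw [← Finset.sum_neg_distrib]
    exact Finset.sum_congr rfl fun t ht => by rw [h2 t ht, mul_neg]
  rw [h3, Nat.sub_self, if_pos (by simp)]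
  have h4 : c (0 / 2) = 1 := by simp [hc]
  rw [h4, mul_one]
  simp only [sideCoeff, hu, hv]
  ring

/-- Weight signs are multiplicative, so twisting the antipode relation by them inverts the left
factor in the definition of `symmetricSum`. -/
theorem zetaReg_eq_conv (k : List ℕ+) : zetaReg k =
    conv (fun l => weightSign l * (lengthSign l * zetaStarReg l)) symmetricSum k := by
  have h1 : conv (fun l => weightSign l * (lengthSign l * zetaStarReg l))
      (fun l => weightSign l * zetaReg l.reverse) = convUnit := by
    funext l
    rw [conv_mul_mul weightSign _ _ weightSign_append, conv_zetaStar_reverse]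
    cases l <;> simp [convUnit, weightSign, weight_nil]
  have h2 : symmetricSum = conv (fun l => weightSign l * zetaReg l.reverse) zetaReg := rfl
  rw [h2, ← conv_assoc, h1, conv_unit_left]

theorem symmetricSum_nil : symmetricSum [] = 1 := by
  simp [symmetricSum, conv_nil, zetaReg_nil, weightSign, weight_nil]

/-- When the delta term is nonzero, the tail consists of an even number of ones. Its weight and
length are then equal and even, so the parity hypothesis passes to the first `i` letters and fixes
the sign. -/
theorem sign_mul_deltaTerm (k : List ℕ+) (hpar : ¬ weight k ≡ k.length [MOD 2]) {i : ℕ}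
    (hi : i < k.length) : (-1 : ℝ) ^ (i + weight (k.take i)) * deltaTerm (k.drop i) =
      -((-1) ^ (k.length - i) * deltaTerm (k.drop i)) := by
  rw [deltaTerm]
  split_ifs with h
  · have h1 : weight k = weight (k.take i) + weight (k.drop i) := by
      rw [← weight_append, List.take_append_drop]
    rw [weight_of_eq_replicate h.2, List.length_drop] at h1
    have h2 := h.1
    rw [List.length_drop] at h2
    have h3 : Odd (i + weight (k.take i)) := by
      rw [Nat.ModEq] at hpar
      rw [Nat.odd_iff]
      rw [Nat.even_iff] at h2
      omega
    rw [h2.neg_one_pow, h3.neg_one_pow]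
    ring
  · simp

/-- The summands of the sum over `i < j`. -/
noncomputable def parityTerm (k : List ℕ+) (i j : ℕ) : ℝ :=
  -- Positions count from `0`, so `j` stands for `j - 1` in the formula. The default `1` plays no
  -- role, as only `j < k.length` is used.
  ∑ t ∈ triples (k.getD j 1), (-1 : ℝ) ^ (t.2.1 + i + t.2.2 + weight (k.take (j + 1)))
    * ((2 * Real.pi) ^ (2 * t.2.1) / (2 * ((2 * t.2.1).factorial : ℝ)))
    * (bernoulli (2 * t.2.1) : ℝ) * zetaStarReg (k.take i)
    * zetaTaylor t.1 ((k.take j).drop i).reverse * zetaTaylor t.2.2 (k.drop (j + 1))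

/-- Applying the symmetric sum formula to the tail only shifts positions by `i`. The factor `2`
offsets the `2` in the denominator of `parityTerm`. -/
theorem sign_mul_symmetricSum_drop (k : List ℕ+) (i : ℕ) :
    (-1 : ℝ) ^ (i + weight (k.take i)) * zetaStarReg (k.take i) * symmetricSum (k.drop i) =
      (-1 : ℝ) ^ (i + weight (k.take i)) * zetaStarReg (k.take i) * deltaTerm (k.drop i) -
        2 * ∑ j ∈ Finset.Ico i k.length, parityTerm k i j := by
  rw [symmetricSum_eq, mul_sub]
  congr 1
  have h1 : ∑ j : Fin (k.drop i).length, ∑ t ∈ triples ((k.drop i).get j),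
      (-1 : ℝ) ^ (t.2.1 + t.2.2 + weight ((k.drop i).take (j + 1))) *
        ((2 * Real.pi) ^ (2 * t.2.1) / ((2 * t.2.1).factorial : ℝ)) *
        (bernoulli (2 * t.2.1) : ℝ) * zetaTaylor t.1 ((k.drop i).take j).reverse *
        zetaTaylor t.2.2 ((k.drop i).drop (j + 1)) =
      ∑ j ∈ Finset.range (k.length - i), ∑ t ∈ triples (k.getD (i + j) 1),
      (-1 : ℝ) ^ (t.2.1 + t.2.2 + weight ((k.drop i).take (j + 1))) *
        ((2 * Real.pi) ^ (2 * t.2.1) / ((2 * t.2.1).factorial : ℝ)) *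
        (bernoulli (2 * t.2.1) : ℝ) * zetaTaylor t.1 ((k.drop i).take j).reverse *
        zetaTaylor t.2.2 ((k.drop i).drop (j + 1)) := by
    rw [← List.length_drop, ← Fin.sum_univ_eq_sum_range (fun j => ∑ t ∈ triples (k.getD (i + j) 1),
      (-1 : ℝ) ^ (t.2.1 + t.2.2 + weight ((k.drop i).take (j + 1))) *
        ((2 * Real.pi) ^ (2 * t.2.1) / ((2 * t.2.1).factorial : ℝ)) *
        (bernoulli (2 * t.2.1) : ℝ) * zetaTaylor t.1 ((k.drop i).take j).reverse *
        zetaTaylor t.2.2 ((k.drop i).drop (j + 1)))]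
    refine Finset.sum_congr rfl fun j _ => ?_
    have hj : i + (j : ℕ) < k.length := by
      have := j.isLt.trans_eq List.length_drop
      omega
    rw [List.getD_eq_getElem _ _ hj, List.get_eq_getElem, List.getElem_drop]
  rw [h1, Finset.sum_Ico_eq_sum_range, Finset.mul_sum, Finset.mul_sum]
  refine Finset.sum_congr rfl fun j _ => ?_
  rw [parityTerm, Finset.mul_sum, Finset.mul_sum]
  refine Finset.sum_congr rfl fun t _ => ?_
  have h2 : weight (k.take (i + j + 1)) = weight (k.take i) + weight ((k.drop i).take (j + 1)) := by
    rw [add_assoc, List.take_add, weight_append]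
  have h3 : (k.drop i).take j = (k.take (i + j)).drop i := by
    rw [List.drop_take, Nat.add_sub_cancel_left]
  rw [h2, h3, List.drop_drop, ← add_assoc]
  have h4 : (-1 : ℝ) ^ (t.2.1 + i + t.2.2 + (weight (k.take i) +
      weight ((k.drop i).take (j + 1)))) = (-1) ^ (i + weight (k.take i)) *
        (-1) ^ (t.2.1 + t.2.2 + weight ((k.drop i).take (j + 1))) := by
    rw [← pow_add]
    congr 1
    ring
  have h5 : (((2 * t.2.1).factorial : ℕ) : ℝ) ≠ 0 := by
    exact_mod_cast (2 * t.2.1).factorial_ne_zero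
  rw [h4]
  field_simp

end MZV

theorem theorem2p3 (k : List ℕ+) (hpar : ¬ MZV.weight k ≡ k.length [MOD 2]) :
    MZV.zetaReg k =
      (MZV.zetaReg k - MZV.zetaStarReg k) / 2
      - 1 / 2 * ∑ i ∈ Finset.range k.length,
          (-1 : ℝ) ^ (k.length - i) * MZV.zetaStarReg (k.take i) * MZV.deltaTerm (k.drop i)
      - ∑ j : Fin k.length, ∑ i ∈ Finset.range (j + 1), ∑ t ∈ MZV.triples (k.get j),
          (-1 : ℝ) ^ (t.2.1 + i + t.2.2 + MZV.weight (k.take (j + 1)))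
            * ((2 * Real.pi) ^ (2 * t.2.1) / (2 * ((2 * t.2.1).factorial : ℝ)))
            * (bernoulli (2 * t.2.1) : ℝ)
            * MZV.zetaStarReg (k.take i)
            * MZV.zetaTaylor t.1 ((k.take j).drop i).reverse
            * MZV.zetaTaylor t.2.2 (k.drop (j + 1)) := by
  have h1 : ∑ j : Fin k.length, ∑ i ∈ Finset.range (j + 1), ∑ t ∈ MZV.triples (k.get j),
          (-1 : ℝ) ^ (t.2.1 + i + t.2.2 + MZV.weight (k.take (j + 1)))
            * ((2 * Real.pi) ^ (2 * t.2.1) / (2 * ((2 * t.2.1).factorial : ℝ)))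
            * (bernoulli (2 * t.2.1) : ℝ)
            * MZV.zetaStarReg (k.take i)
            * MZV.zetaTaylor t.1 ((k.take j).drop i).reverse
            * MZV.zetaTaylor t.2.2 (k.drop (j + 1)) =
      ∑ i ∈ Finset.range k.length, ∑ j ∈ Finset.Ico i k.length, MZV.parityTerm k i j := by
    rw [Finset.range_eq_Ico, Finset.sum_Ico_Ico_comm, ← Finset.range_eq_Ico,
      ← Fin.sum_univ_eq_sum_range
        (fun j => ∑ i ∈ Finset.Ico 0 (j + 1), MZV.parityTerm k i j)]
    refine Finset.sum_congr rfl fun j _ => ?_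
    rw [Finset.range_eq_Ico]
    refine Finset.sum_congr rfl fun i _ => ?_
    rw [MZV.parityTerm, List.getD_eq_getElem _ _ j.isLt]
    rfl
  have hodd : Odd (k.length + MZV.weight k) := by
    rw [Nat.ModEq] at hpar
    rw [Nat.odd_iff]
    omega
  have h2 := MZV.zetaReg_eq_conv k
  rw [MZV.conv_eq_sum, Finset.sum_range_succ, List.take_length, List.drop_length,
    MZV.symmetricSum_nil] at h2
  -- The term with empty second factor: weight plus length is odd, so the star value of the whole
  -- index enters with sign `-1`.
  have h3 : (MZV.weightSign k * (MZV.lengthSign k * MZV.zetaStarReg k) : ℝ) =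
      -MZV.zetaStarReg k := by
    rw [MZV.weightSign, MZV.lengthSign, ← mul_assoc, ← pow_add, add_comm, hodd.neg_one_pow]
    ring
  have h4 : ∀ i ∈ Finset.range k.length, (MZV.weightSign (k.take i) * (MZV.lengthSign (k.take i) *
      MZV.zetaStarReg (k.take i)) * MZV.symmetricSum (k.drop i) : ℝ) =
      -((-1 : ℝ) ^ (k.length - i) * MZV.zetaStarReg (k.take i) * MZV.deltaTerm (k.drop i)) -
        2 * ∑ j ∈ Finset.Ico i k.length, MZV.parityTerm k i j := by
    intro i hi
    have hi' := Finset.mem_range.1 hi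
    have h5 := MZV.sign_mul_symmetricSum_drop k i
    have h6 := MZV.sign_mul_deltaTerm k hpar hi'
    rw [MZV.weightSign, MZV.lengthSign, List.length_take, min_eq_left hi'.le]
    rw [pow_add] at h5 h6
    linear_combination h5 + MZV.zetaStarReg (k.take i) * h6
  rw [h3, Finset.sum_congr rfl h4, Finset.sum_sub_distrib, Finset.sum_neg_distrib,
    ← Finset.mul_sum] at h2
  rw [h1]
  -- The relation `h2` expresses `ζ^* + ζ^{⋆,*}` by the remaining terms. Half of it, added to `(ζ^*
  -- - ζ^{⋆,*}) / 2`, recovers `ζ^*`.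
  linear_combination h2 / 2
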